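/- Let $r\ge 1$, $\hbar,\Lambda\in\mathbb{C}^*$, $\mathbf P=(P_1,\dots,P_r)\in\mathbb{C}^r$, $\mathbf Q=(Q_1,\dots,Q_{r-1})\in\mathbb{C}^{r-1}$, and assume the genericity conditions $P_b-P_c\notin\hbar\mathbb{Z}$ and $Q_b-Q_c\notin\hbar\mathbb{Z}$ for $b\ne c$, and $P_b+Q_c\notin\hbar\mathbb{Z}$ for all $b,c$. Write $[k]=\{1,\dots,k\}$, $[u]_k=u(u+1)\cdots(u+k-1)$, $|\mathbf P|=\sum_{c=1}^r P_c$, $|\mathbf Q|=\sum_{c=1}^{r-1} Q_c$, and $$z=\frac{x}{\hbar(-\Lambda)^r}.$$ Powers of $z$ and $\arg z\in(-\pi,\pi]$ are principal. Fix $a\in[r]$ and let $\delta_{c,a}$ be the Kronecker symbol; here $c\in[r-1]$, so that $\delta_{c,a}=0$ for all $c$ if $a=r$. Analytic basis (for $d\in[r]$): $$\chi_{a,d}(x)=\frac{\prod_{c=1}^{r-1}\Gamma\big(1-\delta_{c,a}-\tfrac{P_d+Q_c}{\hbar}\big)}{\prod_{c\neq d}\Gamma\big(1-\tfrac{P_d-P_c}{\hbar}\big)}\;z^{-P_d/\hbar}\;{}_{r-1}F_{r-1}\!\left[\begin{smallmatrix}\big(1-\delta_{c,a}-\hbar^{-1}(P_d+Q_c)\big)_{c=1}^{r-1}\\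 \big(1-\hbar^{-1}(P_d-P_c)\big)_{c\neq d}\end{smallmatrix}\right](z).$$ Formal basis: for $b\in[r-1]$, $$\overline\psi_{a,b}(x)=(-1)^{\delta_{b\neq a}}\frac{\prod_{c\neq b}\Gamma\big(\tfrac{Q_b-Q_c}{\hbar}+\delta_{b,a}-\delta_{c,a}\big)}{\prod_{c=1}^r\Gamma\big(\tfrac{Q_b+P_c}{\hbar}+\delta_{b,a}\big)}\;z^{Q_b/\hbar-1+\delta_{b,a}}\;{}_{r}F_{r-2}\!\left[\begin{smallmatrix}\big(-\frac{Q_b+P_c}{\hbar}+1-\delta_{b,a}\big)_{c=1}^{r}\\ \big(\frac{Q_c-Q_b}{\hbar}+1+\delta_{c,a}-\delta_{b,a}\big)_{c\neq b}\end{smallmatrix}\right]\!\big(-z^{-1}\big),$$ where ${}_rF_{r-2}$ is a formal power series in $z^{-1}$ and $(-1)^{\delta_{b\ne a}}$ equals $1$ if $b=a$ and $-1$ otherwise; and $$\overline\psi_{a,r}(x)=e^{z}\,z^{-\hbar^{-1}(|\mathbf P|+|\mathbf Q|)-1+\delta_{a,r}}\sum_{k\ge0}c_{k,a}z^{-k},$$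 $$c_{k,a}=\sum_{\substack{k_1,\dots,k_{r-1}\ge0\\k_1+\cdots+k_{r-1}=k}}\ \prod_{c=1}^{r-1}\frac{\big[\frac{P_{c+2}+Q_c}{\hbar}+\delta_{c,a}\big]_{k_c}\big[k_1+\cdots+k_{c-1}+\sum_{d=1}^{c}\big(\frac{P_{d+1}+Q_d}{\hbar}+\delta_{d,a}\big)\big]_{k_c}}{k_c!},\qquad P_{r+1}:=P_1 .$$ For a formal expression $\overline\psi=p(x)\sum_{k\ge0}u_kz^{-k}$ and a function $f$, write $\overline\psi\approx f$ if for every $N\ge0$ one has $f(x)-p(x)\sum_{k<N}u_kz^{-k}=O\big(p(x)z^{-N}\big)$ as $x\to\infty$, uniformly in the stated range of $\arg z$. Then: (i) For $b\in[r-1]$, as $x\to\infty$ in all directions, $$\overline\psi_{a,b}(x)\approx\frac1\pi\sum_{d=1}^r\frac{(-1)^{\delta_{b\neq a}}\prod_{c=1}^{r-1}\sin\big(\frac{\pi(P_d+Q_c)}{\hbar}\big)\prod_{c=1}^r\sin\big(\frac{\pi(P_c+Q_b)}{\hbar}\big)}{\sin\big(\frac{\pi(P_d+Q_b)}{\hbar}\big)\prod_{c\neq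 b}\sin\big(\frac{\pi(Q_b-Q_c)}{\hbar}\big)\prod_{c\neq d}\sin\big(\frac{\pi(P_d-P_c)}{\hbar}\big)}\;\chi_{a,d}(x).$$ (ii) As $x\to\infty$ with $0\le\arg z\le\pi$ (upper sign), respectively with $-\pi<\arg z\le0$ (lower sign), $$\overline\psi_{a,r}(x)\approx\sum_{d=1}^r\frac{e^{\mp{\rm i}\pi\hbar^{-1}(|\mathbf P|+|\mathbf Q|-P_d)}\prod_{c=1}^{r-1}\sin\big(\frac{\pi(P_d+Q_c)}{\hbar}\big)}{\prod_{c\neq d}\sin\big(\frac{\pi(P_d-P_c)}{\hbar}\big)}\;\chi_{a,d}(x).$$ -/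

import Mathlib

noncomputable section

namespace CDO

/-- The `k`-th coefficient `∏ [α i]_k / (∏ [β j]_k · k!)` of the generalised hypergeometric series
`∑ₖ coeffₖ zᵏ` with numerator parameters `α` and denominator parameters `β`. -/
def hypCoeff {ι κ : Type*} [Fintype ι] [Fintype κ] (α : ι → ℂ) (β : κ → ℂ) (k : ℕ) : ℂ :=
  (∏ i, (ascPochhammer ℂ k).eval (α i)) /
    ((∏ j, (ascPochhammer ℂ k).eval (β j)) * (k.factorial : ℂ))

/-- The generalised hypergeometric function. It is used only with equally many numerator and
denominator parameters, where the series converges for every `z`. -/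
def hypF {ι κ : Type*} [Fintype ι] [Fintype κ] (α : ι → ℂ) (β : κ → ℂ) (z : ℂ) : ℂ :=
  ∑' k : ℕ, hypCoeff α β k * z ^ k

/-- A formal expression `e^{growth · z} z^{exponent} ∑ₖ coeff k · z^{-k}` with `z = x / scale`;
the series need not converge. -/
structure FormalSol where
  scale : ℂ
  growth : ℂ
  exponent : ℂ
  coeff : ℕ → ℂ

/-- The prefactor `e^{growth · z} z^{exponent}`, `z = x / scale`, with the principal power. -/
def FormalSol.prefactor (ψ : FormalSol) (x : ℂ) : ℂ :=
  Complex.exp (ψ.growth * (x / ψ.scale)) * (x / ψ.scale) ^ ψ.exponent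

/-- `ψ ≈ f` along the filter `l` (a filter at infinity): `ψ` is the all-order Poincaré asymptotic
expansion of `f`, that is, for every `N`,
`f = prefactor · (∑_{k < N} coeff k · z^{-k} + O(z^{-N}))`, `z = x / scale`. -/
def FormalSol.IsAsymptoticTo (ψ : FormalSol) (l : Filter ℂ) (f : ℂ → ℂ) : Prop :=
  ∀ N : ℕ,
    (fun x : ℂ => f x - ψ.prefactor x *
        ∑ k ∈ Finset.range N, ψ.coeff k * ((x / ψ.scale) ^ k)⁻¹)
      =O[l] (fun x : ℂ => ψ.prefactor x * ((x / ψ.scale) ^ N)⁻¹)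

variable {n : ℕ}

/- Throughout `r = n + 1`; the set `[r]` is `Fin (n + 1)`, its subset `[r - 1]` is `Fin n`
(embedded by `Fin.castSucc`), and the element `r` is `Fin.last n`. -/

/-- The natural scale `ħ (-Λ)^r` of the variable `x`. -/
def scale (n : ℕ) (hbar Λ : ℂ) : ℂ := hbar * (-Λ) ^ (n + 1)

/-- Kronecker symbol `δ_{c,a}` for `a ∈ [r]` and `c ∈ [r - 1]` (always `0` when `a = r`). -/
def delta (a : Fin (n + 1)) (c : Fin n) : ℂ := if c.castSucc = a then 1 else 0

/-- The analytic solution `χ_{a,b}(x)`, for `a, b ∈ [r]`. -/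
def chi (P : Fin (n + 1) → ℂ) (Q : Fin n → ℂ) (hbar Λ : ℂ) (a b : Fin (n + 1)) (x : ℂ) : ℂ :=
  (∏ c : Fin n, Complex.Gamma (1 - (P b + Q c) / hbar - delta a c)) /
      (∏ c : {c : Fin (n + 1) // c ≠ b}, Complex.Gamma (1 - (P b - P c) / hbar)) *
    (x / scale n hbar Λ) ^ (-P b / hbar) *
    hypF (fun c : Fin n => 1 - delta a c - (P b + Q c) / hbar)
      (fun c : {c : Fin (n + 1) // c ≠ b} => 1 - (P b - P c) / hbar)
      (x / scale n hbar Λ)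

/-- The formal solution `ψ̄_{a,b}(x)`, for `a ∈ [r]` and `b ∈ [r - 1]`: up to normalisation
`x^{Q_b/ħ - 1 + δ_{b,a}}` times the formal series `ᵣF_{r-2}` in `-ħ (-Λ)^r / x`. -/
def psiBar (P : Fin (n + 1) → ℂ) (Q : Fin n → ℂ) (hbar Λ : ℂ) (a : Fin (n + 1)) (b : Fin n) :
    FormalSol where
  scale := scale n hbar Λ
  growth := 0
  exponent := Q b / hbar - 1 + delta a b
  coeff k :=
    (if b.castSucc = a then 1 else -1) *
      ((∏ c : {c : Fin n // c ≠ b},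
          Complex.Gamma ((Q b - Q c) / hbar + delta a b - delta a c)) /
        (∏ c : Fin (n + 1), Complex.Gamma ((Q b + P c) / hbar + delta a b))) *
      (hypCoeff (fun c : Fin (n + 1) => -(Q b + P c) / hbar + 1 - delta a b)
        (fun c : {c : Fin n // c ≠ b} => (Q c - Q b) / hbar + 1 + delta a c - delta a b) k *
        (-1) ^ k)

/-- The coefficient `c_{k,a}`: the sum over `(k₁, …, k_{r-1})` of total `k` of
`∏_c [(P_{c+2} + Q_c)/ħ + δ_{c,a}]_{k_c}
  [k₁ + ⋯ + k_{c-1} + ∑_{d ≤ c} ((P_{d+1} + Q_d)/ħ + δ_{d,a})]_{k_c} / k_c!`,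
with `P_{r+1} = P_1`. As `c : Fin n`, the index `c.succ` is the one written `c + 1` above, and
addition in `Fin (n + 1)` is cyclic. -/
def expCoeff (P : Fin (n + 1) → ℂ) (Q : Fin n → ℂ) (hbar : ℂ) (a : Fin (n + 1)) (k : ℕ) : ℂ :=
  ∑ κ ∈ Finset.Nat.antidiagonalTuple n k,
    ∏ c : Fin n,
      (ascPochhammer ℂ (κ c)).eval ((P (c.succ + 1) + Q c) / hbar + delta a c) *
        (ascPochhammer ℂ (κ c)).eval
          ((∑ d ∈ Finset.Iio c, (κ d : ℂ)) +
            ∑ d ∈ Finset.Iic c, ((P d.succ + Q d) / hbar + delta a d)) /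
        ((κ c).factorial : ℂ)

/-- The formal solution `ψ̄_{a,r}(x)`, for `a ∈ [r]`. -/
def psiBarLast (P : Fin (n + 1) → ℂ) (Q : Fin n → ℂ) (hbar Λ : ℂ) (a : Fin (n + 1)) :
    FormalSol where
  scale := scale n hbar Λ
  growth := 1
  exponent := -((∑ c, P c) + ∑ c, Q c) / hbar - (if a = Fin.last n then 0 else 1)
  coeff := expCoeff P Q hbar a

end CDO

end

/-! Put `p = P/ħ`, `q = Q/ħ + δ` and `w = log z`. The shift by `δ` changes the sines only by signs,
and `χ_d` becomes `∑ₖ g(p_d - k) e^{w(k - p_d)}` with `g(s) = ∏ Γ(1 - q_c - s) / ∏ Γ(1 + p_c - s)`,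
an entire function of `w`. Everything is proved in the variable `w`, so that branches of powers
become horizontal lines and monodromy becomes `w ↦ w + 2πi`.

Algebraic solutions. The integrand `∏ Γ(s - p_c) Γ(1 - q_b - s) / ∏_{c ≠ b} Γ(s + q_c)` decays like
`e^{-3π|Im s|/2}` up to powers, so its integral against `z^{-s}` converges for `|Im w| ≤ π`. Closing
the contour to the left (`BarnesIntegrand.exists_sum_eq`) produces a combination of the `χ_d`;
shifting it to the right produces the formal series, with a remainder controlled by the real part of
the new contour (`exists_norm_sum_analyticSol_sub_le`).

Exponential solution. Iterating Gauss's summation theorem expands `g(p_d - k)` in reciprocal Gamma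
functions `1/Γ(k + α + j)` (`isBigO_gammaProdQuot_sub`), and `∑ zᵏ/Γ(k + α)` is `e^z z^{1-α}` up to
polynomially bounded terms. Hence on the positive axis every `χ_d` has the same expansion `e^z
z^{-μ} ∑ c_k z^{-k}`, where `μ = ∑ p + ∑ q`. The connection coefficients sum to `1` by Lagrange
interpolation (`sum_exp_mul_sinQuot`), so the stated combination has this expansion there too.

To leave the axis, divide the combination by `e^z z^{-μ}`. On `arg z = π` the combination is a
Mellin–Barnes integral with no poles far to the right. Pushing the contour to the right bounds it by
`e^{-|z|}` times a power, which compensates the factor `e^{-z}`. On `arg z = π/2, 3π/2` the same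
integral grows at most polynomially and `|e^{-z}| = 1`. On `arg z = 2π` monodromy turns the
coefficients into those with the opposite exponential, which again sum to `1`. Phragmén–Lindelöf on
four quarter-plane strips gives polynomial growth of the quotient for `0 ≤ Im w ≤ 2π`. A second
application, on the whole strip and after subtracting a partial sum, carries the error bound from
the two edges to the interior (`exists_norm_dominantRatio_sub_le`). The lower half of this strip, `0
≤ Im w ≤ π`, is the upper-sign statement; the upper half, translated by `-2πi`, is the lower-sign
one. -/

noncomputable section

/-! ### Decay of the Gamma function and its reciprocal on vertical strips -/

namespace CDO

open Complex Filter Topology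

/-- `f` is bounded on vertical strips by a power of `|Im s|` times `e^{-κ |Im s|}`, away from the
real axis. -/
def StripDecay (f : ℂ → ℂ) (κ : ℝ) : Prop :=
  ∀ σ₁ σ₂ : ℝ, ∃ C : ℝ, 0 ≤ C ∧ ∃ A : ℕ, ∃ T : ℝ, 1 ≤ T ∧ ∀ s : ℂ, σ₁ ≤ s.re → s.re ≤ σ₂ →
    T ≤ |s.im| → ‖f s‖ ≤ C * |s.im| ^ A * Real.exp (-κ * |s.im|)

lemma StripDecay.mul {f g : ℂ → ℂ} {κ l : ℝ} (hf : StripDecay f κ) (hg : StripDecay g l) :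
    StripDecay (fun s => f s * g s) (κ + l) := by
  intro σ₁ σ₂
  obtain ⟨C, hC, A, T, hT, h⟩ := hf σ₁ σ₂
  obtain ⟨C', hC', A', T', hT', h'⟩ := hg σ₁ σ₂
  refine ⟨C * C', by positivity, A + A', max T T', le_max_of_le_left hT, fun s h1 h2 h3 => ?_⟩
  rw [norm_mul]
  calc _ ≤ (C * |s.im| ^ A * Real.exp (-κ * |s.im|)) *
        (C' * |s.im| ^ A' * Real.exp (-l * |s.im|)) :=
        mul_le_mul (h s h1 h2 (le_trans (le_max_left _ _) h3))
          (h' s h1 h2 (le_trans (le_max_right _ _) h3)) (norm_nonneg _) (by positivity)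
    _ = _ := by
      rw [show -(κ + l) * |s.im| = -κ * |s.im| + -l * |s.im| by ring, Real.exp_add, pow_add]; ring

lemma StripDecay.one : StripDecay (fun _ => 1) 0 := by
  intro σ₁ σ₂
  exact ⟨1, zero_le_one, 0, 1, le_rfl, fun s _ _ _ => by simp⟩

lemma StripDecay.prod {ι : Type*} (S : Finset ι) {f : ι → ℂ → ℂ} {κ : ℝ}
    (hf : ∀ i, StripDecay (f i) κ) : StripDecay (fun s => ∏ i ∈ S, f i s) (S.card * κ) := by
  classical
  induction S using Finset.induction_on with
  | empty => simpa using StripDecay.one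
  | insert a S ha ih =>
    have := (hf a).mul ih
    simp only [Finset.prod_insert ha, Finset.card_insert_of_notMem ha]
    convert this using 1
    push_cast; ring

/-- Translation and reflection of the argument enlarge `|Im s|` by at most `|Im p|`, which costs a
factor `2 ^ A` once `|Im s| ≥ |Im p|` and a factor `e^{|κ| |Im p|}` in the exponential. -/
lemma StripDecay.comp_affine {f : ℂ → ℂ} {κ : ℝ} (hf : StripDecay f κ) (p : ℂ) {e : ℝ}
    (he : |e| = 1) : StripDecay (fun s => f (p + e * s)) κ := by
  intro σ₁ σ₂
  obtain ⟨C, hC, A, T, hT, h⟩ :=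
    hf (p.re - (|σ₁| + |σ₂|)) (p.re + (|σ₁| + |σ₂|))
  refine ⟨C * 2 ^ A * Real.exp (|κ| * |p.im|), by positivity, A, T + |p.im|,
    by linarith [abs_nonneg p.im], fun s h1 h2 h3 => ?_⟩
  have hre : (p + e * s).re = p.re + e * s.re := by simp
  have him : (p + e * s).im = p.im + e * s.im := by simp
  have hsre : |e * s.re| ≤ |σ₁| + |σ₂| := by
    rw [abs_mul, he, one_mul, abs_le]
    constructor
    · linarith [neg_abs_le σ₁, abs_nonneg σ₂]
    · linarith [le_abs_self σ₂, abs_nonneg σ₁]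
  have hsim : |e * s.im| = |s.im| := by rw [abs_mul, he, one_mul]
  have k1 : |s.im| - |p.im| ≤ |p.im + e * s.im| := by
    have := abs_sub_abs_le_abs_sub (e * s.im) (-p.im)
    rw [abs_neg, hsim, sub_neg_eq_add, add_comm (e * s.im)] at this
    exact this
  have k2 : |p.im + e * s.im| ≤ |p.im| + |s.im| := by
    rw [← hsim]; exact abs_add_le _ _
  have := h (p + e * s) (by rw [hre]; linarith [neg_le_of_abs_le hsre])
    (by rw [hre]; linarith [le_of_abs_le hsre]) (by rw [him]; linarith)
  rw [him] at this
  refine this.trans ?_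
  have e1 : |p.im + e * s.im| ^ A ≤ 2 ^ A * |s.im| ^ A := by
    rw [← mul_pow]
    exact pow_le_pow_left₀ (abs_nonneg _) (by linarith) _
  have e2 : Real.exp (-κ * |p.im + e * s.im|) ≤
      Real.exp (|κ| * |p.im|) * Real.exp (-κ * |s.im|) := by
    rw [← Real.exp_add]
    apply Real.exp_le_exp.2
    have : κ * (|s.im| - |p.im + e * s.im|) ≤ |κ| * |p.im| := by
      refine (le_abs_self _).trans ?_
      rw [abs_mul]
      exact mul_le_mul_of_nonneg_left (abs_le.2 ⟨by linarith, by linarith⟩) (abs_nonneg _)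
    linarith
  calc C * |p.im + e * s.im| ^ A * Real.exp (-κ * |p.im + e * s.im|)
      ≤ C * (2 ^ A * |s.im| ^ A) * (Real.exp (|κ| * |p.im|) * Real.exp (-κ * |s.im|)) := by gcongr
    _ = _ := by ring

/-- Since `Re v ≥ 1`, the factor `(1 - x)^{v - 1}` has modulus at most `1`. The resulting bound does
not involve the imaginary parts. -/
lemma norm_betaIntegral_le {u v : ℂ} (hu : 0 < u.re) (hv : 1 ≤ v.re) :
    ‖betaIntegral u v‖ ≤ 1 / u.re := by
  have h1 : ∫ x : ℝ in (0 : ℝ)..1, x ^ (u.re - 1) = 1 / u.re := by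
    rw [integral_rpow (Or.inl (by linarith))]
    simp [Real.zero_rpow hu.ne']
  rw [← h1]
  refine intervalIntegral.norm_integral_le_of_norm_le zero_le_one ?_
    (intervalIntegral.intervalIntegrable_rpow' (by linarith))
  filter_upwards [MeasureTheory.Measure.ae_ne MeasureTheory.volume (1 : ℝ)] with x hx1 hx
  have hx0 : 0 < x := hx.1
  have hx2 : 0 < 1 - x := by
    have := lt_of_le_of_ne hx.2 hx1
    linarith
  rw [norm_mul, Complex.norm_cpow_eq_rpow_re_of_pos hx0,
    show (1 - (x : ℂ)) = ((1 - x : ℝ) : ℂ) by push_cast; ring,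
    Complex.norm_cpow_eq_rpow_re_of_pos hx2]
  have : (1 - x) ^ (v - 1).re ≤ 1 :=
    Real.rpow_le_one hx2.le (by linarith) (by simp; linarith)
  calc _ ≤ x ^ (u - 1).re * 1 := by gcongr
    _ = _ := by simp

/-- On the critical line `1 - s` is the conjugate of `s`, so the reflection formula reads `|Γ(s)|² =
π / cosh(π t)`. -/
lemma norm_Gamma_half_add_le (t : ℝ) :
    ‖Gamma (1 / 2 + t * I)‖ ≤ 4 * Real.exp (-(Real.pi / 2) * |t|) := by
  have h := Complex.Gamma_mul_Gamma_one_sub (1 / 2 + t * I)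
  have hc : (1 : ℂ) - (1 / 2 + t * I) = (starRingEnd ℂ) (1 / 2 + t * I) := by
    simp [Complex.ext_iff]
    norm_num
  rw [hc, Complex.Gamma_conj, Complex.mul_conj, show (Real.pi : ℂ) * (1 / 2 + t * I) =
    (Real.pi * t : ℝ) * I + Real.pi / 2 by push_cast; ring, Complex.sin_add_pi_div_two,
    Complex.cos_mul_I] at h
  have h2 : ‖Gamma (1 / 2 + t * I)‖ ^ 2 = Real.pi / Real.cosh (Real.pi * t) := by
    rw [← Complex.ofReal_inj, ← Complex.normSq_eq_norm_sq, h]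
    push_cast; ring
  have h3 : Real.pi / Real.cosh (Real.pi * t) ≤ (4 * Real.exp (-(Real.pi / 2) * |t|)) ^ 2 := by
    rw [mul_pow, ← Real.exp_nat_mul, div_le_iff₀ (Real.cosh_pos _), ← Real.cosh_abs, abs_mul,
      abs_of_pos Real.pi_pos, Real.cosh_eq]
    have e1 : Real.exp (((2 : ℕ) : ℝ) * (-(Real.pi / 2) * |t|)) * Real.exp (Real.pi * |t|) = 1 := by
      rw [← Real.exp_add]; simp; ring
    have e2 : 0 < Real.exp (((2 : ℕ) : ℝ) * (-(Real.pi / 2) * |t|)) *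
      Real.exp (-(Real.pi * |t|)) := by positivity
    nlinarith [Real.pi_lt_four]
  rw [← h2] at h3
  exact le_of_sq_le_sq h3 (by positivity) 

lemma norm_Gamma_nat_add_half_le (m : ℕ) : ∃ C : ℝ, 0 ≤ C ∧ ∀ t : ℝ, 1 ≤ |t| →
    ‖Gamma (m + 1 / 2 + t * I)‖ ≤ C * |t| ^ m * Real.exp (-(Real.pi / 2) * |t|) := by
  induction m with
  | zero => exact ⟨4, by norm_num, fun t _ => by simpa using norm_Gamma_half_add_le t⟩
  | succ m ih =>
    obtain ⟨C, hC, h⟩ := ih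
    refine ⟨(m + 2) * C, by positivity, fun t ht => ?_⟩
    have hne : (m + 1 / 2 + t * I : ℂ) ≠ 0 := by
      intro h0
      have := congrArg Complex.im h0
      simp at this
      rw [this] at ht; simp at ht; linarith
    rw [show (((m + 1 : ℕ) : ℂ) + 1 / 2 + t * I) = (m + 1 / 2 + t * I) + 1 by push_cast; ring,
      Complex.Gamma_add_one _ hne, norm_mul]
    have hn : ‖(m + 1 / 2 + t * I : ℂ)‖ ≤ (m + 2) * |t| := by
      calc ‖(m + 1 / 2 + t * I : ℂ)‖ ≤ ‖((m + 1 / 2 : ℝ) : ℂ)‖ + ‖(t * I : ℂ)‖ := by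
            have := norm_add_le (((m + 1 / 2 : ℝ) : ℂ)) (t * I : ℂ)
            push_cast at this ⊢
            exact this
        _ = (m + 1 / 2) + |t| := by
            rw [Complex.norm_real, norm_mul, Complex.norm_real, norm_I, mul_one,
              Real.norm_eq_abs, Real.norm_eq_abs, abs_of_nonneg (by positivity)]
        _ ≤ _ := by nlinarith [(Nat.cast_nonneg m : (0 : ℝ) ≤ m)]
    calc _ ≤ ((m + 2) * |t|) * (C * |t| ^ m * Real.exp (-(Real.pi / 2) * |t|)) :=
          mul_le_mul hn (h t ht) (norm_nonneg _) (by positivity)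
      _ = _ := by ring

/-- The Beta integral replaces Stirling's formula. A real `a ≥ 1` moves `s` onto the line `Re = m +
1/2`, where the decay is known, and `Γ(s) = Γ(s + a) B(s, a) / Γ(a)` with `|B(s, a)| ≤ 1 / Re s`. -/
lemma exists_bound_Gamma_of_pos (σ₁ σ₂ : ℝ) (h1 : 0 < σ₁) : ∃ C : ℝ, 0 ≤ C ∧ ∃ A : ℕ,
    ∀ s : ℂ, σ₁ ≤ s.re → s.re ≤ σ₂ → 1 ≤ |s.im| →
    ‖Gamma s‖ ≤ C * |s.im| ^ A * Real.exp (-(Real.pi / 2) * |s.im|) := by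
  obtain ⟨m, hm⟩ := exists_nat_ge (|σ₂| + 1)
  have hσ := le_abs_self σ₂
  obtain ⟨C, hC, h⟩ := norm_Gamma_nat_add_half_le m
  have hcont : Continuous fun a : ℝ => ‖(Gamma (a : ℂ))⁻¹‖ :=
    (differentiable_one_div_Gamma.continuous.comp continuous_ofReal).norm
  obtain ⟨D, hD⟩ := (isCompact_Icc (a := (1 : ℝ)) (b := m + 1 / 2)).bddAbove_image
    hcont.continuousOn
  have hD0 : 0 ≤ D :=
    (norm_nonneg _).trans (hD ⟨1, ⟨le_rfl, by linarith [abs_nonneg σ₂]⟩, rfl⟩)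
  refine ⟨1 / σ₁ * C * D, by positivity, m, fun s hs1 hs2 ht => ?_⟩
  set a : ℝ := m + 1 / 2 - s.re with ha
  have ha1 : 1 ≤ a := by linarith
  have hspos : 0 < s.re := by linarith
  have hb := Complex.Gamma_mul_Gamma_eq_betaIntegral (s := s) (t := (a : ℂ)) hspos
    (by simp; linarith)
  have hsa : s + a = m + 1 / 2 + s.im * I := by
    apply Complex.ext <;> simp [ha]
  have hGa : Gamma (a : ℂ) ≠ 0 := Complex.Gamma_ne_zero_of_re_pos (by simp; linarith)
  have hG : Gamma s = Gamma (s + a) * betaIntegral s a * (Gamma (a : ℂ))⁻¹ := by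
    rw [← hb]; field_simp
  rw [hG, norm_mul, norm_mul, hsa]
  have b1 := norm_betaIntegral_le (u := s) (v := a) hspos (by simpa using ha1)
  have b2 : 1 / s.re ≤ 1 / σ₁ := one_div_le_one_div_of_le h1 hs1
  have b3 : ‖(Gamma (a : ℂ))⁻¹‖ ≤ D := hD ⟨a, ⟨ha1, by linarith⟩, rfl⟩
  calc _ ≤ (C * |s.im| ^ m * Real.exp (-(Real.pi / 2) * |s.im|)) * (1 / σ₁) * D := by
        refine mul_le_mul (mul_le_mul (h _ ht) (b1.trans b2) (norm_nonneg _) (by positivity)) b3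
          (norm_nonneg _) (by positivity)
    _ = _ := by ring

/-- For `|Im s| ≥ 1` every factor `|s + j|` in the functional equation is at least `1`, so `|Γ(s)| ≤
|Γ(s + m)|`, and a strip reaching to the left of `0` reduces to one on the right. -/
lemma stripDecay_Gamma : StripDecay Gamma (Real.pi / 2) := by
  intro σ₁ σ₂
  have key : ∀ m : ℕ, ∃ C : ℝ, 0 ≤ C ∧ ∃ A : ℕ, ∀ s : ℂ, 1 - (m : ℝ) ≤ s.re → s.re ≤ σ₂ →
      1 ≤ |s.im| → ‖Gamma s‖ ≤ C * |s.im| ^ A * Real.exp (-(Real.pi / 2) * |s.im|) := by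
    intro m
    obtain ⟨C, hC, A, h⟩ := exists_bound_Gamma_of_pos 1 (σ₂ + m) one_pos
    refine ⟨C, hC, A, fun s h1 h2 h3 => ?_⟩
    have step : ∀ j : ℕ, ‖Gamma s‖ ≤ ‖Gamma (s + j)‖ := by
      intro j
      induction j with
      | zero => simp
      | succ j ih =>
        have him : 1 ≤ ‖s + j‖ := by
          refine h3.trans ?_
          simpa using Complex.abs_im_le_norm (s + j)
        have hne : s + j ≠ 0 := by
          intro h0; rw [h0] at him; simp at him; linarith
        rw [Nat.cast_succ, ← add_assoc, Complex.Gamma_add_one _ hne, norm_mul]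
        nlinarith [norm_nonneg (Gamma (s + j))]
    have := h (s + m) (by simp; linarith) (by simp; linarith) (by simpa using h3)
    refine (step m).trans ?_
    simpa using this
  obtain ⟨m, hm⟩ := exists_nat_ge (1 - σ₁)
  obtain ⟨C, hC, A, h⟩ := key m
  exact ⟨C, hC, A, 1, le_rfl, fun s h1 h2 h3 => h s (by linarith) h2 h3⟩

lemma norm_sin_le_exp (z : ℂ) : ‖sin z‖ ≤ Real.exp |z.im| := by
  have e1 : ‖exp (-z * I)‖ ≤ Real.exp |z.im| := by
    rw [Complex.norm_exp]; apply Real.exp_le_exp.2; simpa using le_abs_self _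
  have e2 : ‖exp (z * I)‖ ≤ Real.exp |z.im| := by
    rw [Complex.norm_exp]; apply Real.exp_le_exp.2; simpa using neg_le_abs _
  rw [Complex.sin, norm_div, norm_mul, norm_I, mul_one, Complex.norm_two]
  have := norm_sub_le (exp (-z * I)) (exp (z * I))
  linarith

/-- By reflection `1/Γ(s) = Γ(1 - s) sin(πs)/π`, with exponential rates `π/2` and `-π` adding up to
`-π/2`. -/
lemma stripDecay_Gamma_inv : StripDecay (fun s => (Gamma s)⁻¹) (-(Real.pi / 2)) := by
  have h1 := stripDecay_Gamma.comp_affine 1 (e := -1) (by simp)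
  have h2 : StripDecay (fun s => sin (Real.pi * s) / Real.pi) (-Real.pi) := by
    intro σ₁ σ₂
    refine ⟨1 / Real.pi, by positivity, 0, 1, le_rfl, fun s _ _ _ => ?_⟩
    rw [norm_div, Complex.norm_real, Real.norm_eq_abs, abs_of_pos Real.pi_pos]
    have := norm_sin_le_exp (Real.pi * s)
    simp only [mul_im, ofReal_re, ofReal_im, zero_mul, add_zero, abs_mul,
      abs_of_pos Real.pi_pos] at this
    rw [pow_zero, mul_one, neg_neg, div_mul_eq_mul_div, one_mul]
    gcongr
  have h3 := h1.mul h2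
  intro σ₁ σ₂
  obtain ⟨C, hC, A, T, hT, h⟩ := h3 σ₁ σ₂
  refine ⟨C, hC, A, T, hT, fun s a b c => ?_⟩
  have hs : (Gamma s)⁻¹ = Gamma (1 + ((-1 : ℝ) : ℂ) * s) * (sin (Real.pi * s) / Real.pi) := by
    have hr := Complex.Gamma_mul_Gamma_one_sub s
    have him : s.im ≠ 0 := by intro h0; rw [h0] at c; simp at c; linarith
    have hsin : sin (Real.pi * s) ≠ 0 := by
      intro h0
      rw [Complex.sin_eq_zero_iff] at h0
      obtain ⟨k, hk⟩ := h0
      have := congrArg Complex.im hk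
      simp [Real.pi_ne_zero] at this
      exact him this
    have hG : Gamma s ≠ 0 := by
      intro h0; rw [h0, zero_mul] at hr
      exact (div_ne_zero (by exact_mod_cast Real.pi_ne_zero) hsin) hr.symm
    have hp : (Real.pi : ℂ) ≠ 0 := by exact_mod_cast Real.pi_ne_zero
    rw [show (1 + ((-1 : ℝ) : ℂ) * s) = 1 - s by push_cast; ring]
    apply inv_eq_of_mul_eq_one_right
    have := (eq_div_iff hsin).1 hr
    rw [← mul_div_assoc, ← mul_div_assoc, div_eq_one_iff_eq hp, ← mul_assoc, this]
  have := h s a b c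
  simp only [← hs] at this
  convert this using 4
  ring

end CDO

end

/-! ### Integrals along vertical lines and explicit integrals of simple fractions -/

noncomputable section

namespace CDO

open Complex Filter Topology MeasureTheory

lemma integrable_of_norm_le_div_sq {φ : ℝ → ℂ} (hφ : Continuous φ) {C T : ℝ}
    (h : ∀ t : ℝ, T ≤ |t| → ‖φ t‖ ≤ C / t ^ 2) : Integrable φ := by
  refine hφ.locallyIntegrable.integrable_of_isBigO_cocompact (g := fun t : ℝ => (1 + t ^ 2)⁻¹) ?_
    (integrable_inv_one_add_sq.integrableAtFilter _)
  refine Asymptotics.IsBigO.of_bound (|C| * 2) ?_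
  have : ∀ᶠ t : ℝ in cocompact ℝ, max T 1 ≤ ‖t‖ :=
    tendsto_norm_cocompact_atTop.eventually_ge_atTop _
  filter_upwards [this] with t ht
  have h1 : 1 ≤ |t| := (le_max_right _ _).trans ht
  have h2 := h t ((le_max_left _ _).trans ht)
  have h3 : 1 ≤ t ^ 2 := by rw [← sq_abs]; nlinarith
  rw [Real.norm_eq_abs, abs_of_nonneg (by positivity : (0 : ℝ) ≤ (1 + t ^ 2)⁻¹)]
  refine h2.trans ?_
  calc C / t ^ 2 ≤ |C| / t ^ 2 := by gcongr; exact le_abs_self _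
    _ = |C| * (t ^ 2)⁻¹ := div_eq_mul_inv _ _
    _ ≤ |C| * (2 * (1 + t ^ 2)⁻¹) := by
        gcongr
        rw [← div_eq_mul_inv, inv_eq_one_div, div_le_div_iff₀ (by linarith) (by linarith)]
        linarith
    _ = _ := by ring

lemma continuous_line {f : ℂ → ℂ} {σ : ℝ} (h : ∀ s : ℂ, s.re = σ → DifferentiableAt ℂ f s) :
    Continuous fun t : ℝ => f (σ + t * I) := by
  rw [continuous_iff_continuousAt]
  intro t
  refine ContinuousAt.comp (f := fun t : ℝ => (σ + t * I : ℂ)) (h _ (by simp)).continuousAt ?_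
  fun_prop

lemma integrable_line {f : ℂ → ℂ} {σ C T : ℝ} (h : ∀ s : ℂ, s.re = σ → DifferentiableAt ℂ f s)
    (hb : ∀ s : ℂ, s.re = σ → T ≤ |s.im| → ‖f s‖ ≤ C / s.im ^ 2) :
    Integrable fun t : ℝ => f (σ + t * I) :=
  integrable_of_norm_le_div_sq (continuous_line h) (C := C) (T := T) fun t ht => by
    simpa using hb (σ + t * I) (by simp) (by simpa using ht)

/-- Cauchy's theorem on the rectangles `|Im s| ≤ R`: the horizontal edges have fixed length and the
integrand is `O(R⁻²)` there. -/
lemma integral_line_eq_of_differentiable {g : ℂ → ℂ} {σ₁ σ₂ C T : ℝ} (hσ : σ₁ ≤ σ₂)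
    (hd : ∀ s : ℂ, σ₁ ≤ s.re → s.re ≤ σ₂ → DifferentiableAt ℂ g s)
    (hb : ∀ s : ℂ, σ₁ ≤ s.re → s.re ≤ σ₂ → T ≤ |s.im| → ‖g s‖ ≤ C / s.im ^ 2) :
    ∫ t : ℝ, g (σ₂ + t * I) = ∫ t : ℝ, g (σ₁ + t * I) := by
  have i1 : Integrable fun t : ℝ => g (σ₁ + t * I) :=
    integrable_line (fun s h => hd s h.ge (h.le.trans hσ))
      (fun s h => hb s h.ge (h.le.trans hσ))
  have i2 : Integrable fun t : ℝ => g (σ₂ + t * I) :=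
    integrable_line (fun s h => hd s (hσ.trans h.ge) h.le)
      (fun s h => hb s (hσ.trans h.ge) h.le)
  have t1 := intervalIntegral_tendsto_integral i1 tendsto_neg_atTop_atBot tendsto_id
  have t2 := intervalIntegral_tendsto_integral i2 tendsto_neg_atTop_atBot tendsto_id
  have key : ∀ R : ℝ, (∫ x : ℝ in σ₁..σ₂, g (x + (-R : ℝ) * I)) -
      (∫ x : ℝ in σ₁..σ₂, g (x + R * I)) + I * (∫ y : ℝ in -R..R, g (σ₂ + y * I)) -
      I * (∫ y : ℝ in -R..R, g (σ₁ + y * I)) = 0 := by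
    intro R
    have := Complex.integral_boundary_rect_eq_zero_of_differentiableOn g (σ₁ + (-R : ℝ) * I)
      (σ₂ + R * I) (fun s hs => by
        rw [mem_reProdIm] at hs
        simp only [add_re, ofReal_re, mul_re, I_re, mul_zero, ofReal_im, I_im, mul_one, sub_self,
          add_zero, Set.uIcc_of_le hσ] at hs
        exact (hd s hs.1.1 hs.1.2).differentiableWithinAt)
    simpa using this
  have edge : ∀ e : ℝ, |e| = 1 →
      Tendsto (fun R : ℝ => ∫ x : ℝ in σ₁..σ₂, g (x + (e * R : ℝ) * I)) atTop (𝓝 0) := by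
    intro e he
    have hz : Tendsto (fun R : ℝ => C / R ^ 2 * |σ₂ - σ₁|) atTop (𝓝 0) := by
      have : Tendsto (fun R : ℝ => C / R ^ 2) atTop (𝓝 0) :=
        (tendsto_const_nhds (x := C)).div_atTop (tendsto_pow_atTop two_ne_zero)
      simpa using this.mul_const |σ₂ - σ₁|
    refine squeeze_zero_norm' ?_ hz
    filter_upwards [eventually_ge_atTop (max T 0)] with R hR
    have hR0 : 0 ≤ R := (le_max_right _ _).trans hR
    refine intervalIntegral.norm_integral_le_of_norm_le_const fun x hx => ?_
    rw [Set.uIoc_of_le hσ] at hx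
    have := hb (x + (e * R : ℝ) * I) (by simpa using hx.1.le) (by simpa using hx.2)
      (by simpa [abs_mul, he, abs_of_nonneg hR0] using (le_max_left _ _).trans hR)
    refine this.trans (le_of_eq ?_)
    have : (e * R) ^ 2 = R ^ 2 := by rw [mul_pow, ← sq_abs e, he]; ring
    simp only [add_im, ofReal_im, mul_im, ofReal_re, I_im, I_re, mul_one, mul_zero, add_zero,
      zero_add, this]
  have e1 := edge (-1) (by simp)
  have e2 := edge 1 (by simp)
  have lim := (((e1.sub e2).add (t2.const_mul I)).sub (t1.const_mul I))
  have hz : (fun R : ℝ => (∫ x : ℝ in σ₁..σ₂, g (x + (-1 * R : ℝ) * I)) -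
      (∫ x : ℝ in σ₁..σ₂, g (x + (1 * R : ℝ) * I)) + I * (∫ y : ℝ in -R..id R, g (σ₂ + y * I)) -
      I * (∫ y : ℝ in -R..id R, g (σ₁ + y * I))) = fun _ => 0 := by
    funext R
    have := key R
    rw [show (-1 * R : ℝ) = -R by ring, one_mul]
    exact this
  have := tendsto_nhds_unique lim (by rw [hz]; exact tendsto_const_nhds)
  rw [sub_zero, zero_add, ← mul_sub, mul_eq_zero] at this
  exact sub_eq_zero.1 (this.resolve_left I_ne_zero)

lemma integral_div_sq_add_sq {α : ℝ} (hα : α ≠ 0) :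
    Integrable (fun t : ℝ => α / (α ^ 2 + t ^ 2)) ∧
    ∫ t : ℝ, α / (α ^ 2 + t ^ 2) = Real.pi * (SignType.sign α : ℝ) := by
  have h : (fun t : ℝ => α / (α ^ 2 + t ^ 2)) = fun t : ℝ => α⁻¹ * (1 + (t / α) ^ 2)⁻¹ := by
    funext t
    have : 0 < α ^ 2 + t ^ 2 := by positivity
    have : 0 < 1 + (t / α) ^ 2 := by positivity
    field_simp
  rw [h]
  refine ⟨(integrable_inv_one_add_sq.comp_div hα).const_mul _, ?_⟩
  rw [integral_const_mul, Measure.integral_comp_div (fun t : ℝ => (1 + t ^ 2)⁻¹),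
    integral_univ_inv_one_add_sq, smul_eq_mul, ← mul_assoc, mul_comm]
  congr 1
  rcases lt_or_gt_of_ne hα with h0 | h0
  · rw [abs_of_neg h0, sign_neg h0]; field_simp; simp
  · rw [abs_of_pos h0, sign_pos h0]; field_simp; simp

/-- A single fraction is not integrable on the line, but a difference of two is `O(t⁻²)`. Averaging
over `t ↦ -t` leaves the real Poisson kernels `γ / (γ² + t²)`, each of integral `π · sign γ`. -/
lemma integral_inv_sub_inv {α β : ℝ} (hα : α ≠ 0) (hβ : β ≠ 0) :
    Integrable (fun t : ℝ => (α + t * I : ℂ)⁻¹ - (β + t * I : ℂ)⁻¹) ∧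
    ∫ t : ℝ, ((α + t * I : ℂ)⁻¹ - (β + t * I : ℂ)⁻¹) =
      Real.pi * ((SignType.sign α : ℝ) - (SignType.sign β : ℝ)) := by
  have hne : ∀ {γ : ℝ}, γ ≠ 0 → ∀ t : ℝ, (γ + t * I : ℂ) ≠ 0 := by
    intro γ hγ t h0
    exact hγ (by simpa using congrArg Complex.re h0)
  have hcont : ∀ {γ : ℝ}, γ ≠ 0 → Continuous fun t : ℝ => (γ + t * I : ℂ)⁻¹ := by
    intro γ hγ
    exact Continuous.inv₀ (by fun_prop) (hne hγ)
  have habs : ∀ (γ t : ℝ), |t| ≤ ‖(γ + t * I : ℂ)‖ := by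
    intro γ t
    simpa using Complex.abs_im_le_norm (γ + t * I)
  have hi : Integrable (fun t : ℝ => (α + t * I : ℂ)⁻¹ - (β + t * I : ℂ)⁻¹) := by
    refine integrable_of_norm_le_div_sq ((hcont hα).sub (hcont hβ)) (C := |β - α|) (T := 1) ?_
    intro t ht
    rw [inv_sub_inv (hne hα t) (hne hβ t), norm_div, norm_mul,
      show (β + t * I - (α + t * I) : ℂ) = ((β - α : ℝ) : ℂ) by push_cast; ring, Complex.norm_real,
      Real.norm_eq_abs, ← sq_abs t, sq]
    have := habs α t
    have := habs β t
    gcongr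
  refine ⟨hi, ?_⟩
  have h1 : ∫ t : ℝ, ((α + t * I : ℂ)⁻¹ - (β + t * I : ℂ)⁻¹) =
      ∫ t : ℝ, ((α + (-t : ℝ) * I : ℂ)⁻¹ - (β + (-t : ℝ) * I : ℂ)⁻¹) :=
    (integral_neg_eq_self (fun t : ℝ => ((α + t * I : ℂ)⁻¹ - (β + t * I : ℂ)⁻¹)) volume).symm
  have hi' : Integrable (fun t : ℝ => (α + (-t : ℝ) * I : ℂ)⁻¹ - (β + (-t : ℝ) * I : ℂ)⁻¹) :=
    hi.comp_neg
  have h2 : ∀ {γ : ℝ}, γ ≠ 0 → ∀ t : ℝ, (γ + t * I : ℂ)⁻¹ + (γ + (-t : ℝ) * I : ℂ)⁻¹ =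
      ((2 * (γ / (γ ^ 2 + t ^ 2)) : ℝ) : ℂ) := by
    intro γ hγ t
    have hp : (γ ^ 2 + t ^ 2 : ℂ) = (γ + t * I) * (γ + (-t : ℝ) * I) := by
      push_cast; ring_nf; rw [I_sq]; ring
    have a1 := hne hγ t
    have a2 := hne hγ (-t)
    simp only [ofReal_mul, ofReal_div, ofReal_add, ofReal_pow, ofReal_ofNat]
    rw [hp, inv_add_inv a1 a2, ← mul_div_assoc]
    push_cast
    congr 1
    ring
  have h3 : 2 * ∫ t : ℝ, ((α + t * I : ℂ)⁻¹ - (β + t * I : ℂ)⁻¹) =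
      ∫ t : ℝ, ((2 * (α / (α ^ 2 + t ^ 2) - β / (β ^ 2 + t ^ 2)) : ℝ) : ℂ) := by
    rw [two_mul]
    nth_rewrite 2 [h1]
    rw [← integral_add hi hi']
    congr 1
    funext t
    have e1 := h2 hα t
    have e2 := h2 hβ t
    push_cast at e1 e2 ⊢
    linear_combination e1 - e2
  rw [show (∫ t : ℝ, ((2 * (α / (α ^ 2 + t ^ 2) - β / (β ^ 2 + t ^ 2)) : ℝ) : ℂ)) =
    ((∫ t : ℝ, 2 * (α / (α ^ 2 + t ^ 2) - β / (β ^ 2 + t ^ 2)) : ℝ) : ℂ) from integral_ofReal,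
    integral_const_mul, integral_sub (integral_div_sq_add_sq hα).1
    (integral_div_sq_add_sq hβ).1, (integral_div_sq_add_sq hα).2,
    (integral_div_sq_add_sq hβ).2] at h3
  have h4 := mul_left_cancel₀ (two_ne_zero) (h3.trans (by push_cast; rfl :
    _ = (2 : ℂ) * (((Real.pi * (SignType.sign α : ℝ) - Real.pi * (SignType.sign β : ℝ) : ℝ)) : ℂ)))
  rw [h4]; push_cast; ring

lemma integral_line_inv_sub_inv {a : ℂ} {l σ : ℝ} (h1 : σ ≠ a.re) (h2 : σ ≠ a.re + l) :
    Integrable (fun t : ℝ => ((σ + t * I) - a)⁻¹ - ((σ + t * I) - (a + l))⁻¹) ∧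
    ∫ t : ℝ, (((σ + t * I) - a)⁻¹ - ((σ + t * I) - (a + l))⁻¹) =
      Real.pi * ((SignType.sign (σ - a.re) : ℝ) - (SignType.sign (σ - (a.re + l)) : ℝ)) := by
  have h := integral_inv_sub_inv (sub_ne_zero.2 h1) (sub_ne_zero.2 h2)
  have e : (fun t : ℝ => ((σ + t * I) - a)⁻¹ - ((σ + t * I) - (a + l))⁻¹) = fun t : ℝ =>
      (fun t : ℝ => (((σ - a.re : ℝ) : ℂ) + t * I)⁻¹ - (((σ - (a.re + l) : ℝ) : ℂ) + t * I)⁻¹)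
        (t - a.im) := by
    funext t
    have ha := Complex.re_add_im a
    simp only
    congr 2
    · push_cast; linear_combination ha
    · push_cast; linear_combination ha
  rw [e]
  refine ⟨h.1.comp_sub_right a.im, ?_⟩
  rw [integral_sub_right_eq_self (fun t : ℝ => (((σ - a.re : ℝ) : ℂ) + t * I)⁻¹ -
    (((σ - (a.re + l) : ℝ) : ℂ) + t * I)⁻¹) a.im]
  exact h.2

end CDO

end

/-! ### Shifting a contour across finitely many simple poles -/

noncomputable section

namespace CDO

open Complex Filter Topology MeasureTheory

/-- A differentiable-off-finitely-many-points function whose singularities are weaker than simple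
poles agrees off these points with one that is differentiable throughout. -/
lemma exists_differentiable_extension {ι : Type*} [Finite ι] {a : ι → ℂ} {f : ℂ → ℂ} {S : Set ℂ}
    (hS : ∀ i, ∀ᶠ s in 𝓝 (a i), s ∈ S)
    (hd : ∀ s ∈ S, (∀ i, s ≠ a i) → DifferentiableAt ℂ f s)
    (h0 : ∀ i, Tendsto (fun s => (s - a i) * f s) (𝓝[≠] (a i)) (𝓝 0)) :
    ∃ g : ℂ → ℂ, (∀ s, (∀ i, s ≠ a i) → g s = f s) ∧ ∀ s ∈ S, DifferentiableAt ℂ g s := by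
  classical
  have hfin : (Set.range a).Finite := Set.finite_range a
  let g : ℂ → ℂ := fun s => if s ∈ Set.range a then limUnder (𝓝[≠] s) f else f s
  have hg : ∀ s, (∀ i, s ≠ a i) → g s = f s := fun s hs =>
    if_neg fun ⟨i, hi⟩ => hs i hi.symm
  refine ⟨g, hg, fun s hs => ?_⟩
  by_cases h : s ∈ Set.range a
  · obtain ⟨i, rfl⟩ := h
    have hne : ∀ᶠ s in 𝓝 (a i), s ∉ Set.range a \ {a i} :=
      (hfin.subset Set.sdiff_subset).isClosed.isOpen_compl.mem_nhds (by simp)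
    have hU : {s | s ∈ S ∧ s ∉ Set.range a \ {a i}} ∈ 𝓝 (a i) := (hS i).and hne
    have hd' : DifferentiableOn ℂ f ({s | s ∈ S ∧ s ∉ Set.range a \ {a i}} \ {a i}) := by
      intro z hz
      refine (hd z hz.1.1 fun j hj => ?_).differentiableWithinAt
      exact hz.1.2 ⟨⟨j, hj.symm⟩, hz.2⟩
    -- This is the hypothesis of Riemann's removable singularity theorem in the form `f(z) - f(a) =
    -- o(1/(z - a))`; it follows from `(z - a) f(z) → 0`.
    have ho : (fun z => f z - f (a i)) =o[𝓝[≠] (a i)] fun z => (z - a i)⁻¹ := by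
      rw [Asymptotics.isLittleO_iff_tendsto']
      · have t1 : Tendsto (fun z => (z - a i) * f z - (z - a i) * f (a i)) (𝓝[≠] (a i))
            (𝓝 (0 - 0 * f (a i))) := by
          refine (h0 i).sub (Tendsto.mul_const _ ?_)
          have : Tendsto (fun z => z - a i) (𝓝 (a i)) (𝓝 (a i - a i)) :=
            (continuous_id.sub continuous_const).tendsto _
          rw [sub_self] at this
          exact this.mono_left nhdsWithin_le_nhds
        rw [zero_mul, sub_zero] at t1
        refine t1.congr fun z => ?_
        rw [div_inv_eq_mul]; ring
      · filter_upwards [self_mem_nhdsWithin] with z hz h1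
        exact absurd (inv_eq_zero.1 h1) (sub_ne_zero.2 hz)
    have hup := (differentiableOn_update_limUnder_of_isLittleO hU hd' ho).differentiableAt hU
    refine hup.congr_of_eventuallyEq ?_
    filter_upwards [hne] with z hz
    by_cases hzi : z = a i
    · subst hzi; simp [g]
    · rw [Function.update_of_ne hzi]
      exact hg z fun j hj => hz ⟨⟨j, hj.symm⟩, hzi⟩
  · have hne : ∀ᶠ z in 𝓝 s, z ∉ Set.range a := hfin.isClosed.isOpen_compl.mem_nhds h
    have : g =ᶠ[𝓝 s] f := by
      filter_upwards [hne] with z hz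
      exact hg z fun j hj => hz ⟨j, hj.symm⟩
    exact (hd s hs fun i hi => h ⟨i, hi.symm⟩).congr_of_eventuallyEq this

lemma tendsto_sub_mul_inv_sub (a : ℂ) :
    Tendsto (fun s => (s - a) * (s - a)⁻¹) (𝓝[≠] a) (𝓝 1) := by
  refine tendsto_const_nhds.congr' ?_
  filter_upwards [self_mem_nhdsWithin] with z hz
  rw [mul_inv_cancel₀ (sub_ne_zero.2 hz)]

lemma tendsto_sub_mul_inv_sub_of_ne {a b : ℂ} (h : a ≠ b) :
    Tendsto (fun s => (s - a) * (s - b)⁻¹) (𝓝[≠] a) (𝓝 0) := by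
  have : ContinuousAt (fun s => (s - a) * (s - b)⁻¹) a :=
    (continuousAt_id.sub continuousAt_const).mul
      ((continuousAt_id.sub continuousAt_const).inv₀ (sub_ne_zero.2 h))
  have := this.tendsto
  simp only [sub_self, zero_mul] at this
  exact this.mono_left nhdsWithin_le_nhds

/-- **Shifting a vertical contour** across finitely many simple poles. -/
lemma integral_line_sub_integral_line {ι : Type*} [Fintype ι] {f : ℂ → ℂ} {σ₁ σ₂ C T : ℝ}
    (hσ : σ₁ < σ₂) {a ρ : ι → ℂ} (hinj : Function.Injective a)
    (ha₁ : ∀ i, σ₁ < (a i).re) (ha₂ : ∀ i, (a i).re < σ₂)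
    (hd : ∀ s : ℂ, σ₁ ≤ s.re → s.re ≤ σ₂ → (∀ i, s ≠ a i) → DifferentiableAt ℂ f s)
    (hρ : ∀ i, Tendsto (fun s => (s - a i) * f s) (𝓝[≠] (a i)) (𝓝 (ρ i)))
    (hb : ∀ s : ℂ, σ₁ ≤ s.re → s.re ≤ σ₂ → T ≤ |s.im| → ‖f s‖ ≤ C / s.im ^ 2) :
    (∫ t : ℝ, f (σ₂ + t * I)) - ∫ t : ℝ, f (σ₁ + t * I) = 2 * Real.pi * ∑ i, ρ i := by
  classical
  set l : ℝ := σ₂ - σ₁ with hl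
  -- A comparison kernel with residue `1` at `a i`. Subtracting the translate by the width `l` of
  -- the strip makes it `O(1/(Im s)²)`, and the extra pole `a i + l` lies to the right of `σ₂`.
  -- Subtracting `∑ ρ i * k i` from `f` leaves removable singularities only.
  let k : ι → ℂ → ℂ := fun i s => (s - a i)⁻¹ - (s - (a i + l))⁻¹
  have hbre : ∀ i, σ₂ < (a i + l).re := fun i => by simp [hl]; linarith [ha₁ i]
  have hbim : ∀ i, (a i + l).im = (a i).im := fun i => by simp
  have hkd : ∀ i (s : ℂ), s.re ≤ σ₂ → s ≠ a i → DifferentiableAt ℂ (k i) s := by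
    intro i s h1 h2
    have h3 : s ≠ a i + l := fun h => by have := hbre i; rw [← h] at this; linarith
    have e : ∀ b : ℂ, s ≠ b → DifferentiableAt ℂ (fun s => (s - b)⁻¹) s := fun b hb =>
      (differentiableAt_id.sub_const b).fun_inv (sub_ne_zero.2 hb)
    exact (e _ h2).sub (e _ h3)
  have hkb : ∀ i, ∀ s : ℂ, 2 * |(a i).im| + 1 ≤ |s.im| → ‖k i s‖ ≤ 4 * l / s.im ^ 2 := by
    intro i s h1
    have e1 : ∀ b : ℂ, b.im = (a i).im → |s.im| / 2 ≤ ‖s - b‖ := by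
      intro b hb
      refine le_trans ?_ (Complex.abs_im_le_norm _)
      rw [sub_im, hb]
      have := abs_sub_abs_le_abs_sub s.im (a i).im
      linarith [abs_nonneg (a i).im]
    have e0 : 0 < |s.im| := by linarith [abs_nonneg (a i).im]
    have h2 := e1 (a i) rfl
    have h3 := e1 (a i + l) (hbim i)
    have n2 : s - a i ≠ 0 := norm_pos_iff.1 (by linarith)
    have n3 : s - (a i + l) ≠ 0 := norm_pos_iff.1 (by linarith)
    simp only [k]
    rw [inv_sub_inv n2 n3, norm_div, norm_mul, show s - (a i + l) - (s - a i) = -(l : ℂ) by ring,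
      norm_neg, Complex.norm_real, Real.norm_eq_abs, abs_of_pos (by linarith)]
    calc l / (‖s - a i‖ * ‖s - (a i + l)‖) ≤ l / ((|s.im| / 2) * (|s.im| / 2)) := by
          have : 0 ≤ l := by linarith
          gcongr
      _ = _ := by rw [← sq_abs s.im]; field_simp; ring
  let M : ℝ := ∑ i, (2 * |(a i).im| + 1)
  have hM : ∀ i, 2 * |(a i).im| + 1 ≤ M := fun i =>
    Finset.single_le_sum (f := fun i => 2 * |(a i).im| + 1) (fun j _ => by positivity)
      (Finset.mem_univ i)
  let f0 : ℂ → ℂ := fun s => f s - ∑ i, ρ i * k i s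
  have hres : ∀ i, Tendsto (fun s => (s - a i) * f0 s) (𝓝[≠] (a i)) (𝓝 0) := by
    intro i
    have h1 : ∀ j, Tendsto (fun s => (s - a i) * k j s) (𝓝[≠] (a i))
        (𝓝 (if j = i then 1 else 0)) := by
      intro j
      have hb : a i ≠ a j + l := fun h => by
        have := hbre j; rw [← h] at this; linarith [ha₂ i]
      have e : (fun s => (s - a i) * k j s) =
          fun s => (s - a i) * (s - a j)⁻¹ - (s - a i) * (s - (a j + l))⁻¹ := by
        funext s; simp only [k]; ring
      rw [e]
      by_cases hj : j = i
      · subst hj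
        rw [if_pos rfl]
        simpa using (tendsto_sub_mul_inv_sub (a j)).sub (tendsto_sub_mul_inv_sub_of_ne hb)
      · rw [if_neg hj]
        simpa using (tendsto_sub_mul_inv_sub_of_ne (fun h => hj (hinj h).symm)).sub
          (tendsto_sub_mul_inv_sub_of_ne hb)
    have h2 := (hρ i).sub (tendsto_finsetSum Finset.univ fun j _ => (h1 j).const_mul (ρ j))
    simp only [mul_ite, mul_one, mul_zero, Finset.sum_ite_eq', Finset.mem_univ, if_true,
      sub_self] at h2
    refine h2.congr fun s => ?_
    simp only [f0, mul_sub, Finset.mul_sum]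
    congr 1
    exact Finset.sum_congr rfl fun j _ => by ring
  obtain ⟨g, hg, hgd⟩ := exists_differentiable_extension (a := a) (f := f0)
    (S := {s : ℂ | σ₁ ≤ s.re ∧ s.re ≤ σ₂})
    (fun i => by
      have h1 : ∀ᶠ s : ℂ in 𝓝 (a i), σ₁ < s.re :=
        continuous_re.continuousAt.eventually (lt_mem_nhds (ha₁ i))
      have h2 : ∀ᶠ s : ℂ in 𝓝 (a i), s.re < σ₂ :=
        continuous_re.continuousAt.eventually (gt_mem_nhds (ha₂ i))
      filter_upwards [h1, h2] with s u v using ⟨u.le, v.le⟩)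
    (fun s hs hne => (hd s hs.1 hs.2 hne).sub
      (DifferentiableAt.fun_sum fun i _ => (hkd i s hs.2 (hne i)).const_mul _)) hres
  have hgb : ∀ s : ℂ, σ₁ ≤ s.re → s.re ≤ σ₂ → max T (M + 1) ≤ |s.im| →
      ‖g s‖ ≤ (C + ∑ i, ‖ρ i‖ * (4 * l)) / s.im ^ 2 := by
    intro s h1 h2 h3
    have h4 : M + 1 ≤ |s.im| := (le_max_right _ _).trans h3
    have hne : ∀ i, s ≠ a i := by
      rintro i rfl
      linarith [hM i, abs_nonneg (a i).im]
    rw [hg s hne, add_div, Finset.sum_div]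
    refine (norm_sub_le _ _).trans (add_le_add (hb s h1 h2 ((le_max_left _ _).trans h3)) ?_)
    refine norm_sum_le_of_le _ fun i _ => ?_
    rw [norm_mul, mul_div_assoc]
    exact mul_le_mul_of_nonneg_left (hkb i s (by linarith [hM i])) (norm_nonneg _)
  have heq := integral_line_eq_of_differentiable hσ.le (fun s h1 h2 => hgd s ⟨h1, h2⟩) hgb
  have line : ∀ σ : ℝ, σ₁ ≤ σ → σ ≤ σ₂ → (∀ i, σ ≠ (a i).re) →
      (∫ t : ℝ, f (σ + t * I)) - ∫ t : ℝ, g (σ + t * I) = ∑ i, ρ i * ∫ t : ℝ, k i (σ + t * I) := by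
    intro σ h1 h2 hne
    have hne' : ∀ s : ℂ, s.re = σ → ∀ i, s ≠ a i := by
      rintro s hs i rfl
      exact hne i hs.symm
    have if1 : Integrable fun t : ℝ => f (σ + t * I) :=
      integrable_line (fun s h => hd s (h1.trans h.ge) (h.le.trans h2) (hne' s h))
        (fun s h => hb s (h1.trans h.ge) (h.le.trans h2))
    have if2 : Integrable fun t : ℝ => g (σ + t * I) :=
      integrable_line (fun s h => hgd s ⟨h1.trans h.ge, h.le.trans h2⟩)
        (fun s h => hgb s (h1.trans h.ge) (h.le.trans h2))
    have ik : ∀ i, Integrable fun t : ℝ => k i (σ + t * I) := fun i =>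
      integrable_line (fun s h => hkd i s (h.le.trans h2) (hne' s h i)) (fun s _ => hkb i s)
    rw [← integral_sub if1 if2]
    simp_rw [← integral_const_mul]
    rw [← integral_finsetSum _ fun i _ => (ik i).const_mul _]
    refine integral_congr_ae (Eventually.of_forall fun t => ?_)
    simp only
    rw [hg _ (hne' _ (by simp))]
    simp [f0]
  have L2 := line σ₂ hσ.le le_rfl fun i => (ha₂ i).ne'
  have L1 := line σ₁ le_rfl hσ.le fun i => (ha₁ i).ne
  -- On `σ₂` the line separates the two poles of the kernel, so the signs differ and the integral is
  -- `2π`; on `σ₁` both poles lie to the right and it vanishes.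
  have k2 : ∀ i, ∫ t : ℝ, k i (σ₂ + t * I) = 2 * Real.pi := by
    intro i
    have hb := hbre i
    simp only [add_re, ofReal_re] at hb
    have := (integral_line_inv_sub_inv (a := a i) (l := l) (σ := σ₂) (ha₂ i).ne' hb.ne).2
    rw [sign_pos (by linarith [ha₂ i]), sign_neg (by linarith)] at this
    refine this.trans ?_
    push_cast [SignType.coe_neg_one, SignType.coe_one]; ring
  have k1 : ∀ i, ∫ t : ℝ, k i (σ₁ + t * I) = 0 := by
    intro i
    have hb := hbre i
    simp only [add_re, ofReal_re] at hb
    have := (integral_line_inv_sub_inv (a := a i) (l := l) (σ := σ₁) (ha₁ i).ne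
      (by linarith : σ₁ < _).ne).2
    rw [sign_neg (by linarith [ha₁ i]), sign_neg (by linarith)] at this
    refine this.trans ?_
    push_cast; ring
  simp_rw [k2] at L2
  simp_rw [k1, mul_zero, Finset.sum_const_zero] at L1
  rw [← Finset.sum_mul] at L2
  linear_combination L2 - L1 + heq

end CDO

end

/-! ### Mellin–Barnes line integrals and closing the contour to the left -/

noncomputable section

namespace CDO

open Complex Filter Topology MeasureTheory

lemma norm_exp_neg_mul_le {w s : ℂ} {θ : ℝ} (hw : |w.im| ≤ θ) :
    ‖exp (-w * s)‖ ≤ Real.exp (-w.re * s.re) * Real.exp (θ * |s.im|) := by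
  rw [Complex.norm_exp, ← Real.exp_add]
  apply Real.exp_le_exp.2
  have : w.im * s.im ≤ θ * |s.im| := (le_abs_self _).trans (by rw [abs_mul]; gcongr)
  simp only [mul_re, neg_re, neg_im]
  linarith

/-- The line integral of `Φ(s) e^{-ws}` along `Re s = σ`. -/
def lineIntegral (Φ : ℂ → ℂ) (σ : ℝ) (w : ℂ) : ℂ :=
  ∫ t : ℝ, Φ (σ + t * I) * exp (-w * (σ + t * I))

/-- The weight `e^{θ|t|}` dominates the kernel `e^{-ws}` for all `|Im w| ≤ θ` at once, which makes
the later estimates uniform in the direction. -/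
lemma integrable_norm_mul_exp {Φ : ℂ → ℂ} {σ C T θ : ℝ}
    (hd : ∀ s : ℂ, s.re = σ → DifferentiableAt ℂ Φ s)
    (hb : ∀ s : ℂ, s.re = σ → T ≤ |s.im| →
      ‖Φ s‖ ≤ C / s.im ^ 2 * Real.exp (-θ * |s.im|)) :
    Integrable (fun t : ℝ => ‖Φ (σ + t * I)‖ * Real.exp (θ * |t|)) := by
  have : Integrable (fun t : ℝ => Φ (σ + t * I) * (Real.exp (θ * |t|) : ℝ)) := by
    refine integrable_of_norm_le_div_sq (C := C) (T := T)
      ((continuous_line hd).mul (by fun_prop)) fun t ht => ?_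
    rw [norm_mul, Complex.norm_real, Real.norm_eq_abs, Real.abs_exp]
    have := hb (σ + t * I) (by simp) (by simpa using ht)
    simp only [add_im, ofReal_im, mul_im, ofReal_re, I_im, mul_one, I_re, mul_zero, add_zero,
      zero_add] at this
    calc _ ≤ C / t ^ 2 * Real.exp (-θ * |t|) * Real.exp (θ * |t|) := by gcongr
      _ = _ := by rw [mul_assoc, ← Real.exp_add]; simp
  refine this.norm.congr (Eventually.of_forall fun t => ?_)
  simp only [norm_mul, Complex.norm_real, Real.norm_eq_abs, Real.abs_exp]

/-- The only dependence on `w` is the factor `e^{-σ Re w}`, that is `|z|^{-σ}`: moving the line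
improves the order of the remainder. -/
lemma norm_lineIntegral_le {Φ : ℂ → ℂ} {σ θ : ℝ}
    (hi : Integrable (fun t : ℝ => ‖Φ (σ + t * I)‖ * Real.exp (θ * |t|))) {w : ℂ}
    (hw : |w.im| ≤ θ) :
    ‖lineIntegral Φ σ w‖ ≤
      (∫ t : ℝ, ‖Φ (σ + t * I)‖ * Real.exp (θ * |t|)) * Real.exp (-w.re * σ) := by
  rw [lineIntegral, ← integral_mul_const]
  refine norm_integral_le_of_norm_le (hi.mul_const _) (Eventually.of_forall fun t => ?_)
  rw [norm_mul, mul_assoc]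
  refine mul_le_mul_of_nonneg_left ?_ (norm_nonneg _)
  have := norm_exp_neg_mul_le (s := σ + t * I) hw
  simp only [add_im, ofReal_im, mul_im, ofReal_re, I_im, mul_one, I_re, mul_zero, add_zero,
      zero_add, add_re, mul_re, sub_self] at this
  linarith

/-- The shift of the contour in `lineIntegral` across finitely many simple poles. -/
lemma lineIntegral_sub_lineIntegral {ι : Type*} [Fintype ι] {Φ : ℂ → ℂ} {σ₁ σ₂ C T θ : ℝ}
    (hσ : σ₁ < σ₂) {a ρ : ι → ℂ} (hinj : Function.Injective a)
    (ha₁ : ∀ i, σ₁ < (a i).re) (ha₂ : ∀ i, (a i).re < σ₂)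
    (hd : ∀ s : ℂ, σ₁ ≤ s.re → s.re ≤ σ₂ → (∀ i, s ≠ a i) → DifferentiableAt ℂ Φ s)
    (hρ : ∀ i, Tendsto (fun s => (s - a i) * Φ s) (𝓝[≠] (a i)) (𝓝 (ρ i)))
    (hb : ∀ s : ℂ, σ₁ ≤ s.re → s.re ≤ σ₂ → T ≤ |s.im| →
      ‖Φ s‖ ≤ C / s.im ^ 2 * Real.exp (-θ * |s.im|)) {w : ℂ} (hw : |w.im| ≤ θ) :
    lineIntegral Φ σ₂ w - lineIntegral Φ σ₁ w =
      2 * Real.pi * ∑ i, ρ i * exp (-w * a i) := by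
  refine integral_line_sub_integral_line (f := fun s => Φ s * exp (-w * s)) (T := T)
    (C := C * Real.exp (|w.re| * (|σ₁| + |σ₂|))) hσ hinj ha₁ ha₂ ?_ ?_ ?_
  · intro s h1 h2 h3
    exact (hd s h1 h2 h3).mul (by fun_prop)
  · intro i
    have h1 : Tendsto (fun s => exp (-w * s)) (𝓝[≠] (a i)) (𝓝 (exp (-w * a i))) :=
      ((by fun_prop : Continuous fun s => exp (-w * s)).tendsto (a i)).mono_left
        nhdsWithin_le_nhds
    exact ((hρ i).mul h1).congr fun s => by ring
  · intro s h1 h2 h3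
    rw [norm_mul]
    have e1 := hb s h1 h2 h3
    have e2 := norm_exp_neg_mul_le (s := s) hw
    have e3 : Real.exp (-w.re * s.re) ≤ Real.exp (|w.re| * (|σ₁| + |σ₂|)) := by
      apply Real.exp_le_exp.2
      refine (le_abs_self _).trans ?_
      rw [abs_mul, abs_neg]
      gcongr
      rw [abs_le]
      constructor
      · linarith [neg_abs_le σ₁, abs_nonneg σ₂]
      · linarith [le_abs_self σ₂, abs_nonneg σ₁]
    calc _ ≤ (C / s.im ^ 2 * Real.exp (-θ * |s.im|)) *
          (Real.exp (|w.re| * (|σ₁| + |σ₂|)) * Real.exp (θ * |s.im|)) :=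
          mul_le_mul e1 (e2.trans (by gcongr)) (norm_nonneg _) ((norm_nonneg _).trans e1)
      _ = C * Real.exp (|w.re| * (|σ₁| + |σ₂|)) / s.im ^ 2 *
          (Real.exp (-θ * |s.im|) * Real.exp (θ * |s.im|)) := by ring
      _ = _ := by rw [← Real.exp_add]; simp

/-- Closing the contour to the left. -/
lemma tendsto_sum_residues {ι : Type*} [Fintype ι] {Φ : ℂ → ℂ} {σ C T θ D : ℝ} (hD : 0 ≤ D)
    {a : ι → ℂ} {ρ : ι → ℕ → ℂ} (hinj : Function.Injective a)
    (ha₁ : ∀ i, σ - 1 < (a i).re) (ha₂ : ∀ i, (a i).re < σ)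
    (hd : ∀ s : ℂ, s.re ≤ σ → (∀ i, ∀ m : ℕ, s ≠ a i - m) → DifferentiableAt ℂ Φ s)
    (hρ : ∀ i, ∀ m : ℕ, Tendsto (fun s => (s - (a i - m)) * Φ s) (𝓝[≠] (a i - m)) (𝓝 (ρ i m)))
    (hb : ∀ s : ℂ, σ - 1 ≤ s.re → s.re ≤ σ → T ≤ |s.im| →
      ‖Φ s‖ ≤ C / s.im ^ 2 * Real.exp (-θ * |s.im|))
    (hR : ∀ s : ℂ, σ - 1 ≤ s.re → s.re ≤ σ → ∀ m : ℕ,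
      ‖Φ (s - (m + 1 : ℕ))‖ ≤ D / (m + 1) * ‖Φ (s - m)‖)
    {w : ℂ} (hw : |w.im| ≤ θ) :
    Tendsto (fun N : ℕ => ∑ m ∈ Finset.range N, ∑ i, ρ i m * exp (-w * (a i - m))) atTop
      (𝓝 ((2 * Real.pi : ℂ)⁻¹ * lineIntegral Φ σ w)) := by
  -- Iterating the ratio bound gains `1/m!`, which is what makes the integral over the line `σ - N`
  -- tend to zero for every fixed `w`.
  have hR' : ∀ s : ℂ, σ - 1 ≤ s.re → s.re ≤ σ → ∀ m : ℕ,
      ‖Φ (s - m)‖ ≤ D ^ m / m.factorial * ‖Φ s‖ := by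
    intro s h1 h2 m
    induction m with
    | zero => simp
    | succ m ih =>
      calc _ ≤ D / (m + 1) * (D ^ m / m.factorial * ‖Φ s‖) :=
            (hR s h1 h2 m).trans (by gcongr)
        _ = _ := by rw [Nat.factorial_succ, pow_succ]; push_cast; field_simp
  have hline : ∀ m : ℕ, ∀ s : ℂ, s.re = σ - m → ∀ i, ∀ k : ℕ, s ≠ a i - k := by
    rintro m s hs i k rfl
    simp only [sub_re, natCast_re] at hs
    have h1 := ha₁ i
    have h2 := ha₂ i
    have h3 : (k : ℝ) < m := by linarith
    have h4 : (m : ℝ) < k + 1 := by linarith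
    norm_cast at h3 h4
    omega
  -- Since `σ - 1 < Re (a i) < σ`, exactly one pole `a i - m` of each family lies between the lines
  -- `σ - m - 1` and `σ - m`, and no pole lies on a line.
  have step : ∀ m : ℕ, lineIntegral Φ (σ - m) w - lineIntegral Φ (σ - (m + 1 : ℕ)) w =
      2 * Real.pi * ∑ i, ρ i m * exp (-w * (a i - m)) := by
    intro m
    have hm1 : σ - ((m + 1 : ℕ) : ℝ) = σ - 1 - m := by push_cast; ring
    rw [hm1]
    have key := lineIntegral_sub_lineIntegral (Φ := Φ) (σ₁ := σ - 1 - m) (σ₂ := σ - m)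
      (C := D ^ m / m.factorial * C) (T := T) (θ := θ) (by linarith) (a := fun i => a i - m)
      (ρ := fun i => ρ i m) (fun i j h => hinj (sub_left_injective h))
      (fun i => by simp; linarith [ha₁ i]) (fun i => by simp; linarith [ha₂ i]) ?_
      (fun i => hρ i m) ?_ hw
    · exact key
    · intro s h1 h2 h3
      refine hd s (by linarith [(Nat.cast_nonneg m : (0 : ℝ) ≤ m)]) fun i k hk => ?_
      have e1 := ha₁ i
      have e2 := ha₂ i
      have e3 : s.re = (a i).re - k := by rw [hk]; simp
      have h3' : (k : ℝ) < m + 1 := by linarith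
      have h4 : (m : ℝ) < k + 1 := by linarith
      norm_cast at h3' h4
      have : k = m := by omega
      exact h3 i (this ▸ hk)
    · intro s h1 h2 h3
      have e1 : σ - 1 ≤ (s + m).re := by simp; linarith
      have e2 : (s + m).re ≤ σ := by simp; linarith
      have e3 := hR' (s + m) e1 e2 m
      rw [add_sub_cancel_right] at e3
      have e4 := hb (s + m) e1 e2 (by simpa using h3)
      simp only [add_im, natCast_im, add_zero] at e4
      calc _ ≤ _ := e3
        _ ≤ D ^ m / m.factorial * (C / s.im ^ 2 * Real.exp (-θ * |s.im|)) := by gcongr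
        _ = _ := by ring
  have hsum : ∀ N : ℕ, ∑ m ∈ Finset.range N, ∑ i, ρ i m * exp (-w * (a i - m)) =
      (2 * Real.pi : ℂ)⁻¹ * lineIntegral Φ σ w -
        (2 * Real.pi : ℂ)⁻¹ * lineIntegral Φ (σ - N) w := by
    intro N
    have hpi : (2 * Real.pi : ℂ) ≠ 0 := by
      simp [Real.pi_ne_zero]
    rw [← mul_sub, eq_inv_mul_iff_mul_eq₀ hpi, Finset.mul_sum,
      ← Finset.sum_congr rfl fun m _ => step m,
      Finset.sum_range_sub' (fun m : ℕ => lineIntegral Φ (σ - m) w)]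
    simp
  have hI : ∀ s : ℂ, s.re = σ → DifferentiableAt ℂ Φ s := fun s hs =>
    hd s hs.le (hline 0 s (by simpa using hs))
  have hint := integrable_norm_mul_exp hI
    (fun s hs => hb s (by linarith) hs.le)
  have hbound : ∀ N : ℕ, ‖lineIntegral Φ (σ - N) w‖ ≤
      (D * Real.exp w.re) ^ N / N.factorial *
        ((∫ t : ℝ, ‖Φ (σ + t * I)‖ * Real.exp (θ * |t|)) * Real.exp (-w.re * σ)) := by
    intro N
    have hle : ∀ t : ℝ, ‖Φ ((σ - N : ℝ) + t * I)‖ * Real.exp (θ * |t|) ≤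
        D ^ N / N.factorial * (‖Φ (σ + t * I)‖ * Real.exp (θ * |t|)) := by
      intro t
      have := hR' (σ + t * I) (by simp) (by simp) N
      rw [show ((σ - N : ℝ) + t * I : ℂ) = σ + t * I - N by push_cast; ring, ← mul_assoc]
      gcongr
    have hN : Integrable (fun t : ℝ => ‖Φ ((σ - N : ℝ) + t * I)‖ * Real.exp (θ * |t|)) := by
      refine (hint.const_mul (D ^ N / N.factorial)).mono' ?_ (Eventually.of_forall fun t => ?_)
      · refine (Continuous.mul ?_ (by fun_prop)).aestronglyMeasurable
        exact (continuous_line (σ := σ - N) fun s hs => hd s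
          (by linarith [(Nat.cast_nonneg N : (0 : ℝ) ≤ N)]) (hline N s hs)).norm
      · rw [Real.norm_eq_abs, abs_of_nonneg (by positivity)]
        exact hle t
    have h1 := norm_lineIntegral_le hN hw
    refine h1.trans ?_
    have h2 := integral_mono hN (hint.const_mul (D ^ N / N.factorial)) hle
    rw [integral_const_mul] at h2
    calc _ ≤ D ^ N / N.factorial * (∫ t : ℝ, ‖Φ (σ + t * I)‖ * Real.exp (θ * |t|)) *
          Real.exp (-w.re * (σ - N)) := by gcongr
      _ = _ := by
        rw [show -w.re * (σ - N) = -w.re * σ + N * w.re by ring, Real.exp_add, Real.exp_nat_mul,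
          mul_pow]
        ring
  have hlim : Tendsto (fun N : ℕ => lineIntegral Φ (σ - N) w) atTop (𝓝 0) := by
    refine squeeze_zero_norm hbound ?_
    simpa using (FloorSemiring.tendsto_pow_div_factorial_atTop (D * Real.exp w.re)).mul_const
      ((∫ t : ℝ, ‖Φ (σ + t * I)‖ * Real.exp (θ * |t|)) * Real.exp (-w.re * σ))
  simp_rw [hsum]
  simpa using (tendsto_const_nhds (x := (2 * Real.pi : ℂ)⁻¹ * lineIntegral Φ σ w)).sub
    (hlim.const_mul (2 * Real.pi : ℂ)⁻¹)

end CDO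

end

/-! ### Abstract Mellin–Barnes integrands -/

noncomputable section

namespace CDO

open Complex Filter Topology MeasureTheory

lemma exists_pow_mul_exp_neg_le (A : ℕ) {ε : ℝ} (hε : 0 < ε) :
    ∃ C : ℝ, 0 ≤ C ∧ ∀ t : ℝ, 0 ≤ t → t ^ A * Real.exp (-ε * t) ≤ C := by
  refine ⟨A.factorial / ε ^ A, by positivity, fun t ht => ?_⟩
  have h := Real.pow_div_factorial_le_exp (ε * t) (by positivity) A
  rw [div_le_iff₀ (by positivity), mul_pow] at h
  rw [le_div_iff₀ (by positivity), neg_mul, Real.exp_neg]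
  have he := Real.exp_pos (ε * t)
  calc t ^ A * (Real.exp (ε * t))⁻¹ * ε ^ A = (ε ^ A * t ^ A) * (Real.exp (ε * t))⁻¹ := by ring
    _ ≤ (Real.exp (ε * t) * A.factorial) * (Real.exp (ε * t))⁻¹ := by gcongr
    _ = A.factorial := by field_simp

/-- Strict inequality `θ < κ` is needed: the surplus rate `κ - θ` absorbs the power `|Im s| ^ (A +
2)`. -/
lemma StripDecay.exists_bound {f : ℂ → ℂ} {κ θ : ℝ} (hf : StripDecay f κ) (h : θ < κ)
    (σ₁ σ₂ : ℝ) : ∃ C T : ℝ, 1 ≤ T ∧ ∀ s : ℂ, σ₁ ≤ s.re → s.re ≤ σ₂ → T ≤ |s.im| →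
      ‖f s‖ ≤ C / s.im ^ 2 * Real.exp (-θ * |s.im|) := by
  obtain ⟨C, hC, A, T, hT, hb⟩ := hf σ₁ σ₂
  obtain ⟨B, hB, hB'⟩ := exists_pow_mul_exp_neg_le (A + 2) (sub_pos.2 h)
  refine ⟨C * B, T, hT, fun s h1 h2 h3 => (hb s h1 h2 h3).trans ?_⟩
  have ht : 0 < |s.im| := by linarith
  have := hB' |s.im| ht.le
  rw [← sq_abs s.im]
  calc C * |s.im| ^ A * Real.exp (-κ * |s.im|)
      = C * (|s.im| ^ (A + 2) * Real.exp (-(κ - θ) * |s.im|)) / |s.im| ^ 2 *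
        Real.exp (-θ * |s.im|) := by
        rw [show -κ * |s.im| = -(κ - θ) * |s.im| + -θ * |s.im| by ring, Real.exp_add, pow_add]
        field_simp
    _ ≤ _ := by gcongr

/-- `Φ` behaves like a Mellin–Barnes integrand: it decays like `e^{-κ |Im s|}`, and its
singularities far to the left are simple poles at `p d - m`, with residues `ρ d m`. -/
structure BarnesIntegrand {n : ℕ} (p : Fin (n + 1) → ℂ) (Φ : ℂ → ℂ) (ρ : Fin (n + 1) → ℕ → ℂ)
    (κ : ℝ) : Prop where
  residue : ∀ d, ∀ m : ℕ,
    Tendsto (fun s => (s - (p d - m)) * Φ s) (𝓝[≠] (p d - m)) (𝓝 (ρ d m))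
  ratio : ∃ D L : ℝ, 0 ≤ D ∧ ∀ s : ℂ, s.re ≤ L → ‖Φ (s - 1)‖ ≤ D / ‖s - 1‖ * ‖Φ s‖
  differentiable : ∃ L : ℝ, ∀ s : ℂ, s.re ≤ L → (∀ d, ∀ m : ℕ, s ≠ p d - m) →
    DifferentiableAt ℂ Φ s
  decay : StripDecay Φ κ

lemma exists_lt_forall_ne_sub_int {ι : Type*} [Finite ι] (x : ι → ℝ) (L : ℝ) :
    ∃ σ < L, ∀ i, ∀ m : ℤ, σ ≠ x i - m := by
  have hc : (Set.range fun y : ι × ℤ => x y.1 - y.2).Countable := Set.countable_range _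
  obtain ⟨σ, h1, h2⟩ := (hc.dense_compl ℝ).exists_mem_open (isOpen_Iio (a := L))
    ⟨L - 1, sub_one_lt L⟩
  exact ⟨σ, h2, fun i m h => h1 ⟨(i, m), h.symm⟩⟩

/-- Closing the contour to the left for a Mellin–Barnes integrand. -/
theorem BarnesIntegrand.exists_sum_eq {n : ℕ} {p : Fin (n + 1) → ℂ} {Φ : ℂ → ℂ}
    {ρ : Fin (n + 1) → ℕ → ℂ} {κ θ : ℝ} (h : BarnesIntegrand p Φ ρ κ)
    (hpp : ∀ b c, b ≠ c → ∀ m : ℤ, p b - p c ≠ m) (hθ : θ ≤ κ) (L : ℝ) :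
    ∃ σ : ℝ, σ ≤ L ∧ ∃ k : Fin (n + 1) → ℕ,
      (∀ d, (p d).re - k d < σ ∧ σ - 1 < (p d).re - k d) ∧
      Integrable (fun t : ℝ => ‖Φ (σ + t * I)‖ * Real.exp (θ * |t|)) ∧
      ∀ w : ℂ, |w.im| ≤ θ → ∀ S : Fin (n + 1) → ℂ,
        (∀ d, HasSum (fun m : ℕ => ρ d m * exp (-w * (p d - m))) (S d)) →
        ∑ d, S d = (∑ d, ∑ m ∈ Finset.range (k d), ρ d m * exp (-w * (p d - m))) +
          (2 * Real.pi : ℂ)⁻¹ * lineIntegral Φ σ w := by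
  obtain ⟨D, L₁, hD, hratio⟩ := h.ratio
  obtain ⟨L₂, hdiff⟩ := h.differentiable
  -- Left of `B` the ratio bound and differentiability hold, every `p d` lies to the right, and real
  -- parts are nonpositive; the last point gives `m + 1 ≤ ‖s - m - 1‖` at the end.
  let B : ℝ := min (min L (min L₁ L₂)) (min (-∑ d, |(p d).re|) 0)
  obtain ⟨σ₀, hσ₀, hne⟩ := exists_lt_forall_ne_sub_int (fun d => (p d).re) B
  simp only [B, lt_min_iff] at hσ₀
  obtain ⟨⟨hL, hL₁, hL₂⟩, hp, h0⟩ := hσ₀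
  obtain ⟨C, hC, A, T, hT, hbd⟩ := h.decay (σ₀ - 1) σ₀
  have hshift : ∀ s : ℂ, s.re ≤ σ₀ → 1 ≤ |s.im| → ∀ j : ℕ,
      ‖Φ (s - j)‖ ≤ (D / |s.im|) ^ j * ‖Φ s‖ := by
    intro s h1 h2 j
    induction j with
    | zero => simp
    | succ j ih =>
      have e := hratio (s - j) (by simp; linarith [(Nat.cast_nonneg j : (0 : ℝ) ≤ j)])
      rw [show s - ((j + 1 : ℕ) : ℂ) = s - j - 1 by push_cast; ring]
      have e2 : |s.im| ≤ ‖s - j - 1‖ := by simpa using Complex.abs_im_le_norm (s - j - 1)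
      calc _ ≤ _ := e
        _ ≤ D / |s.im| * ((D / |s.im|) ^ j * ‖Φ s‖) := by gcongr
        _ = _ := by ring
  -- Moving `A + 2` further to the left gains `|Im s| ^ (-(A + 2))` from the ratio bound. This
  -- cancels the polynomial factor of the strip bound and leaves `1/(Im s)²`, so the endpoint `θ =
  -- κ` is allowed.
  set σ : ℝ := σ₀ - (A + 2 : ℕ) with hσ
  have hσle : σ ≤ σ₀ := by rw [hσ]; linarith [(Nat.cast_nonneg (A + 2) : (0 : ℝ) ≤ (A + 2 : ℕ))]
  have hbσ : ∀ s : ℂ, σ - 1 ≤ s.re → s.re ≤ σ → T ≤ |s.im| →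
      ‖Φ s‖ ≤ (D ^ (A + 2) * C) / s.im ^ 2 * Real.exp (-θ * |s.im|) := by
    intro s h1 h2 h3
    have ht : 0 < |s.im| := by linarith
    have e1 := hshift (s + (A + 2 : ℕ)) (by simp at h2 hσ ⊢; linarith) (by simp; linarith) (A + 2)
    have e2 := hbd (s + (A + 2 : ℕ)) (by simp at h1 hσ ⊢; linarith)
      (by simp at h2 hσ ⊢; linarith) (by simpa using h3)
    have him : (s + (A + 2 : ℕ)).im = s.im := by simp
    rw [add_sub_cancel_right, him] at e1
    rw [him] at e2
    rw [← sq_abs s.im]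
    calc _ ≤ _ := e1
      _ ≤ (D / |s.im|) ^ (A + 2) * (C * |s.im| ^ A * Real.exp (-θ * |s.im|)) := by
        gcongr
        refine e2.trans ?_
        gcongr
      _ = _ := by rw [div_pow, pow_add |s.im|]; field_simp
  have hpd : ∀ d, σ₀ < (p d).re := by
    intro d
    have : |(p d).re| ≤ ∑ d, |(p d).re| :=
      Finset.single_le_sum (f := fun d => |(p d).re|) (fun _ _ => abs_nonneg _) (Finset.mem_univ d)
    linarith [neg_abs_le (p d).re]
  have hk : ∀ d, (p d).re - ⌈(p d).re - σ⌉₊ < σ ∧ σ - 1 < (p d).re - ⌈(p d).re - σ⌉₊ := by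
    intro d
    have h1 := Nat.le_ceil ((p d).re - σ)
    have h2 := Nat.ceil_lt_add_one (a := (p d).re - σ) (by linarith [hpd d])
    have h3 : (p d).re - σ ≠ ⌈(p d).re - σ⌉₊ := by
      intro h
      apply hne d ((⌈(p d).re - σ⌉₊ : ℤ) - (A + 2 : ℕ))
      push_cast
      rw [hσ] at h ⊢
      push_cast at h ⊢
      linarith
    have h4 := lt_of_le_of_ne h1 h3
    constructor <;> linarith
  -- The natural number `k d` counts the poles of the family `d` to the right of `σ`; the pole `p d
  -- - k d` is the first one to the left of the line. Equality is excluded by the choice of `σ₀`.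
  refine ⟨σ, by linarith, fun d => ⌈(p d).re - σ⌉₊, hk, ?_, ?_⟩
  · refine integrable_norm_mul_exp (fun s hs => hdiff s (by linarith) ?_)
      (fun s hs => hbσ s (by linarith) hs.le)
    rintro d m rfl
    simp only [sub_re, natCast_re] at hs
    apply hne d ((m : ℤ) - (A + 2 : ℕ))
    rw [hσ] at hs
    push_cast at hs ⊢
    linarith
  · intro w hw S hS
    have hinj : Function.Injective fun d => p d - (⌈(p d).re - σ⌉₊ : ℂ) := by
      intro b c hbc
      by_contra hne
      apply hpp b c hne ((⌈(p b).re - σ⌉₊ : ℤ) - (⌈(p c).re - σ⌉₊ : ℤ))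
      simp only at hbc
      push_cast
      linear_combination hbc
    have key := tendsto_sum_residues (Φ := Φ) (σ := σ) (C := D ^ (A + 2) * C) (T := T) (θ := θ)
      hD (a := fun d => p d - (⌈(p d).re - σ⌉₊ : ℂ))
      (ρ := fun d m => ρ d (⌈(p d).re - σ⌉₊ + m)) hinj
      (fun d => by simpa using (hk d).2) (fun d => by simpa using (hk d).1) ?_ ?_ hbσ ?_ hw
    · have hlim : Tendsto (fun N : ℕ => ∑ m ∈ Finset.range N, ∑ d,
          ρ d (⌈(p d).re - σ⌉₊ + m) * exp (-w * (p d - (⌈(p d).re - σ⌉₊ : ℂ) - m))) atTop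
          (𝓝 (∑ d, (S d - ∑ m ∈ Finset.range ⌈(p d).re - σ⌉₊,
            ρ d m * exp (-w * (p d - m))))) := by
        simp_rw [Finset.sum_comm (s := Finset.range _)]
        refine tendsto_finsetSum _ fun d _ => ?_
        have := ((hasSum_nat_add_iff' ⌈(p d).re - σ⌉₊).2 (hS d)).tendsto_sum_nat
        refine this.congr fun N => Finset.sum_congr rfl fun m _ => ?_
        rw [add_comm m]
        push_cast
        rw [sub_sub]
      have := tendsto_nhds_unique hlim key
      rw [Finset.sum_sub_distrib] at this
      linear_combination this
    · intro s hs hns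
      by_cases hex : ∃ d, ∃ m : ℕ, s = p d - m
      · obtain ⟨d, m, rfl⟩ := hex
        exfalso
        have h1 := (hk d).2
        simp only [sub_re, natCast_re] at hs
        have h2 : ((⌈(p d).re - σ⌉₊ : ℕ) : ℝ) < m + 1 := by linarith
        have h3 : ⌈(p d).re - σ⌉₊ ≤ m := by
          have : ⌈(p d).re - σ⌉₊ < m + 1 := by exact_mod_cast h2
          omega
        apply hns d (m - ⌈(p d).re - σ⌉₊)
        rw [Nat.cast_sub h3]; ring
      · push Not at hex
        exact hdiff s (by linarith) hex
    · intro d m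
      have := h.residue d (⌈(p d).re - σ⌉₊ + m)
      push_cast at this
      rw [← sub_sub] at this
      exact this
    · intro s h1 h2 m
      have e := hratio (s - m) (by simp; linarith [(Nat.cast_nonneg m : (0 : ℝ) ≤ m)])
      rw [show s - ((m + 1 : ℕ) : ℂ) = s - m - 1 by push_cast; ring]
      refine e.trans ?_
      have e2 : (m : ℝ) + 1 ≤ ‖s - m - 1‖ := by
        have := Complex.abs_re_le_norm (s - m - 1)
        refine le_trans ?_ this
        rw [abs_of_neg] <;> simp <;> linarith [(Nat.cast_nonneg m : (0 : ℝ) ≤ m)]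
      gcongr

end CDO

end

/-! ### The analytic solutions as entire functions of the logarithm -/

noncomputable section

namespace CDO

open Complex Filter Topology MeasureTheory

variable {n : ℕ}

/-- The quotient `∏ Γ(1 - q_c - s) / ∏ Γ(1 + p_c - s)`, whose values at `p_d - k` are the
coefficients of the analytic solutions. -/
def gammaQuot (p : Fin (n + 1) → ℂ) (q : Fin n → ℂ) (s : ℂ) : ℂ :=
  (∏ c, Gamma (1 - q c - s)) / ∏ c, Gamma (1 + p c - s)

/-- The analytic solution with exponent `-p d`, as an entire function of the logarithm of its
argument. -/
def analyticSol (p : Fin (n + 1) → ℂ) (q : Fin n → ℂ) (d : Fin (n + 1)) (w : ℂ) : ℂ :=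
  ∑' k : ℕ, gammaQuot p q (p d - k) * exp (w * (k - p d))

lemma exists_natCast_add_one_le_mul_norm {b : ℂ} (hb : ∀ k : ℕ, b + k ≠ 0) :
    ∃ M : ℝ, 0 < M ∧ ∀ k : ℕ, (k + 1 : ℝ) ≤ M * ‖b + k‖ := by
  have h : (fun k : ℕ => (k + 1 : ℝ)) =O[atTop] fun k : ℕ => b + k := by
    refine Asymptotics.IsBigO.of_bound 4 ?_
    filter_upwards [eventually_ge_atTop (⌈2 * ‖b‖ + 1⌉₊)] with k hk
    have h1 : 2 * ‖b‖ + 1 ≤ k := (Nat.le_ceil _).trans (by exact_mod_cast hk)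
    have h2 : (k : ℝ) - ‖b‖ ≤ ‖b + k‖ := by
      have := norm_sub_norm_le (k : ℂ) (-b)
      rw [norm_neg, sub_neg_eq_add, add_comm, Complex.norm_natCast] at this
      exact this
    rw [Real.norm_eq_abs, abs_of_nonneg (by positivity)]
    linarith [norm_nonneg b]
  obtain ⟨C, hC, hb'⟩ := Asymptotics.bound_of_isBigO_nat_atTop h
  refine ⟨C, hC, fun k => ?_⟩
  have := hb' (x := k) (hb k)
  rwa [Real.norm_eq_abs, abs_of_nonneg (by positivity)] at this

lemma gammaQuot_sub_one (p : Fin (n + 1) → ℂ) (q : Fin n → ℂ) {s : ℂ}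
    (hq : ∀ c, 1 - q c - s ≠ 0) (hp : ∀ c, 1 + p c - s ≠ 0) :
    gammaQuot p q (s - 1) =
      gammaQuot p q s * ((∏ c, (1 - q c - s)) / ∏ c, (1 + p c - s)) := by
  have h1 : ∀ c, Gamma (1 - q c - (s - 1)) = (1 - q c - s) * Gamma (1 - q c - s) := fun c => by
    rw [← Complex.Gamma_add_one _ (hq c)]; ring_nf
  have h2 : ∀ c, Gamma (1 + p c - (s - 1)) = (1 + p c - s) * Gamma (1 + p c - s) := fun c => by
    rw [← Complex.Gamma_add_one _ (hp c)]; ring_nf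
  simp only [gammaQuot, h1, h2, Finset.prod_mul_distrib]
  rw [mul_comm, mul_comm (∏ c, (1 + p c - s)), mul_div_mul_comm]

section generic

variable {p : Fin (n + 1) → ℂ} {q : Fin n → ℂ}

lemma one_add_sub_add_natCast_ne_zero (hpp : ∀ b c, b ≠ c → ∀ m : ℤ, p b - p c ≠ m)
    (c d : Fin (n + 1)) (k : ℕ) : 1 + p c - p d + k ≠ 0 := by
  intro h
  by_cases hcd : c = d
  · subst hcd
    have : ((1 + k : ℕ) : ℂ) = 0 := by push_cast; linear_combination h
    norm_cast at this
    omega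
  · exact hpp c d hcd (-(1 + k : ℕ)) (by push_cast; linear_combination h)

lemma one_sub_sub_add_natCast_ne_zero (hpq : ∀ b c, ∀ m : ℤ, p b + q c ≠ m)
    (c : Fin n) (d : Fin (n + 1)) (k : ℕ) : 1 - q c - p d + k ≠ 0 := fun h =>
  hpq d c (1 + k : ℕ) (by push_cast; linear_combination -h)

/-- Passing from `k` to `k + 1` multiplies by `n` factors in the numerator and `n + 1` in the
denominator, all comparable to `k + 1` or bounded by it in the right direction; the net gain `1/(k +
1)` accumulates to `1/k!`. -/
lemma exists_norm_gammaQuot_le (hpp : ∀ b c, b ≠ c → ∀ m : ℤ, p b - p c ≠ m)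
    (hpq : ∀ b c, ∀ m : ℤ, p b + q c ≠ m) (d : Fin (n + 1)) :
    ∃ C D : ℝ, 0 ≤ C ∧ 0 ≤ D ∧ ∀ k : ℕ, ‖gammaQuot p q (p d - k)‖ ≤ C * D ^ k / k.factorial := by
  choose M hM hMk using fun c => exists_natCast_add_one_le_mul_norm
    (one_add_sub_add_natCast_ne_zero hpp c d)
  refine ⟨‖gammaQuot p q (p d)‖, (∏ c, (‖1 - q c - p d‖ + 1)) * ∏ c, M c, norm_nonneg _,
    mul_nonneg (Finset.prod_nonneg fun c _ => by positivity)
      (Finset.prod_nonneg fun c _ => (hM c).le), fun k => ?_⟩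
  induction k with
  | zero => simp
  | succ k ih =>
    have e := gammaQuot_sub_one p q (s := p d - k)
      (fun c => by
        have := one_sub_sub_add_natCast_ne_zero hpq c d k
        rwa [show 1 - q c - (p d - k) = 1 - q c - p d + k by ring])
      (fun c => by
        have := one_add_sub_add_natCast_ne_zero hpp c d k
        rwa [show 1 + p c - (p d - k) = 1 + p c - p d + k by ring])
    rw [show p d - ((k + 1 : ℕ) : ℂ) = p d - k - 1 by push_cast; ring, e, norm_mul, norm_div,
      norm_prod, norm_prod]
    have h1 : ∏ c, ‖1 - q c - (p d - k)‖ ≤ (∏ c, (‖1 - q c - p d‖ + 1)) * (k + 1) ^ n := by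
      calc _ ≤ ∏ c : Fin n, ((‖1 - q c - p d‖ + 1) * (k + 1)) := by
            refine Finset.prod_le_prod (fun _ _ => norm_nonneg _) fun c _ => ?_
            rw [show 1 - q c - (p d - k) = 1 - q c - p d + k by ring]
            refine (norm_add_le _ _).trans ?_
            rw [Complex.norm_natCast]
            nlinarith [norm_nonneg (1 - q c - p d), (Nat.cast_nonneg k : (0 : ℝ) ≤ k)]
        _ = _ := by rw [Finset.prod_mul_distrib]; simp
    have h2 : ((k + 1 : ℝ)) ^ (n + 1) ≤ (∏ c, M c) * ∏ c, ‖1 + p c - (p d - k)‖ := by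
      rw [← Finset.prod_mul_distrib]
      calc ((k + 1 : ℝ)) ^ (n + 1) = ∏ c : Fin (n + 1), (k + 1 : ℝ) := by simp
        _ ≤ _ := by
          refine Finset.prod_le_prod (fun _ _ => by positivity) fun c _ => ?_
          rw [show 1 + p c - (p d - k) = 1 + p c - p d + k by ring]
          exact hMk c k
    have hpos : 0 < ∏ c, ‖1 + p c - (p d - k)‖ := Finset.prod_pos fun c _ => by
      rw [show 1 + p c - (p d - k) = 1 + p c - p d + k by ring]
      exact norm_pos_iff.2 (one_add_sub_add_natCast_ne_zero hpp c d k)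
    have hA : 0 ≤ ∏ c, (‖1 - q c - p d‖ + 1) := Finset.prod_nonneg fun c _ => by positivity
    have h3 : (∏ c, ‖1 - q c - (p d - k)‖) / ∏ c, ‖1 + p c - (p d - k)‖ ≤
        ((∏ c, (‖1 - q c - p d‖ + 1)) * ∏ c, M c) / (k + 1) := by
      rw [div_le_div_iff₀ hpos (by positivity)]
      calc _ ≤ (∏ c, (‖1 - q c - p d‖ + 1)) * (k + 1) ^ n * (k + 1) := by gcongr
        _ = (∏ c, (‖1 - q c - p d‖ + 1)) * (k + 1) ^ (n + 1) := by ring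
        _ ≤ (∏ c, (‖1 - q c - p d‖ + 1)) * ((∏ c, M c) * ∏ c, ‖1 + p c - (p d - k)‖) := by gcongr
        _ = _ := by ring
    refine (mul_le_mul ih h3 (by positivity) ((norm_nonneg _).trans ih)).trans (le_of_eq ?_)
    rw [Nat.factorial_succ, pow_succ]; push_cast; field_simp

lemma norm_analyticSol_term_le {C D : ℝ} (hC : 0 ≤ C) (hD : 0 ≤ D) {d : Fin (n + 1)} {k : ℕ}
    (h : ‖gammaQuot p q (p d - k)‖ ≤ C * D ^ k / k.factorial) (w : ℂ) :
    ‖gammaQuot p q (p d - k) * exp (w * (k - p d))‖ ≤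
      C * Real.exp (‖p d‖ * (|w.re| + |w.im|)) * ((D * Real.exp w.re) ^ k / k.factorial) := by
  rw [norm_mul, Complex.norm_exp]
  have h1 : (w * (k - p d)).re ≤ k * w.re + ‖p d‖ * (|w.re| + |w.im|) := by
    have e1 : -(w.re * (p d).re) ≤ |w.re| * ‖p d‖ := by
      refine (neg_le_abs _).trans ?_
      rw [abs_mul]
      exact mul_le_mul_of_nonneg_left (Complex.abs_re_le_norm _) (abs_nonneg _)
    have e2 : w.im * (p d).im ≤ |w.im| * ‖p d‖ := by
      refine (le_abs_self _).trans ?_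
      rw [abs_mul]
      exact mul_le_mul_of_nonneg_left (Complex.abs_im_le_norm _) (abs_nonneg _)
    simp only [mul_re, sub_re, natCast_re, sub_im, natCast_im]
    linarith
  calc _ ≤ C * D ^ k / k.factorial * Real.exp (k * w.re + ‖p d‖ * (|w.re| + |w.im|)) := by
        gcongr
    _ = _ := by rw [Real.exp_add, Real.exp_nat_mul, mul_pow]; ring

lemma summable_analyticSol (hpp : ∀ b c, b ≠ c → ∀ m : ℤ, p b - p c ≠ m)
    (hpq : ∀ b c, ∀ m : ℤ, p b + q c ≠ m) (d : Fin (n + 1)) (w : ℂ) :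
    Summable fun k : ℕ => gammaQuot p q (p d - k) * exp (w * (k - p d)) := by
  obtain ⟨C, D, hC, hD, h⟩ := exists_norm_gammaQuot_le hpp hpq d
  exact Summable.of_norm_bounded ((Real.summable_pow_div_factorial _).mul_left _)
    fun k => norm_analyticSol_term_le hC hD (h k) w

lemma exists_norm_analyticSol_le (hpp : ∀ b c, b ≠ c → ∀ m : ℤ, p b - p c ≠ m)
    (hpq : ∀ b c, ∀ m : ℤ, p b + q c ≠ m) (d : Fin (n + 1)) :
    ∃ C D : ℝ, 0 ≤ C ∧ 0 ≤ D ∧ ∀ w : ℂ, ‖analyticSol p q d w‖ ≤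
      C * Real.exp (‖p d‖ * (|w.re| + |w.im|)) * Real.exp (D * Real.exp w.re) := by
  obtain ⟨C, D, hC, hD, h⟩ := exists_norm_gammaQuot_le hpp hpq d
  refine ⟨C, D, hC, hD, fun w => ?_⟩
  have hs := NormedSpace.expSeries_div_hasSum_exp (𝔸 := ℝ) (D * Real.exp w.re)
  rw [← Real.exp_eq_exp_ℝ] at hs
  exact tsum_of_norm_bounded (hs.mul_left _)
    fun k => norm_analyticSol_term_le hC hD (h k) w

lemma differentiable_analyticSol (hpp : ∀ b c, b ≠ c → ∀ m : ℤ, p b - p c ≠ m)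
    (hpq : ∀ b c, ∀ m : ℤ, p b + q c ≠ m) (d : Fin (n + 1)) :
    Differentiable ℂ (analyticSol p q d) := by
  obtain ⟨C, D, hC, hD, h⟩ := exists_norm_gammaQuot_le hpp hpq d
  intro w
  have hU := Metric.isOpen_ball (x := (0 : ℂ)) (ε := ‖w‖ + 1)
  have := differentiableOn_tsum_of_summable_norm (U := Metric.ball (0 : ℂ) (‖w‖ + 1))
    (F := fun (k : ℕ) (w : ℂ) => gammaQuot p q (p d - k) * exp (w * (k - p d)))
    (u := fun k : ℕ => C * Real.exp (‖p d‖ * (2 * (‖w‖ + 1))) *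
      ((D * Real.exp (‖w‖ + 1)) ^ k / k.factorial))
    ((Real.summable_pow_div_factorial _).mul_left _)
    (fun k => by fun_prop) hU (fun k z hz => by
      rw [mem_ball_zero_iff] at hz
      have h1 := (Complex.abs_re_le_norm z).trans hz.le
      have h2 := (Complex.abs_im_le_norm z).trans hz.le
      refine (norm_analyticSol_term_le hC hD (h k) z).trans ?_
      gcongr
      · linarith
      · exact (le_abs_self _).trans h1)
  exact this.differentiableAt (hU.mem_nhds (by simp))

end generic

/-- Residues of `s ↦ Γ(s - p)`. -/
lemma tendsto_sub_mul_Gamma (p : ℂ) (m : ℕ) :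
    Tendsto (fun s => (s - (p - m)) * Gamma (s - p)) (𝓝[≠] (p - m))
      (𝓝 ((-1) ^ m / m.factorial)) := by
  induction m with
  | zero =>
    have h : Tendsto (fun s : ℂ => s - p) (𝓝[≠] p) (𝓝[≠] 0) := by
      refine tendsto_nhdsWithin_iff.2 ⟨?_, ?_⟩
      · have := (continuous_sub_right p).tendsto p
        rw [sub_self] at this
        exact this.mono_left nhdsWithin_le_nhds
      · filter_upwards [self_mem_nhdsWithin] with s hs using sub_ne_zero.2 hs
    simpa [Function.comp_def] using tendsto_self_mul_Gamma_nhds_zero.comp h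
  | succ m ih =>
    have hP : p - ((m + 1 : ℕ) : ℂ) = p - m - 1 := by push_cast; ring
    rw [hP]
    -- The pole at `p - m - 1` is the previous one transported by `Γ(s - p) = Γ(s - p + 1) / (s -
    -- p)`.
    have h : Tendsto (fun s : ℂ => s + 1) (𝓝[≠] (p - m - 1)) (𝓝[≠] (p - m)) := by
      refine tendsto_nhdsWithin_iff.2 ⟨?_, ?_⟩
      · have := (continuous_add_const (1 : ℂ)).tendsto (p - m - 1)
        rw [sub_add_cancel] at this
        exact this.mono_left nhdsWithin_le_nhds
      · filter_upwards [self_mem_nhdsWithin] with s hs h0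
        exact hs (eq_sub_of_add_eq h0)
    have h1 := ih.comp h
    have hne : p - m - 1 - p ≠ 0 := by
      intro h0
      have : ((m + 1 : ℕ) : ℂ) = 0 := by push_cast; linear_combination -h0
      norm_cast at this
    have h2 : Tendsto (fun s : ℂ => (s - p)⁻¹) (𝓝[≠] (p - m - 1)) (𝓝 (p - m - 1 - p)⁻¹) := by
      have : ContinuousAt (fun s : ℂ => (s - p)⁻¹) (p - m - 1) :=
        (continuousAt_id.sub continuousAt_const).inv₀ hne
      exact this.tendsto.mono_left nhdsWithin_le_nhds
    have h3 := h1.mul h2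
    have hval : (-1) ^ m / (m.factorial : ℂ) * (p - m - 1 - p)⁻¹ =
        (-1) ^ (m + 1) / ((m + 1).factorial : ℂ) := by
      have hm : (m : ℂ) + 1 ≠ 0 := by exact_mod_cast Nat.succ_ne_zero m
      rw [show p - m - 1 - p = -((m : ℂ) + 1) by ring, Nat.factorial_succ]
      push_cast
      rw [inv_neg, pow_succ]
      field_simp
    rw [hval] at h3
    have hev : ∀ᶠ s : ℂ in 𝓝[≠] (p - m - 1), s - p ≠ 0 := by
      have : ContinuousAt (fun s : ℂ => s - p) (p - m - 1) :=
        continuousAt_id.sub continuousAt_const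
      exact (this.eventually_ne hne).filter_mono nhdsWithin_le_nhds
    refine h3.congr' ?_
    filter_upwards [hev] with s hs
    simp only [Function.comp]
    rw [show s + 1 - p = s - p + 1 by ring, Complex.Gamma_add_one _ hs]
    field_simp
    ring

lemma sin_pi_mul_ne_zero {u : ℂ} (hu : ∀ m : ℤ, u ≠ m) : sin (Real.pi * u) ≠ 0 := by
  intro h
  obtain ⟨k, hk⟩ := Complex.sin_eq_zero_iff.1 h
  have hp : (Real.pi : ℂ) ≠ 0 := by exact_mod_cast Real.pi_ne_zero
  exact hu k (mul_left_cancel₀ hp (by rw [hk]; ring))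

lemma Gamma_ne_zero_of_ne_int {u : ℂ} (hu : ∀ m : ℤ, u ≠ m) : Gamma u ≠ 0 :=
  Complex.Gamma_ne_zero fun m => by simpa using hu (-m)

/-- The reflection formula at integer translates. -/
lemma Gamma_sub_natCast {u : ℂ} (hu : ∀ m : ℤ, u ≠ m) (m : ℕ) :
    Gamma (u - m) = (-1) ^ m * Real.pi / (sin (Real.pi * u) * Gamma (1 - u + m)) := by
  have h := Complex.Gamma_mul_Gamma_one_sub (u - m)
  rw [show (1 : ℂ) - (u - m) = 1 - u + m by ring,
    show (Real.pi : ℂ) * (u - m) = Real.pi * u - m * Real.pi by ring,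
    sin_antiperiodic.sub_nat_mul_eq] at h
  have h1 := sin_pi_mul_ne_zero hu
  have h2 : Gamma (1 - u + m) ≠ 0 := Gamma_ne_zero_of_ne_int fun k hk =>
    hu (1 + m - k) (by push_cast; linear_combination -hk)
  have h3 : ((-1 : ℂ) ^ m) * (-1) ^ m = 1 := by rw [← mul_pow]; simp
  have h4 : ((-1 : ℂ) ^ m) ≠ 0 := pow_ne_zero _ (by simp)
  rw [eq_div_iff (mul_ne_zero h1 h2)]
  rw [eq_div_iff (mul_ne_zero h4 h1)] at h
  linear_combination (-1) ^ m * h - Gamma (u - m) * sin (Real.pi * u) * Gamma (1 - u + m) * h3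

end CDO

end

/-! ### The two Mellin–Barnes integrands and their residues -/

noncomputable section

namespace CDO

open Complex Filter Topology MeasureTheory

variable {n : ℕ}

/-- The Mellin–Barnes integrand of the exponential solution. -/
def barnesExp (p : Fin (n + 1) → ℂ) (q : Fin n → ℂ) (s : ℂ) : ℂ :=
  (∏ c, Gamma (s - p c)) * ∏ c, (Gamma (s + q c))⁻¹

/-- The Mellin–Barnes integrand of the algebraic solution of index `b`. -/
def barnesAlg (p : Fin (n + 1) → ℂ) (q : Fin n → ℂ) (b : Fin n) (s : ℂ) : ℂ :=
  (∏ c, Gamma (s - p c)) *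
    (Gamma (1 - q b - s) * ∏ c : {c : Fin n // c ≠ b}, (Gamma (s + q c))⁻¹)

/-- The ratio of sines in the connection coefficients. -/
def sinQuot (p : Fin (n + 1) → ℂ) (q : Fin n → ℂ) (d : Fin (n + 1)) : ℂ :=
  (∏ c, sin (Real.pi * (p d + q c))) /
    ∏ c : {c : Fin (n + 1) // c ≠ d}, sin (Real.pi * (p d - p c))

lemma prod_eq_mul_prod_subtype_ne {ι : Type*} [Fintype ι] [DecidableEq ι] (f : ι → ℂ) (d : ι) :
    ∏ c, f c = f d * ∏ c : {c // c ≠ d}, f c := by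
  rw [← Finset.mul_prod_erase _ _ (Finset.mem_univ d)]
  congr 1
  exact (Finset.prod_subtype _ (fun x => by simp) _)

section

variable {p : Fin (n + 1) → ℂ} {q : Fin n → ℂ}

lemma differentiableAt_prod_Gamma {s : ℂ} (h : ∀ d, ∀ m : ℕ, s ≠ p d - m) :
    DifferentiableAt ℂ (fun s => ∏ c, Gamma (s - p c)) s := by
  refine DifferentiableAt.fun_finsetProd fun c _ => ?_
  refine (Complex.differentiableAt_Gamma _ fun m hm => h c m ?_).comp s (by fun_prop)
  linear_combination hm

lemma differentiable_Gamma_inv_add (q : ℂ) : Differentiable ℂ fun s => (Gamma (s + q))⁻¹ :=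
  differentiable_one_div_Gamma.comp (by fun_prop)

lemma differentiable_prod_Gamma_inv {ι : Type*} [Fintype ι] (r : ι → ℂ) :
    Differentiable ℂ fun s => ∏ c, (Gamma (s + r c))⁻¹ :=
  Differentiable.fun_finsetProd fun c _ => differentiable_Gamma_inv_add (r c)

/-- The poles of different Gamma factors never coincide because the differences of the `p c` are not
integers, so at `p d - m` only the factor of index `d` is singular. -/
lemma tendsto_sub_mul_prod_Gamma (hpp : ∀ b c, b ≠ c → ∀ m : ℤ, p b - p c ≠ m)
    (d : Fin (n + 1)) (m : ℕ) {E : ℂ → ℂ} (hE : ContinuousAt E (p d - m)) :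
    Tendsto (fun s => (s - (p d - m)) * ((∏ c, Gamma (s - p c)) * E s)) (𝓝[≠] (p d - m))
      (𝓝 ((-1) ^ m / m.factorial *
        (∏ c : {c : Fin (n + 1) // c ≠ d}, Gamma (p d - m - p c)) * E (p d - m))) := by
  have h1 := tendsto_sub_mul_Gamma (p d) m
  have h2 : ContinuousAt (fun s => ∏ c : {c : Fin (n + 1) // c ≠ d}, Gamma (s - p c))
      (p d - m) := by
    refine (DifferentiableAt.fun_finsetProd fun c _ => ?_ : DifferentiableAt ℂ _ _).continuousAt
    have : DifferentiableAt ℂ Gamma (p d - m - p c) :=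
      Complex.differentiableAt_Gamma _ fun k hk =>
        hpp d c c.2.symm (m - k) (by push_cast; linear_combination hk)
    exact DifferentiableAt.comp (f := fun s => s - p c) _ this (by fun_prop)
  have h3 := (h1.mul (h2.tendsto.mono_left nhdsWithin_le_nhds)).mul
    (hE.tendsto.mono_left nhdsWithin_le_nhds)
  refine h3.congr fun s => ?_
  rw [prod_eq_mul_prod_subtype_ne (fun c => Gamma (s - p c)) d]
  ring

/-- Reflection is applied to the `n` Gamma factors with `c ≠ d` and to the `n` reciprocal ones. The
two `n`-th powers of `(-1) ^ m π` cancel, and `m!` is the missing factor `Γ(1 + p d - s)` of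
`gammaQuot`. -/
lemma residue_barnesExp_eq (hpp : ∀ b c, b ≠ c → ∀ m : ℤ, p b - p c ≠ m)
    (hpq : ∀ b c, ∀ m : ℤ, p b + q c ≠ m) (d : Fin (n + 1)) (m : ℕ) :
    (-1) ^ m / (m.factorial : ℂ) *
        (∏ c : {c : Fin (n + 1) // c ≠ d}, Gamma (p d - m - p c)) *
        ∏ c, (Gamma (p d - m + q c))⁻¹ =
      (-1) ^ m * (sinQuot p q d * gammaQuot p q (p d - m)) := by
  have h1 : ∀ c : {c : Fin (n + 1) // c ≠ d}, Gamma (p d - m - p c) =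
      ((-1) ^ m * Real.pi) * (sin (Real.pi * (p d - p c)))⁻¹ *
        (Gamma (1 + p c - (p d - m)))⁻¹ := by
    intro c
    rw [show p d - m - p c = (p d - p c) - m by ring, Gamma_sub_natCast (hpp d c c.2.symm) m,
      show 1 - (p d - p c) + m = 1 + p c - (p d - m) by ring, div_eq_mul_inv, mul_inv]
    ring
  have hpi : (Real.pi : ℂ) ≠ 0 := by exact_mod_cast Real.pi_ne_zero
  have hs : ((-1 : ℂ) ^ m) * (-1) ^ m = 1 := by rw [← mul_pow]; simp
  have h2 : ∀ c, (Gamma (p d - m + q c))⁻¹ =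
      ((-1 : ℂ) ^ m * Real.pi)⁻¹ * sin (Real.pi * (p d + q c)) * Gamma (1 - q c - (p d - m)) := by
    intro c
    rw [show p d - m + q c = (p d + q c) - m by ring, Gamma_sub_natCast (hpq d c) m,
      show 1 - (p d + q c) + m = 1 - q c - (p d - m) by ring, inv_div, div_eq_mul_inv]
    ring
  have hc : ((-1 : ℂ) ^ m * Real.pi) ≠ 0 := mul_ne_zero (pow_ne_zero _ (by simp)) hpi
  simp_rw [h1, h2, Finset.prod_mul_distrib, Finset.prod_const, Finset.card_univ,
    Fintype.card_fin, Finset.prod_inv_distrib]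
  rw [show Fintype.card {c : Fin (n + 1) // c ≠ d} = n by simp, sinQuot, gammaQuot,
    prod_eq_mul_prod_subtype_ne (fun c => Gamma (1 + p c - (p d - m))) d,
    show 1 + p d - (p d - m) = (m : ℂ) + 1 by ring, Complex.Gamma_nat_eq_factorial, inv_pow]
  have := pow_ne_zero n hc
  simp only [div_eq_mul_inv, mul_inv]
  field_simp
  rw [mul_pow ((-1 : ℂ) ^ m)]

/-- Far to the left each linear factor lies between `‖s - 1‖ / 2` and `2 ‖s - 1‖`, and the
denominator has one factor more. -/
lemma exists_prod_norm_div_le (p : Fin (n + 1) → ℂ) (q : Fin n → ℂ) :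
    ∃ D L : ℝ, 0 ≤ D ∧ ∀ s : ℂ, s.re ≤ L → (∀ c, s - 1 - p c ≠ 0) ∧ (∀ c, s - 1 + q c ≠ 0) ∧
      (∏ c, ‖s - 1 + q c‖) / ∏ c, ‖s - 1 - p c‖ ≤ D / ‖s - 1‖ := by
  refine ⟨2 ^ n * 2 ^ (n + 1), -2 * (∑ c, ‖p c‖ + ∑ c, ‖q c‖), by positivity, fun s hs => ?_⟩
  have hP : ∀ c, ‖p c‖ ≤ ∑ c, ‖p c‖ := fun c =>
    Finset.single_le_sum (f := fun c => ‖p c‖) (fun _ _ => norm_nonneg _) (Finset.mem_univ c)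
  have hQ : ∀ c, ‖q c‖ ≤ ∑ c, ‖q c‖ := fun c =>
    Finset.single_le_sum (f := fun c => ‖q c‖) (fun _ _ => norm_nonneg _) (Finset.mem_univ c)
  have hP0 : 0 ≤ ∑ c, ‖p c‖ := Finset.sum_nonneg fun _ _ => norm_nonneg _
  have hQ0 : 0 ≤ ∑ c, ‖q c‖ := Finset.sum_nonneg fun _ _ => norm_nonneg _
  have hu : 2 * (∑ c, ‖p c‖ + ∑ c, ‖q c‖) + 1 ≤ ‖s - 1‖ := by
    have := (neg_le_abs _).trans (Complex.abs_re_le_norm (s - 1))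
    simp at this
    linarith
  have hp' : ∀ c, ‖s - 1‖ / 2 ≤ ‖s - 1 - p c‖ := fun c => by
    have := norm_sub_norm_le (s - 1) (p c)
    linarith [hP c]
  have hq'' : ∀ c, ‖s - 1‖ / 2 ≤ ‖s - 1 + q c‖ := fun c => by
    have := norm_sub_norm_le (s - 1) (-q c)
    rw [norm_neg, sub_neg_eq_add] at this
    linarith [hQ c]
  have hq' : ∀ c, ‖s - 1 + q c‖ ≤ 2 * ‖s - 1‖ := fun c => by
    have := norm_add_le (s - 1) (q c)
    linarith [hQ c]
  have hpos : 0 < ‖s - 1‖ := by linarith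
  refine ⟨fun c => norm_pos_iff.1 (by linarith [hp' c]),
    fun c => norm_pos_iff.1 (by linarith [hq'' c]), ?_⟩
  calc _ ≤ (∏ c : Fin n, (2 * ‖s - 1‖)) / ∏ c : Fin (n + 1), (‖s - 1‖ / 2) := by
        have hd : 0 < ∏ c : Fin (n + 1), (‖s - 1‖ / 2) := Finset.prod_pos fun _ _ => by positivity
        refine div_le_div₀ (Finset.prod_nonneg fun _ _ => by positivity) ?_ hd ?_
        · exact Finset.prod_le_prod (fun _ _ => norm_nonneg _) fun c _ => hq' c
        · exact Finset.prod_le_prod (fun _ _ => by positivity) fun c _ => hp' c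
    _ = _ := by
      simp only [Finset.prod_const, Finset.card_univ, Fintype.card_fin]
      rw [mul_pow, div_pow, pow_succ ‖s - 1‖]
      field_simp

lemma prod_Gamma_sub_one {s : ℂ} (h : ∀ c, s - 1 - p c ≠ 0) :
    ∏ c, Gamma (s - 1 - p c) = (∏ c, Gamma (s - p c)) / ∏ c, (s - 1 - p c) := by
  rw [← Finset.prod_div_distrib]
  refine Finset.prod_congr rfl fun c _ => ?_
  rw [eq_div_iff (h c), mul_comm, ← Complex.Gamma_add_one _ (h c)]
  ring_nf

lemma Gamma_inv_sub_one (s q : ℂ) :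
    (Gamma (s - 1 + q))⁻¹ = (s - 1 + q) * (Gamma (s + q))⁻¹ := by
  have := Complex.one_div_Gamma_eq_self_mul_one_div_Gamma_add_one (s - 1 + q)
  rwa [show s - 1 + q + 1 = s + q by ring] at this

lemma stripDecay_Gamma_sub (p : ℂ) : StripDecay (fun s => Gamma (s - p)) (Real.pi / 2) := by
  have := stripDecay_Gamma.comp_affine (-p) (e := 1) (by simp)
  convert this using 3 with s
  push_cast; ring

lemma stripDecay_Gamma_inv_add (q : ℂ) :
    StripDecay (fun s => (Gamma (s + q))⁻¹) (-(Real.pi / 2)) := by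
  have := stripDecay_Gamma_inv.comp_affine q (e := 1) (by simp)
  convert this using 4 with s
  push_cast; ring

lemma stripDecay_Gamma_const_sub (q : ℂ) :
    StripDecay (fun s => Gamma (q - s)) (Real.pi / 2) := by
  have := stripDecay_Gamma.comp_affine q (e := -1) (by simp)
  convert this using 3 with s
  push_cast; ring

/-- The rate is `(n + 1) π/2 - n π/2 = π/2`, so this integral is available only for `|Im w| ≤ π/2`.
-/
lemma barnesIntegrand_barnesExp (hpp : ∀ b c, b ≠ c → ∀ m : ℤ, p b - p c ≠ m)
    (hpq : ∀ b c, ∀ m : ℤ, p b + q c ≠ m) :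
    BarnesIntegrand p (barnesExp p q)
      (fun d m => (-1) ^ m * (sinQuot p q d * gammaQuot p q (p d - m))) (Real.pi / 2) where
  residue d m := by
    rw [← residue_barnesExp_eq hpp hpq]
    refine tendsto_sub_mul_prod_Gamma hpp d m (E := fun s => ∏ c, (Gamma (s + q c))⁻¹) ?_
    exact (differentiable_prod_Gamma_inv q).continuous.continuousAt
  ratio := by
    obtain ⟨D, L, hD, h⟩ := exists_prod_norm_div_le p q
    refine ⟨D, L, hD, fun s hs => ?_⟩
    obtain ⟨h1, -, h3⟩ := h s hs
    rw [barnesExp, prod_Gamma_sub_one h1]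
    simp_rw [Gamma_inv_sub_one, Finset.prod_mul_distrib]
    rw [barnesExp]
    simp only [norm_mul, norm_div, norm_prod] at h3 ⊢
    calc _ = ((∏ c, ‖s - 1 + q c‖) / ∏ c, ‖s - 1 - p c‖) *
          ((∏ c, ‖Gamma (s - p c)‖) * ∏ c, ‖(Gamma (s + q c))⁻¹‖) := by ring
      _ ≤ _ := by gcongr
  differentiable := ⟨0, fun s _ h => (differentiableAt_prod_Gamma h).mul
    (differentiable_prod_Gamma_inv q s)⟩
  decay := by
    have := (StripDecay.prod Finset.univ fun c => stripDecay_Gamma_sub (p c)).mul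
      (StripDecay.prod Finset.univ fun c => stripDecay_Gamma_inv_add (q c))
    have e : Real.pi / 2 = ((Finset.univ : Finset (Fin (n + 1))).card : ℝ) * (Real.pi / 2) +
        ((Finset.univ : Finset (Fin n)).card : ℝ) * -(Real.pi / 2) := by
      simp only [Finset.card_univ, Fintype.card_fin]; push_cast; ring
    rw [e]
    exact this

/-- Replacing `1/Γ(s + q b)` by `Γ(1 - q b - s)` raises the rate from `π/2` to `3π/2`. It multiplies
the integrand by `π / sin(π(s + q b))`, whose value at `p d - m` is `(-1) ^ m π / sin(π(p d + q
b))`; the sign cancels the one in the residues of `barnesExp`. -/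
lemma barnesIntegrand_barnesAlg (hpp : ∀ b c, b ≠ c → ∀ m : ℤ, p b - p c ≠ m)
    (hpq : ∀ b c, ∀ m : ℤ, p b + q c ≠ m) (b : Fin n) :
    BarnesIntegrand p (barnesAlg p q b)
      (fun d m => Real.pi / sin (Real.pi * (p d + q b)) *
        (sinQuot p q d * gammaQuot p q (p d - m))) (3 * Real.pi / 2) where
  residue d m := by
    have hcont : ContinuousAt (fun s => Gamma (1 - q b - s) *
        ∏ c : {c : Fin n // c ≠ b}, (Gamma (s + q c))⁻¹) (p d - m) := by
      refine ContinuousAt.mul ?_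
        (differentiable_prod_Gamma_inv fun c : {c // c ≠ b} => q c).continuous.continuousAt
      have : DifferentiableAt ℂ Gamma (1 - q b - (p d - m)) :=
        Complex.differentiableAt_Gamma _ fun k hk =>
          hpq d b (1 + m + k) (by push_cast; linear_combination -hk)
      exact ContinuousAt.comp (f := fun s => 1 - q b - s) this.continuousAt
        (continuousAt_const.sub continuousAt_id)
    have key := tendsto_sub_mul_prod_Gamma hpp d m hcont
    have hval : Real.pi / sin (Real.pi * (p d + q b)) *
        (sinQuot p q d * gammaQuot p q (p d - m)) = (-1) ^ m / m.factorial *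
        (∏ c : {c : Fin (n + 1) // c ≠ d}, Gamma (p d - m - p c)) *
        (Gamma (1 - q b - (p d - m)) *
          ∏ c : {c : Fin n // c ≠ b}, (Gamma (p d - m + q c))⁻¹) := by
      have h1 := residue_barnesExp_eq hpp hpq d m
      rw [prod_eq_mul_prod_subtype_ne (fun c => (Gamma (p d - m + q c))⁻¹) b] at h1
      have hs : ((-1 : ℂ) ^ m) * (-1) ^ m = 1 := by rw [← mul_pow]; simp
      have hG : Gamma (p d - m + q b) ≠ 0 := Gamma_ne_zero_of_ne_int fun k hk =>
        hpq d b (k + m) (by push_cast; linear_combination hk)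
      have h2 : Gamma (1 - q b - (p d - m)) =
          (-1) ^ m * Real.pi / sin (Real.pi * (p d + q b)) * (Gamma (p d - m + q b))⁻¹ := by
        have hsin := sin_pi_mul_ne_zero (hpq d b)
        have e := Gamma_sub_natCast (hpq d b) m
        have hG' : Gamma (1 - (p d + q b) + m) ≠ 0 := Gamma_ne_zero_of_ne_int fun k hk =>
          hpq d b (1 + m - k) (by push_cast; linear_combination -hk)
        rw [show p d - m + q b = p d + q b - m by ring] at hG ⊢
        rw [show 1 - q b - (p d - m) = 1 - (p d + q b) + m by ring, ← div_eq_mul_inv,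
          eq_div_iff hG, e]
        field_simp
      rw [h2]
      calc _ = Real.pi / sin (Real.pi * (p d + q b)) * (-1) ^ m *
            ((-1) ^ m * (sinQuot p q d * gammaQuot p q (p d - m))) := by
            linear_combination (-(Real.pi / sin (Real.pi * (p d + q b)) *
              (sinQuot p q d * gammaQuot p q (p d - m)))) * hs
        _ = _ := by rw [← h1]; ring
    rw [hval]
    exact key
  ratio := by
    obtain ⟨D, L, hD, h⟩ := exists_prod_norm_div_le p q
    refine ⟨D, L, hD, fun s hs => ?_⟩
    obtain ⟨h1, h2, h3⟩ := h s hs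
    have hne : 1 - q b - s ≠ 0 := fun h0 => h2 b (by linear_combination -h0)
    have hG : Gamma (1 - q b - (s - 1)) = -(s - 1 + q b) * Gamma (1 - q b - s) := by
      rw [show -(s - 1 + q b) = 1 - q b - s by ring, ← Complex.Gamma_add_one _ hne]; ring_nf
    rw [barnesAlg, prod_Gamma_sub_one h1, hG]
    simp_rw [Gamma_inv_sub_one, Finset.prod_mul_distrib]
    have hsplit := congrArg norm (prod_eq_mul_prod_subtype_ne (fun c => s - 1 + q c) b)
    rw [barnesAlg]
    simp only [norm_mul, norm_div, norm_prod, norm_neg] at h3 hsplit ⊢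
    calc _ = ((‖s - 1 + q b‖ * ∏ c : {c : Fin n // c ≠ b}, ‖s - 1 + q c‖) /
            ∏ c, ‖s - 1 - p c‖) * ((∏ c, ‖Gamma (s - p c)‖) * (‖Gamma (1 - q b - s)‖ *
            ∏ c : {c : Fin n // c ≠ b}, ‖(Gamma (s + q c))⁻¹‖)) := by ring
      _ ≤ _ := by rw [← hsplit]; gcongr
  differentiable := by
    refine ⟨-(q b).re, fun s hs h => (differentiableAt_prod_Gamma h).mul (DifferentiableAt.mul ?_
      (differentiable_prod_Gamma_inv (fun c : {c // c ≠ b} => q c) s))⟩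
    refine (Complex.differentiableAt_Gamma _ fun m hm => ?_).comp s (by fun_prop)
    have := congrArg re hm
    simp at this
    linarith [(Nat.cast_nonneg m : (0 : ℝ) ≤ m)]
  decay := by
    have := (StripDecay.prod Finset.univ fun c => stripDecay_Gamma_sub (p c)).mul
      ((stripDecay_Gamma_const_sub (1 - q b)).mul (StripDecay.prod
        (Finset.univ : Finset {c : Fin n // c ≠ b}) fun c => stripDecay_Gamma_inv_add (q c)))
    have hn : 1 ≤ n := Nat.one_le_of_lt b.2
    have e : 3 * Real.pi / 2 = ((Finset.univ : Finset (Fin (n + 1))).card : ℝ) * (Real.pi / 2) +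
        (Real.pi / 2 +
          ((Finset.univ : Finset {c : Fin n // c ≠ b}).card : ℝ) * -(Real.pi / 2)) := by
      rw [Finset.card_univ, Finset.card_univ, Fintype.card_fin,
        show Fintype.card {c : Fin n // c ≠ b} = n - 1 by simp, Nat.cast_sub hn]
      push_cast; ring
    rw [e]
    exact this

end

end CDO

end

/-! ### Algebraic asymptotics from the right-hand poles -/

noncomputable section

namespace CDO

open Complex Filter Topology MeasureTheory

variable {n : ℕ} {p : Fin (n + 1) → ℂ} {q : Fin n → ℂ}

/-- Coefficients of the algebraic asymptotic series, from the right-hand poles of `barnesAlg`. -/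
def algCoeff (p : Fin (n + 1) → ℂ) (q : Fin n → ℂ) (b : Fin n) (k : ℕ) : ℂ :=
  (-1) ^ k / k.factorial * ((∏ c, Gamma (1 - q b - p c + k)) *
    ∏ c : {c : Fin n // c ≠ b}, (Gamma (1 + q c - q b + k))⁻¹)

/-- The singular factor is a Gamma function of `-s`, hence the minus sign in the residue. -/
lemma tendsto_sub_mul_barnesAlg (hpq : ∀ b c, ∀ m : ℤ, p b + q c ≠ m) (b : Fin n) (k : ℕ) :
    Tendsto (fun s => (s - (1 - q b + k)) * barnesAlg p q b s) (𝓝[≠] (1 - q b + k))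
      (𝓝 (-algCoeff p q b k)) := by
  have h : Tendsto (fun s : ℂ => 1 - q b - s) (𝓝[≠] (1 - q b + k)) (𝓝[≠] (0 - k)) := by
    refine tendsto_nhdsWithin_iff.2 ⟨?_, ?_⟩
    · have := (continuous_sub_left (1 - q b)).tendsto (1 - q b + (k : ℂ))
      rw [show 1 - q b - (1 - q b + (k : ℂ)) = 0 - k by ring] at this
      exact this.mono_left nhdsWithin_le_nhds
    · filter_upwards [self_mem_nhdsWithin] with s hs h0
      exact hs (by have h0' : 1 - q b - s = 0 - k := h0
                   show s = _
                   linear_combination -h0')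
  have h1 := (tendsto_sub_mul_Gamma 0 k).comp h
  have h2 : ContinuousAt (fun s => (∏ c, Gamma (s - p c)) *
      ∏ c : {c : Fin n // c ≠ b}, (Gamma (s + q c))⁻¹) (1 - q b + k) := by
    refine (DifferentiableAt.continuousAt (𝕜 := ℂ) ?_).mul
      (differentiable_prod_Gamma_inv fun c : {c // c ≠ b} => q c).continuous.continuousAt
    exact differentiableAt_prod_Gamma fun d m h0 =>
      hpq d b (1 + k + m) (by push_cast; linear_combination -h0)
  have h3 := (h1.mul (h2.tendsto.mono_left nhdsWithin_le_nhds)).neg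
  have hval : -((-1) ^ k / (k.factorial : ℂ) * ((∏ c, Gamma (1 - q b + k - p c)) *
      ∏ c : {c : Fin n // c ≠ b}, (Gamma (1 - q b + k + q c))⁻¹)) = -algCoeff p q b k := by
    rw [algCoeff]
    congr 4
    · funext c; congr 1; ring
    · funext c; congr 2; ring
  rw [hval] at h3
  refine h3.congr fun s => ?_
  simp only [Function.comp, barnesAlg, sub_zero]
  ring

/-- The asymptotic expansion of the algebraic combination of analytic solutions, in terms of the
logarithm `w` of the variable. -/
theorem exists_norm_sum_analyticSol_sub_le (hpp : ∀ b c, b ≠ c → ∀ m : ℤ, p b - p c ≠ m)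
    (hpq : ∀ b c, ∀ m : ℤ, p b + q c ≠ m) (b : Fin n) (N : ℕ) :
    ∃ K : ℕ, N ≤ K ∧ ∃ C : ℝ, ∀ w : ℂ, |w.im| ≤ Real.pi → 0 ≤ w.re →
      ‖(∑ d, Real.pi / sin (Real.pi * (p d + q b)) * sinQuot p q d * analyticSol p q d w) -
        ∑ k ∈ Finset.range K, algCoeff p q b k * exp (w * (q b - 1 - k))‖ ≤
      C * Real.exp (w.re * ((q b).re - 1 - N)) := by
  have hpi : Real.pi < 3 * Real.pi / 2 := by linarith [Real.pi_pos]
  have hB := barnesIntegrand_barnesAlg hpp hpq b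
  -- The bound `σ₁ ≤ -Re (q b)` puts all the poles `1 - q b + k` to the right of the initial line.
  obtain ⟨σ₁, hσ₁, k, hk, -, hsum⟩ := hB.exists_sum_eq hpp hpi.le (-(q b).re)
  -- The number `K` may have to exceed `N`: the final line must also lie to the right of every `p
  -- c`. The surplus terms are absorbed in the error later.
  obtain ⟨K, hK⟩ := exists_nat_ge ((N : ℝ) + 1 + (|(q b).re| + ∑ c, |(p c).re| + |σ₁|))
  have hp0 : 0 ≤ ∑ c, |(p c).re| := Finset.sum_nonneg fun _ _ => abs_nonneg _
  have hp1 : ∀ c, (p c).re ≤ ∑ c, |(p c).re| := fun c => (le_abs_self _).trans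
    (Finset.single_le_sum (f := fun c => |(p c).re|) (fun _ _ => abs_nonneg _) (Finset.mem_univ c))
  have ha := le_abs_self (q b).re
  have ha' := neg_abs_le (q b).re
  have hb1 := le_abs_self σ₁
  have hN0 : (0 : ℝ) ≤ N := Nat.cast_nonneg N
  -- Halfway between the last pole collected, of index `K - 1`, and the next one, of index `K`.
  set σ₂ : ℝ := 1 - (q b).re + K - 1 / 2 with hσ₂
  obtain ⟨C, T, hT, hbd⟩ := hB.decay.exists_bound hpi σ₁ σ₂
  have hσ : σ₁ < σ₂ := by linarith
  have hNK : (N : ℝ) + 1 ≤ K := by linarith [abs_nonneg (q b).re, abs_nonneg σ₁]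
  have hdiff : ∀ s : ℂ, σ₁ ≤ s.re → s.re ≤ σ₂ → (∀ d, ∀ m : Fin (k d), s ≠ p d - (m : ℕ)) →
      (∀ j : Fin K, s ≠ 1 - q b + (j : ℕ)) → DifferentiableAt ℂ (barnesAlg p q b) s := by
    intro s h1 h2 h3 h4
    refine (differentiableAt_prod_Gamma fun d m h0 => ?_).mul (DifferentiableAt.mul ?_
      (differentiable_prod_Gamma_inv (fun c : {c // c ≠ b} => q c) s))
    · by_cases hm : m < k d
      · exact h3 d ⟨m, hm⟩ h0
      · have e := (hk d).1
        have e1 : s.re = (p d).re - m := by rw [h0]; simp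
        have e2 : (k d : ℝ) ≤ m := by exact_mod_cast not_lt.1 hm
        linarith
    · refine (Complex.differentiableAt_Gamma _ fun m hm => ?_).comp s (by fun_prop)
      have h0 : s = 1 - q b + m := by linear_combination -hm
      by_cases hmK : m < K
      · exact h4 ⟨m, hmK⟩ h0
      · have e1 : s.re = 1 - (q b).re + m := by rw [h0]; simp
        have e2 : (K : ℝ) ≤ m := by exact_mod_cast not_lt.1 hmK
        linarith
  let a : (Σ d, Fin (k d)) ⊕ Fin K → ℂ :=
    Sum.elim (fun x => p x.1 - (x.2 : ℕ)) (fun j => 1 - q b + (j : ℕ))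
  let r : (Σ d, Fin (k d)) ⊕ Fin K → ℂ :=
    Sum.elim (fun x => Real.pi / sin (Real.pi * (p x.1 + q b)) *
        (sinQuot p q x.1 * gammaQuot p q (p x.1 - (x.2 : ℕ)))) (fun j => -algCoeff p q b j)
  have hinj : Function.Injective a := by
    rintro (⟨d, m⟩ | j) (⟨d', m'⟩ | j') h
    · have h' : p d - (m : ℕ) = p d' - (m' : ℕ) := h
      have hd : d = d' := by
        by_contra hne
        exact hpp d d' hne ((m : ℕ) - (m' : ℕ) : ℤ) (by push_cast; linear_combination h')
      subst hd
      have : ((m : ℕ) : ℂ) = (m' : ℕ) := by linear_combination -h'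
      have : m = m' := Fin.ext (by exact_mod_cast this)
      rw [this]
    · exact absurd (show p d + q b = ((1 + (j' : ℕ) + (m : ℕ) : ℤ) : ℂ) by
        have h' : p d - (m : ℕ) = 1 - q b + (j' : ℕ) := h
        push_cast; linear_combination h') (hpq d b _)
    · exact absurd (show p d' + q b = ((1 + (j : ℕ) + (m' : ℕ) : ℤ) : ℂ) by
        have h' : 1 - q b + (j : ℕ) = p d' - (m' : ℕ) := h
        push_cast; linear_combination -h') (hpq d' b _)
    · have h' : 1 - q b + ((j : ℕ) : ℂ) = 1 - q b + (j' : ℕ) := h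
      have : ((j : ℕ) : ℂ) = (j' : ℕ) := by linear_combination h'
      have : j = j' := Fin.ext (by exact_mod_cast this)
      rw [this]
  have ha₁ : ∀ i, σ₁ < (a i).re := by
    rintro (⟨d, m⟩ | j)
    · have e := (hk d).2
      have e2 : ((m : ℕ) : ℝ) + 1 ≤ k d := by exact_mod_cast m.2
      simp only [a, Sum.elim_inl, sub_re, natCast_re]
      linarith
    · simp only [a, Sum.elim_inr, add_re, sub_re, one_re, natCast_re]
      have : (0 : ℝ) ≤ (j : ℕ) := Nat.cast_nonneg _
      linarith
  have ha₂ : ∀ i, (a i).re < σ₂ := by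
    rintro (⟨d, m⟩ | j)
    · simp only [a, Sum.elim_inl, sub_re, natCast_re]
      have : (0 : ℝ) ≤ (m : ℕ) := Nat.cast_nonneg _
      linarith [hp1 d, abs_nonneg σ₁]
    · simp only [a, Sum.elim_inr, add_re, sub_re, one_re, natCast_re]
      have : ((j : ℕ) : ℝ) + 1 ≤ K := by exact_mod_cast j.2
      linarith
  have hline : ∀ s : ℂ, s.re = σ₂ → DifferentiableAt ℂ (barnesAlg p q b) s := by
    intro s hs
    refine hdiff s (by linarith) hs.le (fun d m h => ?_) (fun j h => ?_)
    · have := ha₂ (Sum.inl ⟨d, m⟩)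
      simp only [a, Sum.elim_inl, ← h] at this
      linarith
    · have := ha₂ (Sum.inr j)
      simp only [a, Sum.elim_inr, ← h] at this
      linarith
  have hint := integrable_norm_mul_exp (T := T) hline (fun s hs => hbd s (by linarith) hs.le)
  refine ⟨K, by exact_mod_cast (by linarith : (N : ℝ) ≤ K), (2 * Real.pi)⁻¹ *
    ∫ t : ℝ, ‖barnesAlg p q b (σ₂ + t * I)‖ * Real.exp (Real.pi * |t|), fun w hw hw0 => ?_⟩
  have key := lineIntegral_sub_lineIntegral (Φ := barnesAlg p q b) (C := C) (T := T)
    (θ := Real.pi) hσ (a := a) (ρ := r) hinj ha₁ ha₂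
    (fun s h1 h2 h3 => hdiff s h1 h2 (fun d m => h3 (Sum.inl ⟨d, m⟩)) fun j => h3 (Sum.inr j))
    (by
      rintro (⟨d, m⟩ | j)
      · exact hB.residue d m
      · exact tendsto_sub_mul_barnesAlg hpq b j) hbd hw
  have hS := hsum w hw (fun d => Real.pi / sin (Real.pi * (p d + q b)) * sinQuot p q d *
    analyticSol p q d w) (fun d => by
      refine ((summable_analyticSol hpp hpq d w).hasSum.mul_left
        (Real.pi / sin (Real.pi * (p d + q b)) * sinQuot p q d)).congr_fun fun m => ?_
      rw [show -w * (p d - m) = w * (m - p d) by ring]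
      ring)
  rw [Fintype.sum_sum_type, Fintype.sum_sigma] at key
  simp only [a, r, Sum.elim_inl, Sum.elim_inr] at key
  simp_rw [Finset.sum_range] at hS ⊢
  have hpi0 : (2 * Real.pi : ℂ) ≠ 0 := by simp [Real.pi_ne_zero]
  -- The residues at the finitely many left-hand poles to the right of `σ₁` occur both in the
  -- closed-up sum and in the shift from `σ₁` to `σ₂`; they cancel and leave the right-hand residues
  -- and the integral over `σ₂`.
  have hres : (∑ d, Real.pi / sin (Real.pi * (p d + q b)) * sinQuot p q d * analyticSol p q d w) -
      ∑ j : Fin K, algCoeff p q b j * exp (w * (q b - 1 - (j : ℕ))) =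
      (2 * Real.pi : ℂ)⁻¹ * lineIntegral (barnesAlg p q b) σ₂ w := by
    have h1 : ∑ j : Fin K, -algCoeff p q b j * exp (-w * (1 - q b + (j : ℕ))) =
        -∑ j : Fin K, algCoeff p q b j * exp (w * (q b - 1 - (j : ℕ))) := by
      rw [← Finset.sum_neg_distrib]
      refine Finset.sum_congr rfl fun j _ => ?_
      rw [show -w * (1 - q b + ((j : ℕ) : ℂ)) = w * (q b - 1 - (j : ℕ)) by ring]
      ring
    rw [h1] at key
    rw [eq_inv_mul_iff_mul_eq₀ hpi0, hS]
    linear_combination -key + lineIntegral (barnesAlg p q b) σ₁ w * mul_inv_cancel₀ hpi0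
  rw [hres, norm_mul]
  have hn := norm_lineIntegral_le hint hw
  have hexp : Real.exp (-w.re * σ₂) ≤ Real.exp (w.re * ((q b).re - 1 - N)) := by
    apply Real.exp_le_exp.2
    rw [neg_mul, ← mul_neg]
    exact mul_le_mul_of_nonneg_left (by rw [hσ₂]; linarith) hw0
  have hpn : ‖(2 * Real.pi : ℂ)⁻¹‖ = (2 * Real.pi)⁻¹ := by
    rw [norm_inv, norm_mul, Complex.norm_real, Real.norm_eq_abs, abs_of_pos Real.pi_pos,
      Complex.norm_two]
  rw [hpn, mul_assoc]
  have hI : 0 ≤ ∫ t : ℝ, ‖barnesAlg p q b (σ₂ + t * I)‖ * Real.exp (Real.pi * |t|) :=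
    integral_nonneg fun t => by positivity
  have := Real.pi_pos
  gcongr
  exact hn.trans (by gcongr)

end CDO

end

/-! ### Factorial bounds for the exponential integrand far to the right -/

noncomputable section

namespace CDO

open Complex Filter Topology MeasureTheory

variable {n : ℕ} {p : Fin (n + 1) → ℂ} {q : Fin n → ℂ}

lemma norm_Gamma_le {s : ℂ} (hs : 0 < s.re) : ‖Gamma s‖ ≤ Real.Gamma s.re := by
  rw [Complex.Gamma_eq_integral hs, Real.Gamma_eq_integral hs, Complex.GammaIntegral]
  refine norm_integral_le_of_norm_le (Real.GammaIntegral_convergent hs) ?_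
  filter_upwards [ae_restrict_mem measurableSet_Ioi] with x hx
  rw [norm_mul, Complex.norm_cpow_eq_rpow_re_of_pos hx, Complex.norm_real, Real.norm_eq_abs,
    Real.abs_exp]
  simp

lemma barnesExp_add_one {s : ℂ} (hp : ∀ c, s - p c ≠ 0) (hq : ∀ c, s + q c ≠ 0) :
    barnesExp p q (s + 1) =
      barnesExp p q s * ((∏ c, (s - p c)) / ∏ c, (s + q c)) := by
  have h1 : ∀ c, Gamma (s + 1 - p c) = (s - p c) * Gamma (s - p c) := fun c => by
    rw [← Complex.Gamma_add_one _ (hp c)]; ring_nf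
  have h2 : ∀ c, (Gamma (s + 1 + q c))⁻¹ = (s + q c)⁻¹ * (Gamma (s + q c))⁻¹ := fun c => by
    rw [← mul_inv, ← Complex.Gamma_add_one _ (hq c)]; ring_nf
  simp_rw [barnesExp, h1, h2, Finset.prod_mul_distrib]
  rw [Finset.prod_inv_distrib (fun c => s + q c)]
  ring

/-- To the right `barnesExp` grows like `Γ(s)`: the ratio is a product of `n + 1` factors over `n`
factors, each equal to `s` up to a relative error `O(1/Re s)`. -/
lemma exists_norm_barnesExp_add_one_le (p : Fin (n + 1) → ℂ) (q : Fin n → ℂ) :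
    ∃ D L : ℕ, ∀ s : ℂ, (L : ℝ) ≤ s.re → 0 < s.re →
      ‖barnesExp p q (s + 1)‖ ≤ ‖s‖ * Real.exp (D / s.re) * ‖barnesExp p q s‖ := by
  obtain ⟨D, hD⟩ := exists_nat_ge (∑ c, ‖p c‖ + ∑ c, 2 * ‖q c‖)
  have hP0 : 0 ≤ ∑ c, ‖p c‖ := Finset.sum_nonneg fun _ _ => norm_nonneg _
  have hQ0 : 0 ≤ ∑ c, 2 * ‖q c‖ := Finset.sum_nonneg fun _ _ => by positivity
  have hP : ∀ c, ‖p c‖ ≤ ∑ c, ‖p c‖ := fun c =>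
    Finset.single_le_sum (f := fun c => ‖p c‖) (fun _ _ => norm_nonneg _) (Finset.mem_univ c)
  have hQ : ∀ c, 2 * ‖q c‖ ≤ ∑ c, 2 * ‖q c‖ := fun c =>
    Finset.single_le_sum (f := fun c => 2 * ‖q c‖) (fun _ _ => by positivity) (Finset.mem_univ c)
  refine ⟨D, D + 1, fun s hs hs0 => ?_⟩
  push_cast at hs
  have hss : s.re ≤ ‖s‖ := Complex.re_le_norm s
  have hsp : 0 < ‖s‖ := by linarith
  have hp : ∀ c, s - p c ≠ 0 := fun c h => by
    have : ‖s‖ = ‖p c‖ := by rw [sub_eq_zero.1 h]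
    linarith [hP c]
  have hq : ∀ c, s + q c ≠ 0 := fun c h => by
    have : ‖s‖ = ‖q c‖ := by rw [eq_neg_of_add_eq_zero_left h, norm_neg]
    linarith [hQ c, norm_nonneg (q c)]
  rw [barnesExp_add_one hp hq, norm_mul, mul_comm, norm_div, norm_prod, norm_prod]
  refine mul_le_mul_of_nonneg_right ?_ (norm_nonneg _)
  have b1 : ∏ c, ‖s - p c‖ ≤ ‖s‖ ^ (n + 1) * Real.exp (∑ c, ‖p c‖ / s.re) := by
    calc _ ≤ ∏ c, (‖s‖ * Real.exp (‖p c‖ / s.re)) := by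
          refine Finset.prod_le_prod (fun _ _ => norm_nonneg _) fun c _ => ?_
          have e1 : ‖p c‖ / s.re + 1 ≤ Real.exp (‖p c‖ / s.re) := Real.add_one_le_exp _
          have e2 : ‖p c‖ ≤ ‖s‖ * (‖p c‖ / s.re) := by
            rw [← mul_div_assoc, le_div_iff₀ hs0, mul_comm]
            gcongr
          calc ‖s - p c‖ ≤ ‖s‖ + ‖p c‖ := norm_sub_le _ _
            _ ≤ ‖s‖ * (‖p c‖ / s.re + 1) := by linarith
            _ ≤ _ := by gcongr
      _ = _ := by rw [Finset.prod_mul_distrib, Real.exp_sum]; simp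
  have b2 : ‖s‖ ^ n ≤ (∏ c, ‖s + q c‖) * Real.exp (∑ c, 2 * ‖q c‖ / s.re) := by
    rw [Real.exp_sum, ← Finset.prod_mul_distrib]
    calc ‖s‖ ^ n = ∏ c : Fin n, ‖s‖ := by simp
      _ ≤ _ := by
        refine Finset.prod_le_prod (fun _ _ => norm_nonneg _) fun c _ => ?_
        set y : ℝ := ‖q c‖ / s.re with hy
        have hy0 : 0 ≤ y := by positivity
        have hy1 : y ≤ 1 / 2 := by
          rw [hy, div_le_iff₀ hs0]; linarith [hQ c]
        have e1 : 2 * y + 1 ≤ Real.exp (2 * y) := Real.add_one_le_exp _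
        have e2 : ‖q c‖ ≤ ‖s‖ * y := by
          rw [hy, ← mul_div_assoc, le_div_iff₀ hs0, mul_comm]
          gcongr
        have e3 : ‖s‖ * (1 - y) ≤ ‖s + q c‖ := by
          have := norm_sub_norm_le s (-q c)
          rw [norm_neg, sub_neg_eq_add] at this
          linarith
        rw [mul_div_assoc, ← hy]
        calc ‖s‖ ≤ ‖s‖ * (1 - y) * (2 * y + 1) := by nlinarith [mul_nonneg hsp.le hy0]
          _ ≤ _ := by gcongr
  have hqpos : 0 < ∏ c, ‖s + q c‖ := Finset.prod_pos fun c _ => norm_pos_iff.2 (hq c)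
  rw [div_le_iff₀ hqpos]
  calc _ ≤ ‖s‖ ^ (n + 1) * Real.exp (∑ c, ‖p c‖ / s.re) := b1
    _ = ‖s‖ * Real.exp (∑ c, ‖p c‖ / s.re) * ‖s‖ ^ n := by ring
    _ ≤ ‖s‖ * Real.exp (∑ c, ‖p c‖ / s.re) *
        ((∏ c, ‖s + q c‖) * Real.exp (∑ c, 2 * ‖q c‖ / s.re)) := by gcongr
    _ = ‖s‖ * Real.exp (∑ c, ‖p c‖ / s.re + ∑ c, 2 * ‖q c‖ / s.re) * ∏ c, ‖s + q c‖ := by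
        rw [Real.exp_add]; ring
    _ ≤ _ := by
        rw [← Finset.sum_div, ← Finset.sum_div, ← add_div]
        gcongr

lemma differentiableAt_barnesExp {s : ℂ} (h : ∀ d, ∀ m : ℕ, s ≠ p d - m) :
    DifferentiableAt ℂ (barnesExp p q) s :=
  (differentiableAt_prod_Gamma h).mul (differentiable_prod_Gamma_inv q s)

/-- A factorial bound for the integral of `barnesExp` along lines far to the right. -/
lemma exists_lineIntegral_barnesExp_le (hpp : ∀ b c, b ≠ c → ∀ m : ℤ, p b - p c ≠ m)
    (hpq : ∀ b c, ∀ m : ℤ, p b + q c ≠ m) (L₀ : ℝ) :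
    ∃ J : ℝ, 0 ≤ J ∧ ∃ S E : ℕ, L₀ ≤ S ∧ ∀ M : ℕ, ∀ x : ℝ,
      ‖lineIntegral (barnesExp p q) (S + M : ℝ) x‖ ≤
        J * (M + E).factorial * Real.exp (-x * (S + M)) := by
  obtain ⟨D, L, hDL⟩ := exists_norm_barnesExp_add_one_le p q
  obtain ⟨S, hS⟩ := exists_nat_ge (|L₀| + L + 2 + ∑ c, |(p c).re|)
  have hP0 : 0 ≤ ∑ c, |(p c).re| := Finset.sum_nonneg fun _ _ => abs_nonneg _
  have hP : ∀ c, (p c).re ≤ ∑ c, |(p c).re| := fun c => (le_abs_self _).trans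
    (Finset.single_le_sum (f := fun c => |(p c).re|) (fun _ _ => abs_nonneg _) (Finset.mem_univ c))
  have hL0 : (0 : ℝ) ≤ L := Nat.cast_nonneg L
  have hS2 : (2 : ℝ) ≤ S := by linarith [abs_nonneg L₀]
  have hSL : (L : ℝ) ≤ S := by linarith [abs_nonneg L₀]
  have hdiff : ∀ s : ℂ, (S : ℝ) ≤ s.re → DifferentiableAt ℂ (barnesExp p q) s := by
    intro s hs
    refine differentiableAt_barnesExp fun d m h => ?_
    have : s.re = (p d).re - m := by rw [h]; simp
    linarith [hP d, (Nat.cast_nonneg m : (0 : ℝ) ≤ m), abs_nonneg L₀]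
  obtain ⟨C, hC, A, T, hT, hbd⟩ :=
    ((barnesIntegrand_barnesExp hpp hpq).decay.mul stripDecay_Gamma_inv) S S
  -- Comparison of `barnesExp` with `Γ` along the translates of the line `Re s = S`. As `S ≥ 2`,
  -- each error factor is at most `((M + 2)/(M + 1)) ^ D`, and the product telescopes to `(M + 1) ^
  -- D`.
  have hstep : ∀ s : ℂ, s.re = S → ∀ M : ℕ, ‖barnesExp p q (s + M)‖ * ‖Gamma s‖ ≤
      ‖barnesExp p q s‖ * ‖Gamma (s + M)‖ * (M + 1) ^ D := by
    intro s hs M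
    induction M with
    | zero => simp
    | succ M ih =>
      have hre : (s + M).re = S + M := by simp [hs]
      have hM0 : (0 : ℝ) ≤ M := Nat.cast_nonneg M
      have h1 := hDL (s + M) (by rw [hre]; linarith) (by rw [hre]; linarith)
      have hne : s + M ≠ 0 := fun h => by
        have := congrArg re h
        rw [hre, zero_re] at this
        linarith
      have h2 : Real.exp (D / (s + M).re) ≤ ((M + 2) / (M + 1)) ^ D := by
        rw [div_eq_mul_inv, Real.exp_nat_mul, hre]
        gcongr
        have e1 : Real.exp (((S : ℝ) + M)⁻¹) ≤ Real.exp ((M + 2 : ℝ)⁻¹) := by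
          apply Real.exp_le_exp.2
          exact inv_anti₀ (by positivity) (by linarith)
        refine e1.trans ?_
        have e2 := Real.add_one_le_exp (-(M + 2 : ℝ)⁻¹)
        rw [Real.exp_neg] at e2
        rw [le_div_iff₀ (by positivity)]
        have e3 := mul_le_mul_of_nonneg_left e2 (Real.exp_pos ((M + 2 : ℝ)⁻¹)).le
        rw [mul_inv_cancel₀ (Real.exp_pos _).ne'] at e3
        have e4 : -(M + 2 : ℝ)⁻¹ + 1 = (M + 1) / (M + 2) := by field_simp; ring
        rw [e4, ← mul_div_assoc, div_le_one (by positivity)] at e3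
        exact e3
      have h3 : ‖Gamma (s + (M + 1 : ℕ))‖ = ‖s + M‖ * ‖Gamma (s + M)‖ := by
        rw [Nat.cast_succ, ← add_assoc, Complex.Gamma_add_one _ hne, norm_mul]
      rw [h3, Nat.cast_succ, ← add_assoc]
      calc _ ≤ (‖s + M‖ * ((M + 2) / (M + 1)) ^ D * ‖barnesExp p q (s + M)‖) * ‖Gamma s‖ := by
            gcongr
            exact h1.trans (by gcongr)
        _ = ‖s + M‖ * ((M + 2) / (M + 1)) ^ D * (‖barnesExp p q (s + M)‖ * ‖Gamma s‖) := by ring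
        _ ≤ ‖s + M‖ * ((M + 2) / (M + 1)) ^ D *
            (‖barnesExp p q s‖ * ‖Gamma (s + M)‖ * (M + 1) ^ D) := by gcongr
        _ = ‖barnesExp p q s‖ * (‖s + M‖ * ‖Gamma (s + M)‖) *
            (((M + 2) / (M + 1)) * (M + 1)) ^ D := by rw [mul_pow]; ring
        _ = _ := by
            rw [div_mul_cancel₀ _ (by positivity)]
            push_cast
            ring
  -- Powers of `|Im s|` are paid for by raising the argument of `Γ`, since each `|s + M + B|` is at
  -- least `max 1 |Im s|`; the result is bounded by the value of `Γ` at the real part, a factorial.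
  have hGam : ∀ s : ℂ, s.re = S → ∀ M B : ℕ,
      ‖Gamma (s + M)‖ * (max 1 |s.im|) ^ B ≤ (S + M + B - 1).factorial := by
    intro s hs M B
    have h1 : ‖Gamma (s + M)‖ * (max 1 |s.im|) ^ B ≤ ‖Gamma (s + M + B)‖ := by
      induction B with
      | zero => simp
      | succ B ih =>
        have hre : (s + M + B).re = S + M + B := by simp [hs]
        have hB0 : (0 : ℝ) ≤ B := Nat.cast_nonneg B
        have hM0 : (0 : ℝ) ≤ M := Nat.cast_nonneg M
        have hne : s + M + B ≠ 0 := fun h => by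
          have := congrArg re h
          rw [hre, zero_re] at this
          linarith
        rw [Nat.cast_succ, ← add_assoc, Complex.Gamma_add_one _ hne, norm_mul, pow_succ]
        have hmax : max 1 |s.im| ≤ ‖s + M + B‖ := by
          refine max_le ?_ ?_
          · have := Complex.re_le_norm (s + M + B)
            rw [hre] at this
            linarith
          · simpa using Complex.abs_im_le_norm (s + M + B)
        calc _ = max 1 |s.im| * (‖Gamma (s + M)‖ * max 1 |s.im| ^ B) := by ring
          _ ≤ _ := by gcongr
    refine h1.trans ?_
    have hre : (s + M + B).re = S + M + B := by simp [hs]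
    have hS2' : 2 ≤ S := by exact_mod_cast hS2
    refine (norm_Gamma_le (by rw [hre]; positivity)).trans (le_of_eq ?_)
    rw [hre, show (S : ℝ) + M + B = ((S + M + B - 1 : ℕ) : ℝ) + 1 by
      rw [Nat.cast_sub (by omega)]; push_cast; ring, Real.Gamma_nat_eq_factorial]
  -- The quotient `barnesExp / Γ` has exponential rate `π/2 - π/2 = 0`, so it grows at most like
  -- `|t| ^ A`; the power `A + 2` makes it integrable.
  let φ : ℝ → ℂ := fun t => barnesExp p q (S + t * I) * (Gamma (S + t * I))⁻¹ *
    (((max 1 |t|) ^ (A + 2) : ℝ) : ℂ)⁻¹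
  have hφ : Integrable φ := by
    refine integrable_of_norm_le_div_sq (C := C) (T := T) ?_ fun t ht => ?_
    · have c1 := continuous_line (σ := S) (f := barnesExp p q) fun s hs => hdiff s hs.ge
      have c2 := continuous_line (σ := S) (f := fun s => (Gamma s)⁻¹)
        fun s _ => differentiable_one_div_Gamma s
      push_cast at c1 c2
      refine (c1.mul c2).mul (Continuous.inv₀ (by fun_prop) fun t => ?_)
      have : (0 : ℝ) < max 1 |t| := lt_max_of_lt_left one_pos
      exact_mod_cast (pow_pos this _).ne'
    · have h1 := hbd (S + t * I) (by simp) (by simp) (by simpa using ht)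
      have ht1 : 1 ≤ |t| := hT.trans ht
      simp only [add_im, natCast_im, mul_im, ofReal_re, I_im, mul_one, ofReal_im, I_re, mul_zero,
        add_zero, zero_add, add_neg_cancel, neg_zero, zero_mul, Real.exp_zero] at h1
      simp only [φ]
      rw [norm_mul, norm_inv, Complex.norm_real, Real.norm_eq_abs,
        abs_of_nonneg (by positivity), max_eq_right ht1]
      calc _ ≤ C * |t| ^ A * (|t| ^ (A + 2))⁻¹ := by gcongr
        _ = _ := by
          have : 0 < |t| := by linarith
          rw [← sq_abs t, pow_add]; field_simp
  -- The offset `E` combines the factorial `(S + M + (A + 2) - 1)!` with the power `(M + 1) ^ D`.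
  refine ⟨∫ t, ‖φ t‖, integral_nonneg fun t => norm_nonneg _, S, S + (A + 2) - 1 + D,
    by linarith [le_abs_self L₀], fun M x => ?_⟩
  rw [lineIntegral]
  have hpt : ∀ t : ℝ, ‖barnesExp p q ((S + M : ℝ) + t * I) * exp (-x * ((S + M : ℝ) + t * I))‖ ≤
      ‖φ t‖ * ((M + (S + (A + 2) - 1 + D)).factorial * Real.exp (-x * (S + M))) := by
    intro t
    have hs : (S + t * I : ℂ).re = S := by simp
    have e1 := hstep (S + t * I) hs M
    have e2 := hGam (S + t * I) hs M (A + 2)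
    have him : (S + t * I : ℂ).im = t := by simp
    rw [him] at e2
    have hG : Gamma (S + t * I) ≠ 0 :=
      Complex.Gamma_ne_zero_of_re_pos (by rw [hs]; linarith)
    have hGn : 0 < ‖Gamma (S + t * I)‖ := norm_pos_iff.2 hG
    have hmx : (0 : ℝ) < max 1 |t| := lt_max_of_lt_left one_pos
    have hexp : ‖exp (-x * ((S + M : ℝ) + t * I))‖ = Real.exp (-x * (S + M)) := by
      rw [Complex.norm_exp]; simp
    rw [norm_mul, hexp, show ((S + M : ℝ) + t * I : ℂ) = S + t * I + M by push_cast; ring,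
      ← mul_assoc]
    refine mul_le_mul_of_nonneg_right ?_ (Real.exp_pos _).le
    have e3 : ‖φ t‖ = ‖barnesExp p q (S + t * I)‖ * ‖Gamma (S + t * I)‖⁻¹ *
        ((max 1 |t|) ^ (A + 2))⁻¹ := by
      simp only [φ]
      rw [norm_mul, norm_mul, norm_inv, norm_inv, Complex.norm_real, Real.norm_eq_abs,
        abs_of_nonneg (by positivity)]
    have e4 : ((S + M + (A + 2) - 1).factorial : ℝ) * (M + 1) ^ D ≤
        (M + (S + (A + 2) - 1 + D)).factorial := by
      have hS2' : 2 ≤ S := by exact_mod_cast hS2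
      have h1 := Nat.factorial_mul_pow_le_factorial (m := S + M + (A + 2) - 1) (n := D)
      have h2 : (M + 1) ^ D ≤ (S + M + (A + 2) - 1 + 1) ^ D := Nat.pow_le_pow_left (by omega) _
      rw [show M + (S + (A + 2) - 1 + D) = S + M + (A + 2) - 1 + D by omega]
      exact_mod_cast (Nat.mul_le_mul_left _ h2).trans h1
    rw [e3, ← div_eq_mul_inv, ← div_eq_mul_inv, div_div, div_mul_eq_mul_div,
      le_div_iff₀ (by positivity)]
    calc _ = (‖barnesExp p q (S + t * I + M)‖ * ‖Gamma (S + t * I)‖) *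
          (max 1 |t|) ^ (A + 2) := by ring
      _ ≤ (‖barnesExp p q (S + t * I)‖ * ‖Gamma (S + t * I + M)‖ * (M + 1) ^ D) *
          (max 1 |t|) ^ (A + 2) := by gcongr
      _ = ‖barnesExp p q (S + t * I)‖ * ((‖Gamma (S + t * I + M)‖ * (max 1 |t|) ^ (A + 2)) *
          (M + 1) ^ D) := by ring
      _ ≤ ‖barnesExp p q (S + t * I)‖ * ((S + M + (A + 2) - 1).factorial * (M + 1) ^ D) := by
          gcongr
      _ ≤ _ := by gcongr
  refine (norm_integral_le_of_norm_le (hφ.norm.mul_const _) (Eventually.of_forall hpt)).trans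
    (le_of_eq ?_)
  rw [integral_mul_const]; ring

end CDO

end

/-! ### The recessive solution -/

noncomputable section

namespace CDO

open Complex Filter Topology MeasureTheory

variable {n : ℕ} {p : Fin (n + 1) → ℂ} {q : Fin n → ℂ}

/-- Factorial bounds on all moments give exponential decay. -/
lemma mul_exp_le_of_forall_mul_pow_le {g ζ J : ℝ} {E : ℕ} (hζ : 1 ≤ ζ) (hJ : 0 ≤ J)
    (h : ∀ M : ℕ, g * ζ ^ M ≤ J * (M + E).factorial) :
    g * Real.exp ζ ≤ J * ((E + 2) * E.factorial + 1) * ζ ^ (E + 2) := by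
  have hζ0 : 0 < ζ := by linarith
  -- The exponential series is summed against the hypothesis. The term of index `T + E + 2` uses the
  -- moment `M = T`, and `(T + E)! / (T + E + 2)! = 1/(T + E + 1) - 1/(T + E + 2)` telescopes; the
  -- first `E + 2` terms are bounded by `ζ ^ (E + 2)` each.
  have hpart : ∀ T : ℕ, g * ∑ m ∈ Finset.range (T + (E + 2)), ζ ^ m / m.factorial ≤
      J * ((E + 2) * E.factorial + (1 - (T + E + 1 : ℝ)⁻¹)) * ζ ^ (E + 2) := by
    intro T
    induction T with
    | zero =>
      have h0 : g ≤ J * E.factorial := by simpa using h 0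
      have h1 : ∀ m ∈ Finset.range (0 + (E + 2)), ζ ^ m / (m.factorial : ℝ) ≤ ζ ^ (E + 2) := by
        intro m hm
        have : m ≤ E + 2 := by simp at hm; omega
        refine (div_le_self (by positivity) (by exact_mod_cast m.factorial_pos)).trans ?_
        exact pow_le_pow_right₀ hζ this
      have h2 := Finset.sum_le_card_nsmul _ _ _ h1
      rw [Finset.card_range, nsmul_eq_mul] at h2
      have h3 : (0 : ℝ) ≤ 1 - ((0 : ℕ) + E + 1 : ℝ)⁻¹ := by
        rw [sub_nonneg]
        exact inv_le_one_of_one_le₀ (by simp)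
      calc _ ≤ (J * E.factorial) * (((0 + (E + 2) : ℕ) : ℝ) * ζ ^ (E + 2)) := by gcongr
        _ = J * ((E + 2) * E.factorial + 0) * ζ ^ (E + 2) := by push_cast; ring
        _ ≤ _ := by gcongr
    | succ T ih =>
      have hM := h T
      rw [show T + 1 + (E + 2) = T + (E + 2) + 1 by ring, Finset.sum_range_succ, mul_add]
      have hf : ((T + (E + 2)).factorial : ℝ) = (T + E + 2) * ((T + E + 1) * (T + E).factorial) := by
        rw [show T + (E + 2) = T + E + 1 + 1 by ring, Nat.factorial_succ, Nat.factorial_succ]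
        push_cast; ring
      have hF : (0 : ℝ) < (T + E).factorial := by exact_mod_cast Nat.factorial_pos _
      have h1 : g * (ζ ^ (T + (E + 2)) / ((T + (E + 2)).factorial : ℝ)) ≤
          J * ((T + E + 1 : ℝ)⁻¹ - (T + E + 2 : ℝ)⁻¹) * ζ ^ (E + 2) := by
        have e : (T + E + 1 : ℝ)⁻¹ - (T + E + 2 : ℝ)⁻¹ =
            (((T : ℝ) + E + 2) * (T + E + 1))⁻¹ := by field_simp; ring
        rw [hf, pow_add, e]
        calc _ = (g * ζ ^ T) * (ζ ^ (E + 2) / ((T + E + 2) * ((T + E + 1) *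
              (T + E).factorial))) := by ring
          _ ≤ (J * (T + E).factorial) * (ζ ^ (E + 2) / ((T + E + 2) * ((T + E + 1) *
              (T + E).factorial))) := by gcongr
          _ = _ := by field_simp
      refine (add_le_add ih h1).trans (le_of_eq ?_)
      push_cast
      rw [show (T : ℝ) + 1 + E + 1 = T + E + 2 by ring]
      ring
  have hlim : Tendsto (fun T : ℕ => g * ∑ m ∈ Finset.range (T + (E + 2)),
      ζ ^ m / (m.factorial : ℝ)) atTop (𝓝 (g * Real.exp ζ)) := by
    rw [Real.exp_eq_exp_ℝ]
    exact ((tendsto_add_atTop_iff_nat (E + 2)).2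
      (NormedSpace.expSeries_div_hasSum_exp ζ).tendsto_sum_nat).const_mul g
  refine le_of_tendsto' hlim fun T => (hpart T).trans ?_
  gcongr
  have : (0 : ℝ) ≤ (T + E + 1 : ℝ)⁻¹ := by positivity
  linarith

/-- The combination of analytic solutions which is recessive on the negative real axis, as a
function of the logarithm of minus the variable. -/
def recessiveSol (p : Fin (n + 1) → ℂ) (q : Fin n → ℂ) (w : ℂ) : ℂ :=
  ∑ d, exp (I * Real.pi * p d) * sinQuot p q d * analyticSol p q d (w + Real.pi * I)

/-- The shift by `πi` produces the signs `(-1) ^ m` of the residues of `barnesExp`, and the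
prefactor removes the resulting constant `e^{-iπ p d}`. Thus `recessiveSol` is the sum of all
left-hand residues. -/
lemma hasSum_recessiveSol_term (hpp : ∀ b c, b ≠ c → ∀ m : ℤ, p b - p c ≠ m)
    (hpq : ∀ b c, ∀ m : ℤ, p b + q c ≠ m) (d : Fin (n + 1)) (w : ℂ) :
    HasSum (fun m : ℕ => (-1) ^ m * (sinQuot p q d * gammaQuot p q (p d - m)) *
      exp (-w * (p d - m)))
      (exp (I * Real.pi * p d) * sinQuot p q d * analyticSol p q d (w + Real.pi * I)) := by
  refine ((summable_analyticSol hpp hpq d (w + Real.pi * I)).hasSum.mul_left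
    (exp (I * Real.pi * p d) * sinQuot p q d)).congr_fun fun m => ?_
  have e : exp ((w + Real.pi * I) * (m - p d)) =
      exp (-w * (p d - m)) * (-1) ^ m * exp (-(I * Real.pi * p d)) := by
    rw [← exp_pi_mul_I, ← Complex.exp_nat_mul, ← Complex.exp_add, ← Complex.exp_add]
    congr 1; ring
  have e2 : exp (I * Real.pi * p d) * exp (-(I * Real.pi * p d)) = 1 := by
    rw [← Complex.exp_add]; simp
  rw [e]
  linear_combination (-(sinQuot p q d * gammaQuot p q (p d - m) * exp (-w * (p d - m)) *
    (-1) ^ m)) * e2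

/-- Exponential growth in the logarithm, that is, polynomial growth in the variable, in a half
plane. -/
theorem exists_norm_recessiveSol_le (hpp : ∀ b c, b ≠ c → ∀ m : ℤ, p b - p c ≠ m)
    (hpq : ∀ b c, ∀ m : ℤ, p b + q c ≠ m) :
    ∃ C K : ℝ, 0 ≤ C ∧ 0 ≤ K ∧ ∀ w : ℂ, |w.im| ≤ Real.pi / 2 → 0 ≤ w.re →
      ‖recessiveSol p q w‖ ≤ C * Real.exp (K * w.re) := by
  -- The endpoint `θ = κ = π/2` is used: the edges `|Im w| = π/2` are exactly the lines needed for
  -- Phragmén–Lindelöf.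
  obtain ⟨σ, hσ, k, -, hint, hsum⟩ :=
    (barnesIntegrand_barnesExp hpp hpq).exists_sum_eq hpp le_rfl 0
  set K : ℝ := |σ| + ∑ d, ∑ m ∈ Finset.range (k d), ‖p d - m‖ with hK
  have hK1 : 0 ≤ ∑ d, ∑ m ∈ Finset.range (k d), ‖p d - m‖ :=
    Finset.sum_nonneg fun _ _ => Finset.sum_nonneg fun _ _ => norm_nonneg _
  have hI : 0 ≤ ∫ t : ℝ, ‖barnesExp p q (σ + t * I)‖ * Real.exp (Real.pi / 2 * |t|) :=
    integral_nonneg fun t => by positivity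
  have hpos := Real.pi_pos
  refine ⟨(∑ d, ∑ m ∈ Finset.range (k d), ‖sinQuot p q d * gammaQuot p q (p d - m)‖ *
      Real.exp (‖p d - m‖ * (Real.pi / 2))) + (2 * Real.pi)⁻¹ *
      ∫ t : ℝ, ‖barnesExp p q (σ + t * I)‖ * Real.exp (Real.pi / 2 * |t|), K, ?_,
      by positivity, fun w hw hw0 => ?_⟩
  · have : 0 ≤ ∑ d, ∑ m ∈ Finset.range (k d), ‖sinQuot p q d * gammaQuot p q (p d - m)‖ *
      Real.exp (‖p d - m‖ * (Real.pi / 2)) :=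
      Finset.sum_nonneg fun _ _ => Finset.sum_nonneg fun _ _ => by positivity
    positivity
  rw [recessiveSol, hsum w hw _ fun d => hasSum_recessiveSol_term hpp hpq d w, add_mul]
  have hpn : ‖(2 * Real.pi : ℂ)⁻¹‖ = (2 * Real.pi)⁻¹ := by
    rw [norm_inv, norm_mul, Complex.norm_real, Real.norm_eq_abs, abs_of_pos Real.pi_pos,
      Complex.norm_two]
  refine (norm_add_le _ _).trans (add_le_add ?_ ?_)
  · rw [Finset.sum_mul]
    refine (norm_sum_le _ _).trans (Finset.sum_le_sum fun d _ => ?_)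
    rw [Finset.sum_mul]
    refine (norm_sum_le _ _).trans (Finset.sum_le_sum fun m hm => ?_)
    rw [norm_mul, norm_mul, norm_pow, norm_neg, norm_one, one_pow, one_mul, mul_assoc]
    refine mul_le_mul_of_nonneg_left ?_ (norm_nonneg _)
    rw [Complex.norm_exp, ← Real.exp_add]
    apply Real.exp_le_exp.2
    have h1 : ‖p d - m‖ ≤ K := by
      have h2 : ‖p d - m‖ ≤ ∑ m ∈ Finset.range (k d), ‖p d - m‖ :=
        Finset.single_le_sum (f := fun m : ℕ => ‖p d - m‖) (fun _ _ => norm_nonneg _) hm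
      have h3 : ∑ m ∈ Finset.range (k d), ‖p d - m‖ ≤
          ∑ d, ∑ m ∈ Finset.range (k d), ‖p d - m‖ :=
        Finset.single_le_sum (f := fun d => ∑ m ∈ Finset.range (k d), ‖p d - m‖)
          (fun _ _ => Finset.sum_nonneg fun _ _ => norm_nonneg _) (Finset.mem_univ d)
      linarith [abs_nonneg σ]
    rw [mul_re, neg_re, neg_im]
    have h4 := (abs_le.1 (Complex.abs_re_le_norm (p d - m))).1
    have h5 : w.im * (p d - m).im ≤ Real.pi / 2 * ‖p d - m‖ := by
      refine (le_abs_self _).trans ?_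
      rw [abs_mul]
      exact mul_le_mul hw (Complex.abs_im_le_norm _) (abs_nonneg _) (by positivity)
    nlinarith
  · rw [norm_mul, hpn, mul_assoc]
    refine mul_le_mul_of_nonneg_left ((norm_lineIntegral_le hint hw).trans ?_) (by positivity)
    refine mul_le_mul_of_nonneg_left (Real.exp_le_exp.2 ?_) hI
    have := neg_abs_le σ
    nlinarith

/-- Exponential decay on the positive real axis. -/
theorem exists_norm_recessiveSol_ofReal_le (hpp : ∀ b c, b ≠ c → ∀ m : ℤ, p b - p c ≠ m)
    (hpq : ∀ b c, ∀ m : ℤ, p b + q c ≠ m) :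
    ∃ C K : ℝ, 0 ≤ C ∧ 0 ≤ K ∧ ∀ x : ℝ, 0 ≤ x →
      ‖recessiveSol p q x‖ ≤ C * Real.exp (K * x) * Real.exp (-Real.exp x) := by
  have hpi : (0 : ℝ) < Real.pi / 2 := by positivity
  have hB := barnesIntegrand_barnesExp hpp hpq
  obtain ⟨σ₁, hσ₁, k, hk, -, hsum⟩ := hB.exists_sum_eq hpp hpi.le 0
  obtain ⟨J, hJ, S, E, hS, hbound⟩ := exists_lineIntegral_barnesExp_le hpp hpq
    (1 + ∑ c, |(p c).re|)
  have hp0 : 0 ≤ ∑ c, |(p c).re| := Finset.sum_nonneg fun _ _ => abs_nonneg _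
  have hp1 : ∀ c, (p c).re ≤ ∑ c, |(p c).re| := fun c => (le_abs_self _).trans
    (Finset.single_le_sum (f := fun c => |(p c).re|) (fun _ _ => abs_nonneg _) (Finset.mem_univ c))
  -- The integrand has no poles to the right of the `p c`, so after collecting the finitely many
  -- residues the solution is the integral over every line `S + M`.
  have hrep : ∀ x : ℝ, ∀ M : ℕ,
      recessiveSol p q x = (2 * Real.pi : ℂ)⁻¹ * lineIntegral (barnesExp p q) (S + M : ℝ) x := by
    intro x M
    set σ₂ : ℝ := S + M with hσ₂
    have hM0 : (0 : ℝ) ≤ M := Nat.cast_nonneg M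
    obtain ⟨C, T, hT, hbd⟩ := hB.decay.exists_bound hpi σ₁ σ₂
    have hinj : Function.Injective fun x : Σ d, Fin (k d) => p x.1 - ((x.2 : ℕ) : ℂ) := by
      rintro ⟨d, m⟩ ⟨d', m'⟩ h
      have h' : p d - (m : ℕ) = p d' - (m' : ℕ) := h
      have hd : d = d' := by
        by_contra hne
        exact hpp d d' hne ((m : ℕ) - (m' : ℕ) : ℤ) (by push_cast; linear_combination h')
      subst hd
      have : ((m : ℕ) : ℂ) = (m' : ℕ) := by linear_combination -h'
      have : m = m' := Fin.ext (by exact_mod_cast this)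
      rw [this]
    have key := lineIntegral_sub_lineIntegral (Φ := barnesExp p q) (C := C) (T := T)
      (θ := 0) (σ₁ := σ₁) (σ₂ := σ₂) (w := x) (by linarith)
      (a := fun x : Σ d, Fin (k d) => p x.1 - ((x.2 : ℕ) : ℂ))
      (ρ := fun x => (-1) ^ (x.2 : ℕ) * (sinQuot p q x.1 * gammaQuot p q (p x.1 - (x.2 : ℕ))))
      hinj
      (by
        rintro ⟨d, m⟩
        have e := (hk d).2
        have e2 : ((m : ℕ) : ℝ) + 1 ≤ k d := by exact_mod_cast m.2
        simp only [sub_re, natCast_re]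
        linarith)
      (by
        rintro ⟨d, m⟩
        simp only [sub_re, natCast_re]
        have : (0 : ℝ) ≤ (m : ℕ) := Nat.cast_nonneg _
        linarith [hp1 d])
      (by
        intro s h1 h2 h3
        refine differentiableAt_barnesExp fun d m h0 => ?_
        by_cases hm : m < k d
        · exact h3 ⟨d, m, hm⟩ h0
        · have e := (hk d).1
          have e1 : s.re = (p d).re - m := by rw [h0]; simp
          have e2 : (k d : ℝ) ≤ m := by exact_mod_cast not_lt.1 hm
          linarith)
      (by
        rintro ⟨d, m⟩
        exact hB.residue d m) (fun s h1 h2 h3 => by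
          simpa using hbd s h1 h2 h3) (by simp)
    have hS := hsum x (by simp) _ fun d => hasSum_recessiveSol_term hpp hpq d x
    rw [Fintype.sum_sigma] at key
    simp only at key
    simp_rw [Finset.sum_range] at hS
    have hpi0 : (2 * Real.pi : ℂ) ≠ 0 := by simp [Real.pi_ne_zero]
    rw [eq_inv_mul_iff_mul_eq₀ hpi0, recessiveSol, hS]
    linear_combination -key + lineIntegral (barnesExp p q) σ₁ x * mul_inv_cancel₀ hpi0
  refine ⟨(2 * Real.pi)⁻¹ * J * ((E + 2) * E.factorial + 1), (E + 2 : ℕ), by positivity,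
    by positivity, fun x hx => ?_⟩
  have hpn : ‖(2 * Real.pi : ℂ)⁻¹‖ = (2 * Real.pi)⁻¹ := by
    rw [norm_inv, norm_mul, Complex.norm_real, Real.norm_eq_abs, abs_of_pos Real.pi_pos,
      Complex.norm_two]
  have hpos := Real.pi_pos
  -- With `ζ = e^x`, the bound on the line `S + M` is a bound on the `M`-th moment; having it for
  -- all `M` yields the factor `e^{-ζ}`.
  have hmain := mul_exp_le_of_forall_mul_pow_le (g := ‖recessiveSol p q x‖) (ζ := Real.exp x)
    (J := (2 * Real.pi)⁻¹ * J) (E := E) (Real.one_le_exp hx) (by positivity)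
    fun M => by
      have h1 := hbound M x
      rw [hrep x M, norm_mul, hpn, ← Real.exp_nat_mul]
      calc _ ≤ (2 * Real.pi)⁻¹ * (J * (M + E).factorial * Real.exp (-x * (S + M))) *
            Real.exp (M * x) := by gcongr
        _ = (2 * Real.pi)⁻¹ * J * (M + E).factorial * Real.exp (-(x * S)) := by
            rw [show -x * ((S : ℝ) + M) = -(x * S) + -(M * x) by ring, Real.exp_add, Real.exp_neg (M * x)]
            field_simp
        _ ≤ (2 * Real.pi)⁻¹ * J * (M + E).factorial * 1 := by
            gcongr
            rw [Real.exp_le_one_iff, neg_nonpos]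
            positivity
        _ = _ := mul_one _
  rw [← Real.exp_nat_mul] at hmain
  rw [Real.exp_neg, ← div_eq_mul_inv, le_div_iff₀ (Real.exp_pos _)]
  exact hmain

end CDO

end

/-! ### Gamma quotients and the asymptotic form of Gauss's summation theorem -/

noncomputable section

namespace CDO

open Complex Filter Topology MeasureTheory Asymptotics

/-- The rising factorial `x (x + 1) ⋯ (x + j - 1)`. -/
def rising (x : ℂ) (j : ℕ) : ℂ := (ascPochhammer ℂ j).eval x

@[simp] lemma rising_zero (x : ℂ) : rising x 0 = 1 := by simp [rising]

lemma rising_succ (x : ℂ) (j : ℕ) : rising x (j + 1) = rising x j * (x + j) :=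
  ascPochhammer_succ_eval j x

lemma rising_add (x : ℂ) (i j : ℕ) : rising x (i + j) = rising x i * rising (x + i) j := by
  rw [rising, ← ascPochhammer_mul]
  simp [rising]

lemma mul_rising_add_one (x : ℂ) (j : ℕ) : x * rising (x + 1) j = rising x j * (x + j) := by
  rw [← rising_succ, add_comm j 1, rising_add]
  simp [rising_succ x 0]

lemma rising_ne_zero {x : ℂ} {j : ℕ} (h : ∀ i < j, x + i ≠ 0) : rising x j ≠ 0 := by
  induction j with
  | zero => simp
  | succ j ih =>
    rw [rising_succ]
    exact mul_ne_zero (ih fun i hi => h i (by omega)) (h j (by omega))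

lemma Gamma_add_natCast {x : ℂ} {j : ℕ} (h : ∀ i < j, x + i ≠ 0) :
    Gamma (x + j) = Gamma x * rising x j := by
  induction j with
  | zero => simp
  | succ j ih =>
    rw [Nat.cast_succ, ← add_assoc, Complex.Gamma_add_one _ (h j (by omega)),
      ih fun i hi => h i (by omega), rising_succ]
    ring

lemma rising_eq_prod (x : ℂ) (j : ℕ) : rising x j = ∏ i ∈ Finset.range j, (x + i) := by
  induction j with
  | zero => simp
  | succ j ih => rw [rising_succ, Finset.prod_range_succ, ih]

lemma eventually_natCast_add_ne_zero (γ : ℂ) : ∀ᶠ k : ℕ in atTop, (k : ℂ) + γ ≠ 0 := by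
  filter_upwards [eventually_gt_atTop ⌈‖γ‖⌉₊] with k hk h
  have h1 : (k : ℂ) = -γ := by linear_combination h
  have h2 : (k : ℝ) = ‖γ‖ := by rw [← norm_neg γ, ← h1, Complex.norm_natCast]
  have h3 : ‖γ‖ < k := Nat.lt_of_ceil_lt hk
  linarith

lemma eventually_natCast_add_add_ne_zero (γ : ℂ) :
    ∀ᶠ k : ℕ in atTop, ∀ i : ℕ, (k : ℂ) + γ + i ≠ 0 := by
  filter_upwards [eventually_forall_ge_atTop.2 (eventually_natCast_add_ne_zero γ)] with k hk i
  have := hk (k + i) (Nat.le_add_right _ _)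
  rw [Nat.cast_add] at this
  rwa [add_right_comm]

lemma isBigO_inv_natCast_add (γ : ℂ) :
    (fun k : ℕ => ((k : ℂ) + γ)⁻¹) =O[atTop] fun k : ℕ => (k : ℝ)⁻¹ := by
  refine IsBigO.of_bound 2 ?_
  filter_upwards [eventually_gt_atTop ⌈2 * ‖γ‖⌉₊] with k hk
  have h1 : 2 * ‖γ‖ < k := Nat.lt_of_ceil_lt hk
  have h2 : (k : ℝ) ≤ ‖(k : ℂ) + γ‖ + ‖γ‖ := by
    calc (k : ℝ) = ‖(k : ℂ) + γ - γ‖ := by simp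
      _ ≤ _ := norm_sub_le _ _
  have h0 : (0 : ℝ) < k := lt_of_le_of_lt (by positivity) h1
  rw [norm_inv, norm_inv, Real.norm_natCast, ← div_eq_mul_inv, inv_eq_one_div,
    div_le_div_iff₀ (by linarith) h0]
  linarith

lemma isBigO_inv_rising (γ : ℂ) (j : ℕ) :
    (fun k : ℕ => (rising (k + γ) j)⁻¹) =O[atTop] fun k : ℕ => ((k : ℝ)⁻¹) ^ j := by
  induction j with
  | zero => simpa using isBigO_refl (fun _ : ℕ => (1 : ℝ)) atTop
  | succ j ih =>
    simp_rw [rising_succ, mul_inv, pow_succ, add_assoc]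
    exact ih.mul (isBigO_inv_natCast_add _)

/-- Stirling's formula along arithmetic progressions of step one. -/
lemma tendsto_Gamma_natCast_add_div {a : ℂ} (ha : 0 < a.re) :
    Tendsto (fun k : ℕ => Gamma ((k + 1 : ℕ) + a) / ((k : ℂ) ^ a * k.factorial)) atTop (𝓝 1) := by
  have hG := Complex.Gamma_ne_zero_of_re_pos ha
  have h := (Complex.GammaSeq_tendsto_Gamma a).inv₀ hG |>.const_mul (Gamma a)
  rw [mul_inv_cancel₀ hG] at h
  refine h.congr' ?_
  filter_upwards [eventually_ge_atTop 1] with k hk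
  have hne : ∀ i : ℕ, a + i ≠ 0 := fun i h => by
    have := congrArg re h
    simp at this
    linarith [(Nat.cast_nonneg i : (0 : ℝ) ≤ i)]
  rw [add_comm _ a, Gamma_add_natCast fun i _ => hne i, Complex.GammaSeq, ← rising_eq_prod, inv_div]
  ring

/-- A balanced quotient of Gamma functions tends to one. -/
lemma tendsto_Gamma_quot {a b c d : ℂ} (h : a + b = c + d) :
    Tendsto (fun k : ℕ => Gamma (k + a) * Gamma (k + b) / (Gamma (k + c) * Gamma (k + d)))
      atTop (𝓝 1) := by
  obtain ⟨K, hK⟩ := exists_nat_gt (|a.re| + |b.re| + |c.re| + |d.re|)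
  have ha := neg_abs_le a.re
  have hb := neg_abs_le b.re
  have hc := neg_abs_le c.re
  have hd := neg_abs_le d.re
  have ha0 := abs_nonneg a.re
  have hb0 := abs_nonneg b.re
  have hc0 := abs_nonneg c.re
  have hd0 := abs_nonneg d.re
  rw [← tendsto_add_atTop_iff_nat (K + 1)]
  have e : ∀ z : ℂ, ∀ k : ℕ, ((k + (K + 1) : ℕ) : ℂ) + z = (k + 1 : ℕ) + (K + z) := by
    intro z k; push_cast; ring
  simp_rw [e]
  have h1 := ((tendsto_Gamma_natCast_add_div (a := K + a) (by simp; linarith)).mul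
    (tendsto_Gamma_natCast_add_div (a := K + b) (by simp; linarith))).div
    ((tendsto_Gamma_natCast_add_div (a := K + c) (by simp; linarith)).mul
    (tendsto_Gamma_natCast_add_div (a := K + d) (by simp; linarith))) (by simp)
  simp only [mul_one, div_one] at h1
  refine h1.congr' ?_
  filter_upwards [eventually_ge_atTop 1] with k hk
  have hk0 : (k : ℂ) ≠ 0 := by exact_mod_cast (by omega : k ≠ 0)
  have hf : (k.factorial : ℂ) ≠ 0 := by exact_mod_cast k.factorial_ne_zero
  have hpow : (k : ℂ) ^ (K + a) * (k : ℂ) ^ (K + b) = (k : ℂ) ^ (K + c) * (k : ℂ) ^ (K + d) := by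
    rw [← cpow_add _ _ hk0, ← cpow_add _ _ hk0]
    congr 1; linear_combination h
  have hc' : (k : ℂ) ^ (K + c) ≠ 0 := by simp [cpow_eq_zero_iff, hk0]
  have hd' : (k : ℂ) ^ (K + d) ≠ 0 := by simp [cpow_eq_zero_iff, hk0]
  simp only [Pi.div_apply]
  rw [div_mul_div_comm, div_mul_div_comm, div_div_div_eq,
    show (k : ℂ) ^ (K + a) * k.factorial * ((k : ℂ) ^ (K + b) * k.factorial) =
      (k : ℂ) ^ (K + c) * k.factorial * ((k : ℂ) ^ (K + d) * k.factorial) by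
      linear_combination (k.factorial : ℂ) ^ 2 * hpow,
    mul_comm (Gamma _ * Gamma _) ((k : ℂ) ^ (K + c) * _ * _), mul_div_mul_left]
  exact mul_ne_zero (mul_ne_zero hc' hf) (mul_ne_zero hd' hf)

/-- The partial sums of Gauss's series `₂F₁(A, B; C; 1)`. -/
def gaussSum (A B : ℂ) (N : ℕ) (C : ℂ) : ℂ :=
  ∑ j ∈ Finset.range N, rising A j * rising B j / (rising C j * j.factorial)

/-- The contiguity relation between `₂F₁(A, B; C; 1)` and `₂F₁(A, B; C + 1; 1)`, which is the
recurrence satisfied by Gauss's Gamma quotient. For the truncated series a single boundary term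
remains. -/
lemma gaussSum_contiguous {A B C : ℂ} (hC : ∀ i : ℕ, C + i ≠ 0) (N : ℕ) :
    C * (C - A - B) * gaussSum A B N C - (C - A) * (C - B) * gaussSum A B N (C + 1) =
      -(N * C * (rising A N * rising B N / (rising C N * N.factorial))) := by
  induction N with
  | zero => simp [gaussSum]
  | succ N ih =>
    rw [gaussSum, gaussSum, Finset.sum_range_succ, Finset.sum_range_succ, ← gaussSum, ← gaussSum]
    have h1 := mul_rising_add_one C N
    have hr := rising_ne_zero (x := C) (j := N) fun i _ => hC i
    have hN := hC N
    have h0 : C ≠ 0 := by simpa using hC 0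
    have hf : (N.factorial : ℂ) ≠ 0 := by exact_mod_cast N.factorial_ne_zero
    have h2 : rising (C + 1) N = rising C N * (C + N) / C := by
      rw [eq_div_iff h0]; linear_combination h1
    have hN1 : (N + 1 : ℂ) ≠ 0 := by exact_mod_cast N.succ_ne_zero
    have key : C * (C - A - B) * (rising A N * rising B N / (rising C N * N.factorial)) -
        (C - A) * (C - B) * (rising A N * rising B N / (rising (C + 1) N * N.factorial)) =
        -((N + 1 : ℕ) * C * (rising A (N + 1) * rising B (N + 1) /
          (rising C (N + 1) * (N + 1).factorial))) +
        N * C * (rising A N * rising B N / (rising C N * N.factorial)) := by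
      rw [h2, rising_succ, rising_succ, rising_succ, Nat.factorial_succ]
      push_cast
      field_simp
      ring
    linear_combination ih + key

/-- A convergent sequence with polynomially small increments is polynomially close to its limit. -/
lemma isBigO_sub_of_tendsto {f : ℕ → ℂ} {L : ℂ} (hf : Tendsto f atTop (𝓝 L)) {N : ℕ}
    (h : (fun k => f (k + 1) - f k) =O[atTop] fun k : ℕ => ((k : ℝ)⁻¹) ^ (N + 2)) :
    (fun k => f k - L) =O[atTop] fun k : ℕ => ((k : ℝ)⁻¹) ^ (N + 1) := by
  obtain ⟨C, hC, hb⟩ := h.exists_nonneg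
  rw [IsBigOWith] at hb
  refine IsBigO.of_bound (2 * C) ?_
  filter_upwards [eventually_forall_ge_atTop.2 hb, eventually_ge_atTop 1] with k hk hk1
  have hk0 : (0 : ℝ) < k := by exact_mod_cast hk1
  -- The increments are summed through `K⁻² ≤ 2 (K⁻¹ - (K + 1)⁻¹)`, keeping the other `N` powers at
  -- their largest value `k⁻¹`.
  have hstep : ∀ m : ℕ, ‖f k - f (k + m)‖ ≤
      2 * C * ((k : ℝ)⁻¹) ^ N * ((k : ℝ)⁻¹ - ((k + m : ℕ) : ℝ)⁻¹) := by
    intro m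
    induction m with
    | zero => simp
    | succ m ih =>
      have h1 := hk (k + m) (Nat.le_add_right _ _)
      set K : ℝ := ((k + m : ℕ) : ℝ) with hKdef
      have hkK : (k : ℝ) ≤ K := by rw [hKdef]; push_cast; linarith [(Nat.cast_nonneg m : (0:ℝ) ≤ m)]
      have hK1 : 1 ≤ K := le_trans (by exact_mod_cast hk1) hkK
      rw [Real.norm_of_nonneg (by positivity)] at h1
      have h2 : (K⁻¹) ^ (N + 2) ≤ ((k : ℝ)⁻¹) ^ N * (2 * (K⁻¹ - (K + 1)⁻¹)) := by
        rw [pow_add]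
        have e : (K⁻¹) ^ 2 ≤ 2 * (K⁻¹ - (K + 1)⁻¹) := by
          have : K⁻¹ - (K + 1)⁻¹ = (K * (K + 1))⁻¹ := by field_simp; ring
          rw [this, inv_pow, ← div_eq_mul_inv, inv_eq_one_div,
            div_le_div_iff₀ (by positivity) (by positivity)]
          nlinarith
        gcongr
      have h3 : ((k + (m + 1) : ℕ) : ℝ) = K + 1 := by rw [hKdef]; push_cast; ring
      rw [h3]
      calc ‖f k - f (k + (m + 1))‖ = ‖(f k - f (k + m)) - (f (k + m + 1) - f (k + m))‖ := by
            congr 1; rw [← add_assoc]; ring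
        _ ≤ _ := norm_sub_le _ _
        _ ≤ 2 * C * ((k : ℝ)⁻¹) ^ N * ((k : ℝ)⁻¹ - K⁻¹) +
            C * (((k : ℝ)⁻¹) ^ N * (2 * (K⁻¹ - (K + 1)⁻¹))) :=
            add_le_add ih (h1.trans (by gcongr))
        _ = _ := by ring
  have hlim : Tendsto (fun m => ‖f k - f (k + m)‖) atTop (𝓝 ‖f k - L‖) := by
    have : Tendsto (fun m => f (k + m)) atTop (𝓝 L) := by
      simp_rw [add_comm k]
      exact (tendsto_add_atTop_iff_nat k).2 hf
    exact (tendsto_const_nhds.sub this).norm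
  rw [Real.norm_of_nonneg (by positivity)]
  refine le_of_tendsto' hlim fun m => (hstep m).trans ?_
  rw [pow_succ, ← mul_assoc]
  gcongr
  rw [sub_le_self_iff]
  positivity

lemma tendsto_gaussSum (A B γ : ℂ) (N : ℕ) :
    Tendsto (fun k : ℕ => gaussSum A B (N + 1) (k + γ)) atTop (𝓝 1) := by
  have hz : Tendsto (fun k : ℕ => (k : ℝ)⁻¹) atTop (𝓝 0) := tendsto_inv_atTop_nhds_zero_nat
  simp_rw [gaussSum, Finset.sum_range_succ']
  have h : Tendsto (fun k : ℕ => ∑ j ∈ Finset.range N, rising A (j + 1) * rising B (j + 1) /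
      (rising (k + γ) (j + 1) * (j + 1).factorial)) atTop (𝓝 (∑ j ∈ Finset.range N, 0)) := by
    refine tendsto_finsetSum _ fun j _ => ?_
    have h1 : Tendsto (fun k : ℕ => (rising (k + γ) (j + 1))⁻¹) atTop (𝓝 0) := by
      refine (isBigO_inv_rising γ (j + 1)).trans_tendsto ?_
      simpa using hz.pow (j + 1)
    have h2 := h1.const_mul (rising A (j + 1) * rising B (j + 1) / (j + 1).factorial)
    rw [mul_zero] at h2
    exact h2.congr fun k => by rw [div_mul_eq_div_div_swap, div_eq_mul_inv _ (rising _ _)]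
  simpa using h.add_const 1

/-- The asymptotic form of Gauss's summation theorem. -/
theorem isBigO_Gamma_quot_sub_gaussSum (A B γ : ℂ) (N : ℕ) :
    (fun k : ℕ => Gamma (k + γ) * Gamma (k + (γ - A - B)) /
      (Gamma (k + (γ - A)) * Gamma (k + (γ - B))) - gaussSum A B N (k + γ)) =O[atTop]
      fun k : ℕ => ((k : ℝ)⁻¹) ^ N := by
  set g : ℕ → ℂ := fun k => Gamma (k + γ) * Gamma (k + (γ - A - B)) /
      (Gamma (k + (γ - A)) * Gamma (k + (γ - B))) with hg
  have hg1 : Tendsto g atTop (𝓝 1) := tendsto_Gamma_quot (by ring)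
  rcases N with _ | N
  · simp only [gaussSum, Finset.range_zero, Finset.sum_empty, sub_zero, pow_zero]
    exact hg1.isBigO_one ℝ
  set f : ℕ → ℂ := fun k => gaussSum A B (N + 1) (k + γ) / g k with hf
  have hf1 : Tendsto f atTop (𝓝 1) := by
    have := (tendsto_gaussSum A B γ N).div hg1 one_ne_zero
    rwa [div_one] at this
  have hg0 : ∀ᶠ k in atTop, g k ≠ 0 := hg1.eventually_ne one_ne_zero
  -- The quotient `g` satisfies the contiguity recurrence exactly, so the increment of `gaussSum /
  -- g` is the boundary term alone: `N + 1` powers from the rising factorial and one from `k + (γ -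
  -- A - B)`.
  have hinc : (fun k => f (k + 1) - f k) =O[atTop] fun k : ℕ => ((k : ℝ)⁻¹) ^ (N + 2) := by
    have h1 : (fun k : ℕ => (g k)⁻¹ * (((N + 1 : ℕ) : ℂ) * (rising A (N + 1) * rising B (N + 1) /
        (N + 1).factorial) * ((rising (k + γ) (N + 1))⁻¹ * ((k : ℂ) + (γ - A - B))⁻¹))) =O[atTop]
        fun k : ℕ => ((k : ℝ)⁻¹) ^ (N + 2) := by
      have e1 : (fun k => (g k)⁻¹) =O[atTop] fun _ => (1 : ℝ) :=
        (hg1.inv₀ one_ne_zero).isBigO_one ℝ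
      have e2 := (isBigO_inv_rising γ (N + 1)).mul (isBigO_inv_natCast_add (γ - A - B))
      have e3 := e1.mul (e2.const_mul_left (((N + 1 : ℕ) : ℂ) *
        (rising A (N + 1) * rising B (N + 1) / (N + 1).factorial)))
      simp_rw [one_mul, ← pow_succ] at e3
      exact e3
    refine h1.congr' ?_ EventuallyEq.rfl
    filter_upwards [hg0, eventually_natCast_add_add_ne_zero γ,
      eventually_natCast_add_ne_zero (γ - A - B), eventually_natCast_add_ne_zero (γ - A),
      eventually_natCast_add_ne_zero (γ - B)] with k hk hγ hAB hA hB
    have hC0 : (k : ℂ) + γ ≠ 0 := by simpa using hγ 0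
    have hgs : g (k + 1) = g k * (((k + γ) * (k + (γ - A - B))) /
        ((k + (γ - A)) * (k + (γ - B)))) := by
      simp only [hg, Nat.cast_succ]
      rw [add_right_comm _ 1 γ, add_right_comm _ 1 (γ - A - B), add_right_comm _ 1 (γ - A),
        add_right_comm _ 1 (γ - B), Complex.Gamma_add_one _ hC0, Complex.Gamma_add_one _ hAB,
        Complex.Gamma_add_one _ hA, Complex.Gamma_add_one _ hB, div_mul_div_comm]
      ring
    have hcont := gaussSum_contiguous (A := A) (B := B) hγ (N + 1)
    simp only [hf]
    rw [hgs, Nat.cast_succ k, add_right_comm _ 1 γ]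
    have hr := rising_ne_zero (x := k + γ) (j := N + 1) fun i _ => hγ i
    have hfac : ((N + 1).factorial : ℂ) ≠ 0 := by exact_mod_cast (N + 1).factorial_ne_zero
    have hX : ((k : ℂ) + γ) * (k + (γ - A - B)) ≠ 0 := mul_ne_zero hC0 hAB
    have e : gaussSum A B (N + 1) (k + γ + 1) / (g k * (((k + γ) * (k + (γ - A - B))) /
        ((k + (γ - A)) * (k + (γ - B))))) - gaussSum A B (N + 1) (k + γ) / g k =
        (g k)⁻¹ * ((((k + γ - A) * (k + γ - B)) * gaussSum A B (N + 1) (k + γ + 1) -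
          (k + γ) * (k + γ - A - B) * gaussSum A B (N + 1) (k + γ)) /
          ((k + γ) * (k + (γ - A - B)))) := by
      field_simp
      ring
    rw [e, show ((k + γ - A) * (k + γ - B)) * gaussSum A B (N + 1) (k + γ + 1) -
          (k + γ) * (k + γ - A - B) * gaussSum A B (N + 1) (k + γ) =
          ((N + 1 : ℕ) * (k + γ) * (rising A (N + 1) * rising B (N + 1) /
            (rising (k + γ) (N + 1) * (N + 1).factorial))) by linear_combination -hcont]
    field_simp
  have hmain := (isBigO_sub_of_tendsto hf1 hinc).neg_left
  have h2 := (hg1.isBigO_one ℝ).mul hmain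
  simp only [one_mul] at h2
  refine h2.congr' ?_ EventuallyEq.rfl
  filter_upwards [hg0] with k hk
  simp only [hf]
  field_simp
  ring

end CDO

end

/-! ### Inverse factorial expansions of products of Gamma quotients -/

noncomputable section

namespace CDO

open Complex Filter Topology MeasureTheory Asymptotics

/-- The coefficients obtained by iterating Gauss's summation theorem. -/
def gaussCoeff (A B : ℕ → ℂ) : ℕ → ℕ → ℂ
  | 0, l => if l = 0 then 1 else 0
  | m + 1, l => ∑ x ∈ Finset.HasAntidiagonal.antidiagonal l, gaussCoeff A B m x.1 *
      (rising (A m) x.2 * rising (B m + x.1) x.2 / x.2.factorial)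

lemma sum_gaussCoeff_succ (A B : ℕ → ℂ) (m N : ℕ) (f : ℕ → ℂ) :
    ∑ l ∈ Finset.range N, gaussCoeff A B (m + 1) l * f l =
      ∑ j ∈ Finset.range N, gaussCoeff A B m j * ∑ i ∈ Finset.range (N - j),
        rising (A m) i * rising (B m + j) i / i.factorial * f (j + i) := by
  simp_rw [Finset.mul_sum]
  rw [← Finset.sum_range_diag_flip N fun j i => gaussCoeff A B m j *
    (rising (A m) i * rising (B m + j) i / i.factorial * f (j + i))]
  refine Finset.sum_congr rfl fun l _ => ?_
  rw [gaussCoeff, Finset.sum_mul, Finset.Nat.sum_antidiagonal_eq_sum_range_succ_mk]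
  refine Finset.sum_congr rfl fun j hj => ?_
  have : j + (l - j) = l := by simp at hj; omega
  simp only [this]
  ring

variable (P Q : ℕ → ℂ) (β : ℂ)

/-- The parameter of the Gamma function balancing `gammaProdQuot`. -/
def gammaProdShift (m : ℕ) : ℂ :=
  β + ∑ i ∈ Finset.range (m + 1), P i + ∑ i ∈ Finset.range m, Q i

/-- A quotient of products of Gamma functions, with one more factor in the denominator. -/
def gammaProdQuot (m k : ℕ) : ℂ :=
  (∏ i ∈ Finset.range m, Gamma (k + (β - Q i))) /
    ∏ i ∈ Finset.range (m + 1), Gamma (k + (β + P i))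

lemma eventually_Gamma_natCast_add_ne_zero (γ : ℂ) : ∀ᶠ k : ℕ in atTop, Gamma (k + γ) ≠ 0 := by
  filter_upwards [eventually_natCast_add_add_ne_zero γ] with k hk
  exact Complex.Gamma_ne_zero fun m h => hk m (by rw [h]; ring)

/-- Gauss's theorem with parameters `A`, `B + j` and `γ + j`, divided by `rising (k + γ) j`. It
re-expands an inverse factorial based at `γ - A`, times a balanced Gamma quotient, in inverse
factorials based at `γ`. -/
lemma isBigO_gauss_step (A B γ : ℂ) (j N : ℕ) (hj : j ≤ N) :
    (fun k : ℕ => Gamma (k + (γ - A - B)) * Gamma (k + γ) /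
        (Gamma (k + (γ - B)) * Gamma (k + (γ - A))) * (rising (k + (γ - A)) j)⁻¹ -
      ∑ i ∈ Finset.range (N - j), rising A i * rising (B + j) i / i.factorial *
        (rising (k + γ) (j + i))⁻¹) =O[atTop] fun k : ℕ => ((k : ℝ)⁻¹) ^ N := by
  have h := (isBigO_inv_rising γ j).mul
    (isBigO_Gamma_quot_sub_gaussSum A (B + j) (γ + j) (N - j))
  simp_rw [← pow_add, Nat.add_sub_cancel' hj] at h
  refine h.congr' ?_ EventuallyEq.rfl
  filter_upwards [eventually_natCast_add_add_ne_zero γ,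
    eventually_natCast_add_add_ne_zero (γ - A), eventually_Gamma_natCast_add_ne_zero (γ - A),
    eventually_Gamma_natCast_add_ne_zero (γ - B)] with k h1 h2 h3 h4
  have hr := rising_ne_zero (x := k + γ) (j := j) fun i _ => h1 i
  have hr2 := rising_ne_zero (x := k + (γ - A)) (j := j) fun i _ => h2 i
  rw [mul_sub, gaussSum, Finset.mul_sum]
  congr 1
  · rw [show (k : ℂ) + (γ + j) = k + γ + j by ring, Gamma_add_natCast fun i _ => h1 i,
      show (k : ℂ) + (γ + j - A) = k + (γ - A) + j by ring, Gamma_add_natCast fun i _ => h2 i,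
      show (k : ℂ) + (γ + j - A - (B + j)) = k + (γ - A - B) by ring,
      show (k : ℂ) + (γ + j - (B + j)) = k + (γ - B) by ring]
    field_simp
  · refine Finset.sum_congr rfl fun i _ => ?_
    rw [rising_add, mul_inv, add_assoc]
    rw [div_mul_eq_div_div_swap, div_eq_mul_inv _ (rising _ _)]
    ring

/-- The expansion of `gammaProdQuot` in inverse rising factorials. -/
theorem isBigO_gammaProdQuot_sub (m N : ℕ) :
    (fun k : ℕ => gammaProdQuot P Q β m k * Gamma (k + gammaProdShift P Q β m) -
      ∑ j ∈ Finset.range N, gaussCoeff (fun i => P (i + 1) + Q i)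
        (fun i => ∑ d ∈ Finset.range (i + 1), (P d + Q d)) m j *
          (rising (k + gammaProdShift P Q β m) j)⁻¹) =O[atTop] fun k : ℕ => ((k : ℝ)⁻¹) ^ N := by
  induction m generalizing N with
  | zero =>
    have h : (fun k : ℕ => gammaProdQuot P Q β 0 k * Gamma (k + gammaProdShift P Q β 0)) =ᶠ[atTop]
        fun _ => 1 := by
      filter_upwards [eventually_Gamma_natCast_add_ne_zero (β + P 0)] with k hk
      simp [gammaProdQuot, gammaProdShift, hk]
    rcases N with _ | N
    · simp only [Finset.range_zero, Finset.sum_empty, sub_zero, pow_zero]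
      exact
        (tendsto_const_nhds.congr' h.symm : Tendsto _ atTop (𝓝 (1 : ℂ))).isBigO_one ℝ
    · refine (isBigO_zero _ _).congr' ?_ EventuallyEq.rfl
      filter_upwards [h] with k hk
      rw [hk, Finset.sum_range_succ']
      simp [gaussCoeff]
  | succ m ih =>
    set A : ℕ → ℂ := fun i => P (i + 1) + Q i with hA
    set B : ℕ → ℂ := fun i => ∑ d ∈ Finset.range (i + 1), (P d + Q d) with hB
    set α := gammaProdShift P Q β m with hα
    set γ := gammaProdShift P Q β (m + 1) with hγ
    have e1 : γ - A m = α := by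
      rw [hγ, hα, hA, gammaProdShift, gammaProdShift, Finset.sum_range_succ P (m + 1),
        Finset.sum_range_succ Q m]
      ring
    have e2 : γ - B m = β + P (m + 1) := by
      rw [hγ, hB, gammaProdShift, Finset.sum_range_succ _ (m + 1)]
      simp only [Finset.sum_add_distrib]
      ring
    have e3 : γ - A m - B m = β - Q m := by
      have : A m = P (m + 1) + Q m := rfl
      linear_combination e2 - this
    set R : ℕ → ℂ := fun k => gammaProdQuot P Q β m k * Gamma (k + α) with hR
    -- Passing from `m` to `m + 1` multiplies by this balanced quotient, to which the Gauss step
    -- applies with `A m`, `B m` and `γ`; the parameters match because `γ - A m = α`, `γ - B m = β +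
    -- P (m + 1)` and `γ - A m - B m = β - Q m`.
    set G : ℕ → ℂ := fun k => Gamma (k + (β - Q m)) * Gamma (k + γ) /
      (Gamma (k + (β + P (m + 1))) * Gamma (k + α)) with hG
    have hGO : G =O[atTop] fun _ => (1 : ℝ) := (tendsto_Gamma_quot (by
      have : A m = P (m + 1) + Q m := rfl
      linear_combination e1 + this)).isBigO_one ℝ
    have h1 := (ih N).mul hGO
    simp only [mul_one] at h1
    have h2 : (fun k : ℕ => ∑ j ∈ Finset.range N, gaussCoeff A B m j *
        (G k * (rising (k + α) j)⁻¹ -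
        ∑ i ∈ Finset.range (N - j), rising (A m) i * rising (B m + j) i / i.factorial *
          (rising (k + γ) (j + i))⁻¹)) =O[atTop] fun k : ℕ => ((k : ℝ)⁻¹) ^ N := by
      refine IsBigO.fun_sum fun j hj => ?_
      have := isBigO_gauss_step (A m) (B m) γ j N (Finset.mem_range.1 hj).le
      rw [e3, e2, e1] at this
      exact this.const_mul_left _
    refine (h1.add h2).congr' ?_ EventuallyEq.rfl
    filter_upwards [eventually_Gamma_natCast_add_ne_zero α] with k hk
    rw [sum_gaussCoeff_succ A B m N fun l => (rising (k + γ) l)⁻¹]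
    have e4 : gammaProdQuot P Q β (m + 1) k * Gamma (k + γ) =
        gammaProdQuot P Q β m k * Gamma (k + α) * G k := by
      simp only [hG]
      rw [gammaProdQuot, gammaProdQuot, Finset.prod_range_succ _ (m + 1),
        Finset.prod_range_succ _ m]
      field_simp
    rw [e4]
    simp only [mul_sub, Finset.sum_sub_distrib, sub_mul, Finset.sum_mul]
    rw [show ∀ f : ℕ → ℂ, ∑ j ∈ Finset.range N, gaussCoeff A B m j * f j * G k =
      ∑ j ∈ Finset.range N, gaussCoeff A B m j * (G k * f j) from
      fun f => Finset.sum_congr rfl fun j _ => by ring]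
    ring

lemma sum_antidiagonalTuple_succ {n : ℕ} (k : ℕ) (f : (Fin (n + 1) → ℕ) → ℂ) :
    ∑ κ ∈ Finset.Nat.antidiagonalTuple (n + 1) k, f κ =
      ∑ x ∈ Finset.HasAntidiagonal.antidiagonal k, ∑ κ ∈ Finset.Nat.antidiagonalTuple n x.1,
        f (Fin.snoc κ x.2) := by
  rw [Finset.sum_sigma']
  refine Finset.sum_bij' (fun κ _ => ⟨(∑ i : Fin n, κ i.castSucc, κ (Fin.last n)),
    fun i => κ i.castSucc⟩) (fun x _ => Fin.snoc x.2 x.1.2) ?_ ?_ ?_ ?_ ?_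
  · intro κ hκ
    rw [Finset.Nat.mem_antidiagonalTuple, Fin.sum_univ_castSucc] at hκ
    simp [Finset.Nat.mem_antidiagonalTuple, hκ]
  · rintro ⟨⟨a, b⟩, κ⟩ h
    simp only [Finset.mem_sigma, Finset.HasAntidiagonal.mem_antidiagonal, Finset.Nat.mem_antidiagonalTuple] at h
    rw [Finset.Nat.mem_antidiagonalTuple, Fin.sum_univ_castSucc]
    simp [h.2, h.1]
  · intro κ _
    exact Fin.snoc_init_self κ
  · rintro ⟨⟨a, b⟩, κ⟩ h
    simp only [Finset.mem_sigma, Finset.HasAntidiagonal.mem_antidiagonal, Finset.Nat.mem_antidiagonalTuple] at h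
    simp [h.2]
  · intro κ _
    congr 1
    exact (Fin.snoc_init_self κ).symm

/-- Unfolding the recursion: the first component of each antidiagonal pair is the partial sum `k₁ +
⋯ + k_{c-1}` that shifts the second parameter. -/
lemma gaussCoeff_eq_sum (A B : ℕ → ℂ) (n k : ℕ) :
    gaussCoeff A B n k = ∑ κ ∈ Finset.Nat.antidiagonalTuple n k, ∏ c : Fin n,
      rising (A c) (κ c) * rising ((∑ d ∈ Finset.Iio c, (κ d : ℂ)) + B c) (κ c) /
        (κ c).factorial := by
  induction n generalizing k with
  | zero =>
    rcases k with _ | k <;> simp [gaussCoeff]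
  | succ n ih =>
    rw [gaussCoeff, sum_antidiagonalTuple_succ]
    refine Finset.sum_congr rfl fun x _ => ?_
    rw [ih, Finset.sum_mul]
    refine Finset.sum_congr rfl fun κ hκ => ?_
    rw [Finset.Nat.mem_antidiagonalTuple] at hκ
    have hIio : ∀ c : Fin n, Finset.Iio c.castSucc = (Finset.Iio c).map Fin.castSuccEmb := by
      intro c; simp
    have hlast : Finset.Iio (Fin.last n) = Finset.univ.map Fin.castSuccEmb := by
      ext i; simp [Fin.exists_castSucc_eq]
    rw [Fin.prod_univ_castSucc]
    simp only [Fin.snoc_castSucc, Fin.snoc_last, hIio, hlast, Finset.sum_map,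
      Fin.coe_castSuccEmb, Fin.val_castSucc, Fin.val_last]
    rw [← Nat.cast_sum, hκ, add_comm (B n)]

end CDO

end

/-! ### The series of reciprocal Gamma functions -/

noncomputable section

namespace CDO

open Complex Filter Topology MeasureTheory Asymptotics

/-- The reciprocal Gamma function decays factorially along the integers, up to powers. -/
lemma isBigO_Gamma_natCast_add_inv (α : ℂ) : ∃ a : ℕ,
    (fun k : ℕ => (Gamma (k + α))⁻¹) =O[atTop] fun k : ℕ => (k + 1 : ℝ) ^ a / k.factorial := by
  obtain ⟨K, hK⟩ := exists_nat_gt (|α.re|)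
  have hα := neg_abs_le α.re
  refine ⟨K + 1, ?_⟩
  have hpos : 0 < (K + α).re := by simp; linarith
  have h := (tendsto_Gamma_natCast_add_div hpos).inv₀ one_ne_zero
  have h1 := (h.isBigO_one ℝ)
  obtain ⟨C, hC⟩ := h1.bound
  have h2 : ∀ᶠ k : ℕ in atTop, ‖(Gamma ((k + (K + 1) : ℕ) + α))⁻¹‖ ≤
      C * ‖((k + (K + 1) : ℕ) + 1 : ℝ) ^ (K + 1) / (k + (K + 1)).factorial‖ := by
    filter_upwards [hC, eventually_ge_atTop 1] with k hk hk1
    have hk0 : (0 : ℝ) < k := by exact_mod_cast hk1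
    have hf : (0 : ℝ) < k.factorial := by exact_mod_cast k.factorial_pos
    have hF : (0 : ℝ) < (k + (K + 1)).factorial := by exact_mod_cast Nat.factorial_pos _
    rw [inv_div, norm_div, norm_mul, Complex.norm_natCast, norm_one, mul_one,
      ← Complex.ofReal_natCast, Complex.norm_cpow_eq_rpow_re_of_pos hk0] at hk
    have e1 : ((k + (K + 1) : ℕ) : ℂ) + α = (k + 1 : ℕ) + (K + α) := by push_cast; ring
    have e2 : (1 : ℝ) ≤ (k : ℝ) ^ (K + α).re :=
      Real.one_le_rpow (by exact_mod_cast hk1) hpos.le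
    have hC0 : 0 ≤ C := le_trans (by positivity) hk
    rw [e1, norm_inv, Real.norm_of_nonneg (by positivity)]
    have e3 : ‖Gamma ((k + 1 : ℕ) + (K + α))‖⁻¹ ≤ C / k.factorial := by
      rw [le_div_iff₀ hf]
      calc _ = 1 * (k.factorial : ℝ) / ‖Gamma ((k + 1 : ℕ) + (K + α))‖ := by ring
        _ ≤ (k : ℝ) ^ (K + α).re * k.factorial / ‖Gamma ((k + 1 : ℕ) + (K + α))‖ := by gcongr
        _ ≤ C := hk
    refine e3.trans ?_
    rw [div_eq_mul_inv]
    refine mul_le_mul_of_nonneg_left ?_ hC0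
    rw [inv_eq_one_div, div_le_div_iff₀ hf hF, one_mul]
    have e4 : (k + (K + 1)).factorial ≤ k.factorial * (k + (K + 1)) ^ (K + 1) := by
      have := Nat.factorial_mul_descFactorial (Nat.le_add_left (K + 1) k)
      rw [Nat.add_sub_cancel] at this
      rw [← this]
      exact Nat.mul_le_mul_left _ (Nat.descFactorial_le_pow _ _)
    calc ((k + (K + 1)).factorial : ℝ) ≤ k.factorial * ((k + (K + 1) : ℕ) : ℝ) ^ (K + 1) := by
          exact_mod_cast e4
      _ ≤ k.factorial * (((k + (K + 1) : ℕ) : ℝ) + 1) ^ (K + 1) := by gcongr; linarith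
      _ = _ := by ring
  obtain ⟨m, hm⟩ := eventually_atTop.1 h2
  refine IsBigO.of_bound C ?_
  filter_upwards [eventually_ge_atTop (m + (K + 1))] with k hk
  have := hm (k - (K + 1)) (by omega)
  rwa [Nat.sub_add_cancel (by omega)] at this

lemma exists_norm_Gamma_natCast_add_inv_le (α : ℂ) : ∃ a : ℕ, ∃ C : ℝ, 0 ≤ C ∧
    ∀ k : ℕ, ‖(Gamma (k + α))⁻¹‖ ≤ C * ((k + 1 : ℝ) ^ a / k.factorial) := by
  obtain ⟨a, h⟩ := isBigO_Gamma_natCast_add_inv α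
  have hpos : ∀ k : ℕ, (0 : ℝ) < (k + 1 : ℝ) ^ a / k.factorial := fun k => by positivity
  obtain ⟨C, hC⟩ := (isBigO_nat_atTop_iff fun k hk => absurd hk (hpos k).ne').1 h
  refine ⟨a, C, ?_, fun k => ?_⟩
  · have := hC 0
    rw [Real.norm_of_nonneg (hpos 0).le] at this
    exact nonneg_of_mul_nonneg_left ((norm_nonneg _).trans this) (hpos 0)
  · have := hC k
    rwa [Real.norm_of_nonneg (hpos k).le] at this

lemma summable_Gamma_inv_mul_pow (α z : ℂ) :
    Summable fun k : ℕ => (Gamma (k + α))⁻¹ * z ^ k := by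
  obtain ⟨a, C, hC, h⟩ := exists_norm_Gamma_natCast_add_inv_le α
  refine Summable.of_norm_bounded (g := fun k : ℕ => C * (a.factorial * Real.exp 1) *
    ((Real.exp 1 * ‖z‖) ^ k / k.factorial)) ((Real.summable_pow_div_factorial _).mul_left _)
    fun k => ?_
  have h1 := Real.pow_div_factorial_le_exp (k + 1 : ℝ) (by positivity) a
  rw [div_le_iff₀ (by positivity)] at h1
  have h2 : Real.exp (k + 1 : ℝ) = Real.exp 1 ^ k * Real.exp 1 := by
    rw [← Real.exp_nat_mul, mul_one, Real.exp_add]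
  rw [h2] at h1
  rw [norm_mul, norm_pow]
  calc _ ≤ C * ((k + 1 : ℝ) ^ a / k.factorial) * ‖z‖ ^ k := by gcongr; exact h k
    _ ≤ C * ((Real.exp 1 ^ k * Real.exp 1 * a.factorial) / k.factorial) * ‖z‖ ^ k := by gcongr
    _ = _ := by rw [mul_pow]; ring

/-- The series `∑ z ^ k / Γ(k + α)`. -/
def invGammaSeries (α z : ℂ) : ℂ := ∑' k : ℕ, (Gamma (k + α))⁻¹ * z ^ k

lemma invGammaSeries_eq (α z : ℂ) :
    invGammaSeries α z = (Gamma α)⁻¹ + z * invGammaSeries (α + 1) z := by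
  rw [invGammaSeries, (summable_Gamma_inv_mul_pow α z).tsum_eq_zero_add, invGammaSeries,
    ← tsum_mul_left]
  congr 1
  · simp
  · refine tsum_congr fun k => ?_
    rw [pow_succ, show ((k + 1 : ℕ) : ℂ) + α = k + (α + 1) by push_cast; ring]
    ring

lemma norm_partialGamma_le {s : ℂ} (hs : 1 ≤ s.re) {z : ℝ} (hz : 0 < z) :
    ‖partialGamma s z‖ ≤ z ^ s.re := by
  have h := intervalIntegral.norm_integral_le_of_norm_le_const (a := 0) (b := z)
    (f := fun x : ℝ => ((Real.exp (-x) : ℝ) : ℂ) * (x : ℂ) ^ (s - 1)) (C := z ^ (s.re - 1)) ?_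
  · refine h.trans (le_of_eq ?_)
    rw [sub_zero, abs_of_pos hz, ← Real.rpow_add_one hz.ne', sub_add_cancel]
  · intro x hx
    rw [Set.uIoc_of_le hz.le] at hx
    rw [norm_mul, Complex.norm_real, Real.norm_of_nonneg (Real.exp_pos _).le,
      Complex.norm_cpow_eq_rpow_re_of_pos hx.1]
    have e1 : Real.exp (-x) ≤ 1 := Real.exp_le_one_iff.2 (by linarith [hx.1])
    have e2 : x ^ (s - 1).re ≤ z ^ (s.re - 1) := by
      simp only [sub_re, one_re]
      exact Real.rpow_le_rpow hx.1.le hx.2 (by linarith)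
    calc _ ≤ 1 * z ^ (s.re - 1) := mul_le_mul e1 e2 (Real.rpow_nonneg hx.1.le _) zero_le_one
      _ = _ := one_mul _

/-- Iterating the recurrence of the lower incomplete Gamma function gives the partial sums of this
series. The remainder is at most `z ^ Re s` times the modulus of a term of a convergent series. -/
lemma exp_neg_mul_invGammaSeries {s : ℂ} (hs : 0 < s.re) {z : ℝ} (hz : 0 < z) :
    exp (-z) * (z : ℂ) ^ s * invGammaSeries (s + 1) z = partialGamma s z / Gamma s := by
  have hz0 : (z : ℂ) ≠ 0 := by exact_mod_cast hz.ne'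
  have hre : ∀ M : ℕ, 0 < (s + M).re := fun M => by simp; positivity
  have hG : ∀ M : ℕ, Gamma (s + M) ≠ 0 := fun M => Complex.Gamma_ne_zero_of_re_pos (hre M)
  have hne : ∀ M : ℕ, s + M ≠ 0 := fun M h => by
    have := hre M
    rw [h] at this
    simp at this
  have hpart : ∀ M : ℕ, ∑ k ∈ Finset.range M,
      exp (-z) * (z : ℂ) ^ s * ((Gamma (k + (s + 1)))⁻¹ * (z : ℂ) ^ k) =
      partialGamma s z / Gamma s - partialGamma (s + M) z / Gamma (s + M) := by
    intro M
    induction M with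
    | zero => simp
    | succ M ih =>
      rw [Finset.sum_range_succ, ih, Nat.cast_succ, ← add_assoc s, partialGamma_add_one (hre M) hz.le,
        Complex.Gamma_add_one _ (hne M), show (M : ℂ) + (s + 1) = s + M + 1 by ring,
        Complex.Gamma_add_one _ (hne M), cpow_add _ _ hz0, cpow_natCast]
      have h1 := hne M
      have h2 := hG M
      field_simp
      push_cast
      ring
  have hlim : Tendsto (fun M : ℕ => partialGamma (s + M) z / Gamma (s + M)) atTop (𝓝 0) := by
    have h0 := (summable_Gamma_inv_mul_pow s z).tendsto_atTop_zero
    refine squeeze_zero_norm' (a := fun M : ℕ => z ^ s.re * ‖(Gamma (M + s))⁻¹ * (z : ℂ) ^ M‖) ?_ (by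
        have := h0.norm.const_mul (z ^ s.re)
        rwa [norm_zero, mul_zero] at this)
    filter_upwards [eventually_ge_atTop 1] with M hM
    have hM1 : (1 : ℝ) ≤ M := by exact_mod_cast hM
    rw [norm_div, norm_mul, norm_inv, norm_pow, Complex.norm_real, Real.norm_of_nonneg hz.le,
      add_comm (M : ℂ)]
    have := norm_partialGamma_le (s := s + M) (by simp; linarith) hz
    rw [add_re, natCast_re, Real.rpow_add hz, Real.rpow_natCast] at this
    calc _ ≤ z ^ s.re * z ^ M / ‖Gamma (s + M)‖ := by gcongr
      _ = _ := by ring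
  have h1 := ((summable_Gamma_inv_mul_pow (s + 1) z).hasSum.mul_left
    (exp (-z) * (z : ℂ) ^ s)).tendsto_sum_nat
  refine tendsto_nhds_unique h1 ?_
  simp_rw [hpart]
  simpa using tendsto_const_nhds.sub hlim

/-- The difference is the integral over `(z, ∞)`, where `|x^{s-1}| ≤ 1` because `Re s ≤ 1` and `x ≥
1`. -/
lemma norm_Gamma_sub_partialGamma_le {s : ℂ} (hs : 0 < s.re) (hs1 : s.re ≤ 1) {z : ℝ}
    (hz : 1 ≤ z) : ‖Gamma s - partialGamma s z‖ ≤ Real.exp (-z) := by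
  have hi := Complex.GammaIntegral_convergent hs
  have hz0 : (0 : ℝ) ≤ z := by linarith
  have h := intervalIntegral.integral_interval_add_Ioi hi
    (hi.mono_set (Set.Ioi_subset_Ioi hz0))
  rw [Complex.Gamma_eq_integral hs, GammaIntegral, ← h, partialGamma]
  have e : (∫ x in (0 : ℝ)..z, ((Real.exp (-x) : ℝ) : ℂ) * (x : ℂ) ^ (s - 1)) +
      (∫ x in Set.Ioi z, ((Real.exp (-x) : ℝ) : ℂ) * (x : ℂ) ^ (s - 1)) -
      (∫ x in (0 : ℝ)..z, ((Real.exp (-x) : ℝ) : ℂ) * (x : ℂ) ^ (s - 1)) =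
      ∫ x in Set.Ioi z, ((Real.exp (-x) : ℝ) : ℂ) * (x : ℂ) ^ (s - 1) := by ring
  rw [e, ← integral_exp_neg_Ioi z]
  refine norm_integral_le_of_norm_le (integrableOn_exp_neg_Ioi z) ?_
  refine (ae_restrict_iff' measurableSet_Ioi).2 (Eventually.of_forall fun x hx => ?_)
  have hx1 : 1 ≤ x := hz.trans (Set.mem_Ioi.1 hx).le
  rw [norm_mul, Complex.norm_real, Real.norm_of_nonneg (Real.exp_pos _).le,
    Complex.norm_cpow_eq_rpow_re_of_pos (by linarith)]
  refine mul_le_of_le_one_right (Real.exp_pos _).le ?_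
  exact Real.rpow_le_one_of_one_le_of_nonpos hx1 (by simp; linarith)

/-- The series `∑ z ^ k / Γ(k + α)` is `e ^ z z ^ (1 - α)` up to polynomially bounded terms. -/
theorem exists_norm_invGammaSeries_sub_le (α : ℂ) : ∃ C : ℝ, ∃ K : ℕ, 0 ≤ C ∧ ∀ z : ℝ, 1 ≤ z →
    ‖invGammaSeries α z - exp z * (z : ℂ) ^ (1 - α)‖ ≤ C * z ^ K := by
  have hz0 : ∀ z : ℝ, 1 ≤ z → (z : ℂ) ≠ 0 := fun z hz => by exact_mod_cast (by linarith : z ≠ 0)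
  have hkey : ∀ α : ℂ, ∀ z : ℝ, 1 ≤ z → invGammaSeries α z - exp z * (z : ℂ) ^ (1 - α) =
      (Gamma α)⁻¹ + z * (invGammaSeries (α + 1) z - exp z * (z : ℂ) ^ (1 - (α + 1))) := by
    intro α z hz
    rw [invGammaSeries_eq, show (1 : ℂ) - α = (1 - (α + 1)) + 1 by ring,
      cpow_add _ _ (hz0 z hz), cpow_one]
    ring
  -- In this range `α - 1` has real part in `(0, 1]`, and the error is the upper incomplete Gamma
  -- function times `e^z z^{1-α} / Γ(α - 1)`, which is bounded.
  have hbase : ∀ α : ℂ, 1 < α.re → α.re ≤ 2 → ∃ C : ℝ, ∃ K : ℕ, 0 ≤ C ∧ ∀ z : ℝ, 1 ≤ z →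
      ‖invGammaSeries α z - exp z * (z : ℂ) ^ (1 - α)‖ ≤ C * z ^ K := by
    intro α h1 h2
    have hs : 0 < (α - 1).re := by simp; linarith
    have hs1 : (α - 1).re ≤ 1 := by simp; linarith
    refine ⟨‖(Gamma (α - 1))⁻¹‖, 0, norm_nonneg _, fun z hz => ?_⟩
    have hzp : 0 < z := by linarith
    have e := exp_neg_mul_invGammaSeries hs hzp
    have hG := Complex.Gamma_ne_zero_of_re_pos hs
    rw [sub_add_cancel] at e
    have hp : (z : ℂ) ^ (α - 1) * (z : ℂ) ^ (1 - α) = 1 := by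
      rw [← cpow_add _ _ (hz0 z hz)]; simp
    have hexp : exp (-z) * exp z = 1 := by rw [← Complex.exp_add]; simp
    have e2 : invGammaSeries α z - exp z * (z : ℂ) ^ (1 - α) =
        (Gamma (α - 1))⁻¹ * (exp z * (z : ℂ) ^ (1 - α) * -(Gamma (α - 1) - partialGamma (α - 1) z)) := by
      have e3 : invGammaSeries α z = exp z * (z : ℂ) ^ (1 - α) *
          (partialGamma (α - 1) z / Gamma (α - 1)) := by
        rw [← e]
        linear_combination (-invGammaSeries α z) * ((exp (-z) * exp z) * hp + hexp)
      rw [e3]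
      field_simp
      ring
    rw [e2, norm_mul, pow_zero]
    refine mul_le_mul_of_nonneg_left ?_ (norm_nonneg _)
    rw [norm_mul, norm_mul, norm_neg, Complex.norm_exp, ofReal_re,
      Complex.norm_cpow_eq_rpow_re_of_pos hzp]
    have e4 := norm_Gamma_sub_partialGamma_le hs hs1 hz
    have e5 : z ^ (1 - α).re ≤ 1 := Real.rpow_le_one_of_one_le_of_nonpos hz (by simp; linarith)
    calc _ ≤ Real.exp z * 1 * Real.exp (-z) := by gcongr
      _ = 1 := by rw [mul_one, ← Real.exp_add]; simp
  have hdown : ∀ m : ℕ, ∀ α : ℂ, (∃ C : ℝ, ∃ K : ℕ, 0 ≤ C ∧ ∀ z : ℝ, 1 ≤ z →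
      ‖invGammaSeries (α + m) z - exp z * (z : ℂ) ^ (1 - (α + m))‖ ≤ C * z ^ K) →
      ∃ C : ℝ, ∃ K : ℕ, 0 ≤ C ∧ ∀ z : ℝ, 1 ≤ z →
        ‖invGammaSeries α z - exp z * (z : ℂ) ^ (1 - α)‖ ≤ C * z ^ K := by
    intro m
    induction m with
    | zero => intro α h; simpa using h
    | succ m ih =>
      intro α h
      refine ih α ?_
      rw [Nat.cast_succ, ← add_assoc] at h
      obtain ⟨C, K, hC, h⟩ := h
      refine ⟨‖(Gamma (α + m))⁻¹‖ + C, K + 1, by positivity, fun z hz => ?_⟩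
      rw [hkey _ z hz, add_mul]
      refine (norm_add_le _ _).trans (add_le_add ?_ ?_)
      · exact le_mul_of_one_le_right (norm_nonneg _) (one_le_pow₀ hz)
      · rw [norm_mul, Complex.norm_real, Real.norm_of_nonneg (by linarith), pow_succ]
        have := h z hz
        calc _ ≤ z * (C * z ^ K) := by gcongr
          _ = _ := by ring
  have hup : ∀ m : ℕ, ∀ α : ℂ, (∃ C : ℝ, ∃ K : ℕ, 0 ≤ C ∧ ∀ z : ℝ, 1 ≤ z →
      ‖invGammaSeries α z - exp z * (z : ℂ) ^ (1 - α)‖ ≤ C * z ^ K) →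
      ∃ C : ℝ, ∃ K : ℕ, 0 ≤ C ∧ ∀ z : ℝ, 1 ≤ z →
        ‖invGammaSeries (α + m) z - exp z * (z : ℂ) ^ (1 - (α + m))‖ ≤ C * z ^ K := by
    intro m
    induction m with
    | zero => intro α h; simpa using h
    | succ m ih =>
      intro α h
      obtain ⟨C, K, hC, h⟩ := ih α h
      rw [Nat.cast_succ, ← add_assoc]
      refine ⟨‖(Gamma (α + m))⁻¹‖ + C, K, by positivity, fun z hz => ?_⟩
      have h1 := hkey (α + m) z hz
      have h2 := h z hz
      have h3 : (z : ℂ) * (invGammaSeries (α + m + 1) z - exp z * (z : ℂ) ^ (1 - (α + m + 1))) =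
        (invGammaSeries (α + m) z - exp z * (z : ℂ) ^ (1 - (α + m))) - (Gamma (α + m))⁻¹ := by
        rw [h1]; ring
      have h4 := congrArg norm h3
      rw [norm_mul, Complex.norm_real, Real.norm_of_nonneg (by linarith)] at h4
      have h5 := le_mul_of_one_le_left (norm_nonneg
        (invGammaSeries (α + m + 1) z - exp z * (z : ℂ) ^ (1 - (α + m + 1)))) hz
      rw [h4] at h5
      have h6 : ‖(Gamma (α + m))⁻¹‖ ≤ ‖(Gamma (α + m))⁻¹‖ * z ^ K :=
        le_mul_of_one_le_right (norm_nonneg _) (one_le_pow₀ hz)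
      have h7 := norm_sub_le
        (invGammaSeries (α + m) z - exp z * (z : ℂ) ^ (1 - (α + m))) ((Gamma (α + m))⁻¹)
      rw [add_mul]
      linarith
  -- This shift brings the real part of `α + m` into `(1, 2]`. The recurrence `hkey` then transports
  -- the bound in either direction, at the cost of a power of `z`.
  obtain ⟨m, hm⟩ : ∃ m : ℤ, m = 2 - ⌈α.re⌉ := ⟨_, rfl⟩
  have hc1 := Int.le_ceil α.re
  have hc2 := Int.ceil_lt_add_one α.re
  have hmr : (m : ℝ) = 2 - ⌈α.re⌉ := by rw [hm]; push_cast; ring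
  have hb := hbase (α + m) (by simp; linarith) (by simp; linarith)
  rcases Int.eq_nat_or_neg m with ⟨k, rfl | rfl⟩
  · exact hdown k α (by simpa using hb)
  · have := hup k _ hb
    simpa using this

end CDO

end

/-! ### From coefficients to exponential asymptotics on the positive axis -/

noncomputable section

namespace CDO

open Complex Filter Topology MeasureTheory Asymptotics

lemma isBigO_cpow_principal_Ici (a : ℂ) : ∃ M : ℕ,
    (fun z : ℝ => (z : ℂ) ^ a) =O[𝓟 (Set.Ici 1)] fun z : ℝ => z ^ M := by
  obtain ⟨M, hM⟩ := exists_nat_ge a.re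
  refine ⟨M, isBigO_principal.2 ⟨1, fun z hz => ?_⟩⟩
  have hz1 : 1 ≤ z := hz
  rw [one_mul, Complex.norm_cpow_eq_rpow_re_of_pos (by linarith),
    Real.norm_of_nonneg (by positivity), ← Real.rpow_natCast]
  exact Real.rpow_le_rpow_of_exponent_le hz1 hM

lemma isBigO_exp_neg_principal_Ici (M : ℕ) :
    (fun z : ℝ => exp (-z)) =O[𝓟 (Set.Ici 1)] fun z : ℝ => (z⁻¹) ^ M := by
  refine isBigO_principal.2 ⟨M.factorial, fun z hz => ?_⟩
  have hz1 : 1 ≤ z := hz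
  have hz0 : 0 < z := by linarith
  have h := Real.pow_div_factorial_le_exp z hz0.le M
  rw [Complex.norm_exp, neg_re, ofReal_re, Real.norm_of_nonneg (by positivity), Real.exp_neg,
    inv_pow, ← div_eq_mul_inv, inv_eq_one_div, div_le_div_iff₀ (Real.exp_pos z) (by positivity)]
  rw [div_le_iff₀ (by positivity)] at h
  linarith

lemma isBigO_inv_pow_principal_Ici {i j : ℕ} (h : i ≤ j) :
    (fun z : ℝ => (z⁻¹) ^ j) =O[𝓟 (Set.Ici 1)] fun z : ℝ => (z⁻¹) ^ i := by
  refine isBigO_principal.2 ⟨1, fun z hz => ?_⟩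
  have hz1 : 1 ≤ z := hz
  have hz0 : 0 < z := by linarith
  rw [one_mul, Real.norm_of_nonneg (by positivity), Real.norm_of_nonneg (by positivity)]
  exact pow_le_pow_of_le_one (by positivity) (inv_le_one_of_one_le₀ hz1) h

lemma pow_mul_inv_pow_eventuallyEq (M N : ℕ) :
    (fun z : ℝ => z ^ M * (z⁻¹) ^ (M + N)) =ᶠ[𝓟 (Set.Ici 1)] fun z => (z⁻¹) ^ N := by
  refine eventually_principal.2 fun z hz => ?_
  have hz1 : 1 ≤ z := hz
  have hz0 : z ≠ 0 := by linarith
  simp only [pow_add, inv_pow]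
  field_simp

/-- A power series with small coefficients compared to those of the exponential. -/
lemma isBigO_tsum_mul_pow {ε : ℕ → ℂ} {L : ℕ}
    (h : ε =O[atTop] fun k : ℕ => ((k + L).factorial : ℝ)⁻¹) :
    (fun z : ℝ => exp (-z) * ∑' k, ε k * (z : ℂ) ^ k) =O[𝓟 (Set.Ici 1)]
      fun z : ℝ => (z⁻¹) ^ L := by
  have hpos : ∀ k : ℕ, (0 : ℝ) < ((k + L).factorial : ℝ)⁻¹ := fun k => by positivity
  obtain ⟨C, hC⟩ := (isBigO_nat_atTop_iff fun k hk => absurd hk (hpos k).ne').1 h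
  refine isBigO_principal.2 ⟨C, fun z hz => ?_⟩
  have hz1 : 1 ≤ z := hz
  have hz0 : 0 < z := by linarith
  have hC0 : 0 ≤ C := by
    have := hC 0
    rw [Real.norm_of_nonneg (hpos 0).le] at this
    exact nonneg_of_mul_nonneg_left ((norm_nonneg _).trans this) (hpos 0)
  have hs := Real.summable_pow_div_factorial z
  have hs' : HasSum (fun k => z ^ k / (k.factorial : ℝ)) (Real.exp z) := by
    rw [Real.exp_eq_exp_ℝ]; exact NormedSpace.expSeries_div_hasSum_exp z
  have hsL := (summable_nat_add_iff L).2 hs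
  have hle : ∑' k, z ^ (k + L) / ((k + L).factorial : ℝ) ≤ Real.exp z := by
    rw [← hs'.tsum_eq, ← hs.sum_add_tsum_nat_add L]
    exact le_add_of_nonneg_left (Finset.sum_nonneg fun _ _ => by positivity)
  -- The power `z⁻ᴸ` is extracted by reindexing: what remains is a tail of the exponential series.
  have hb : ∀ k, ‖ε k * (z : ℂ) ^ k‖ ≤
      C * (z⁻¹) ^ L * (z ^ (k + L) / ((k + L).factorial : ℝ)) := by
    intro k
    have h1 := hC k
    rw [Real.norm_of_nonneg (hpos k).le] at h1
    rw [norm_mul, norm_pow, Complex.norm_real, Real.norm_of_nonneg hz0.le]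
    calc _ ≤ C * ((k + L).factorial : ℝ)⁻¹ * z ^ k := by gcongr
      _ = _ := by rw [inv_pow, pow_add]; field_simp
  have h2 := tsum_of_norm_bounded (hsL.hasSum.mul_left (C * (z⁻¹) ^ L)) hb
  rw [norm_mul, Complex.norm_exp, neg_re, ofReal_re, Real.norm_of_nonneg (by positivity)]
  calc _ ≤ Real.exp (-z) * (C * (z⁻¹) ^ L * Real.exp z) := by
        refine mul_le_mul_of_nonneg_left (h2.trans ?_) (Real.exp_pos _).le
        gcongr
    _ = C * (z⁻¹) ^ L * (Real.exp (-z) * Real.exp z) := by ring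
    _ = _ := by rw [← Real.exp_add]; simp

/-- A power series whose coefficients have an expansion in reciprocal Gamma functions has an
exponential asymptotic expansion on the positive axis. -/
theorem isBigO_exp_neg_mul_tsum_sub {h c : ℕ → ℂ} {α : ℂ}
    (hs : ∀ z : ℂ, Summable fun k => h k * z ^ k)
    (hh : ∀ N : ℕ, (fun k : ℕ => h k * Gamma (k + α) -
      ∑ j ∈ Finset.range N, c j * (rising (k + α) j)⁻¹) =O[atTop] fun k : ℕ => ((k : ℝ)⁻¹) ^ N)
    (N : ℕ) :
    (fun z : ℝ => exp (-z) * (z : ℂ) ^ (α - 1) * ∑' k, h k * (z : ℂ) ^ k -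
      ∑ j ∈ Finset.range N, c j * ((z : ℂ) ^ j)⁻¹) =O[𝓟 (Set.Ici 1)] fun z : ℝ => (z⁻¹) ^ N := by
  obtain ⟨M, hM⟩ := isBigO_cpow_principal_Ici (α - 1)
  obtain ⟨a, ha⟩ := isBigO_Gamma_natCast_add_inv α
  set L := M + N with hL
  -- The expansion is taken `a + L` terms far: `a` powers of `k` are lost in bounding `1/Γ(k + α)`,
  -- and the remaining `L = M + N` turn `1/k!` into `1/(k + L)!`. Of these, `M` compensate the
  -- factor `z^{α-1}`.
  set ε : ℕ → ℂ := fun k => h k - ∑ j ∈ Finset.range (a + L), c j * (Gamma (k + (α + j)))⁻¹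
    with hε
  have hεO : ε =O[atTop] fun k : ℕ => ((k + L).factorial : ℝ)⁻¹ := by
    have h1 := ha.mul (hh (a + L))
    have h2 : ε =ᶠ[atTop] fun k : ℕ => (Gamma (k + α))⁻¹ * (h k * Gamma (k + α) -
        ∑ j ∈ Finset.range (a + L), c j * (rising (k + α) j)⁻¹) := by
      filter_upwards [eventually_Gamma_natCast_add_ne_zero α,
        eventually_natCast_add_add_ne_zero α] with k hk hk'
      simp only [hε]
      rw [mul_sub, Finset.mul_sum]
      congr 1
      · field_simp
      · refine Finset.sum_congr rfl fun j _ => ?_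
        rw [← add_assoc, Gamma_add_natCast fun i _ => hk' i, mul_inv]
        ring
    refine (h1.congr' h2.symm EventuallyEq.rfl).trans ?_
    refine IsBigO.of_bound (2 ^ a * (L + 1) ^ L) ?_
    filter_upwards [eventually_ge_atTop 1] with k hk
    have hk1 : (1 : ℝ) ≤ k := by exact_mod_cast hk
    have hk0 : (0 : ℝ) < k := by linarith
    have hf : (0 : ℝ) < k.factorial := by positivity
    rw [Real.norm_of_nonneg (by positivity), Real.norm_of_nonneg (by positivity)]
    have e1 : ((k + L).factorial : ℝ) ≤ k.factorial * ((L + 1) * k) ^ L := by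
      have e2 := Nat.factorial_mul_descFactorial (Nat.le_add_left L k)
      rw [Nat.add_sub_cancel] at e2
      rw [← e2]
      have e3 := Nat.descFactorial_le_pow (k + L) L
      push_cast
      refine mul_le_mul_of_nonneg_left ?_ hf.le
      calc (((k + L).descFactorial L : ℕ) : ℝ) ≤ ((k + L : ℕ) : ℝ) ^ L := by exact_mod_cast e3
        _ ≤ _ := by
          gcongr
          push_cast
          nlinarith [(Nat.cast_nonneg L : (0 : ℝ) ≤ L)]
    have e4 : (k + 1 : ℝ) ^ a ≤ 2 ^ a * k ^ a := by
      rw [← mul_pow]; gcongr; linarith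
    rw [← div_eq_mul_inv, le_div_iff₀ (by positivity)]
    calc _ ≤ (2 ^ a * (k : ℝ) ^ a) / k.factorial * ((k : ℝ)⁻¹) ^ (a + L) *
          (k.factorial * ((L + 1) * k) ^ L) := by gcongr
      _ = _ := by rw [mul_pow, pow_add, inv_pow, inv_pow]; field_simp
  have hE := isBigO_tsum_mul_pow hεO
  have hsum : ∀ z : ℂ, ∑' k, h k * z ^ k =
      (∑ j ∈ Finset.range (a + L), c j * invGammaSeries (α + j) z) + ∑' k, ε k * z ^ k := by
    intro z
    have h1 : HasSum (fun k : ℕ => ∑ j ∈ Finset.range (a + L), c j *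
        ((Gamma (k + (α + j)))⁻¹ * z ^ k))
        (∑ j ∈ Finset.range (a + L), c j * invGammaSeries (α + j) z) :=
      hasSum_sum fun j _ => (summable_Gamma_inv_mul_pow (α + j) z).hasSum.mul_left _
    have h2 : ∀ k, ε k * z ^ k = h k * z ^ k - ∑ j ∈ Finset.range (a + L), c j *
        ((Gamma (k + (α + j)))⁻¹ * z ^ k) := by
      intro k
      simp only [hε]
      rw [sub_mul, Finset.sum_mul]
      congr 1
      exact Finset.sum_congr rfl fun j _ => by ring
    simp_rw [h2]
    rw [(hs z).tsum_sub h1.summable, h1.tsum_eq]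
    ring
  have hmain : ∀ j : ℕ, (fun z : ℝ => exp (-z) * (z : ℂ) ^ (α - 1) *
      (invGammaSeries (α + j) z - exp z * (z : ℂ) ^ (1 - (α + j)))) =O[𝓟 (Set.Ici 1)]
      fun z : ℝ => (z⁻¹) ^ N := by
    intro j
    obtain ⟨C, K, hC, hb⟩ := exists_norm_invGammaSeries_sub_le (α + j)
    have h1 : (fun z : ℝ => invGammaSeries (α + j) z - exp z * (z : ℂ) ^ (1 - (α + j)))
        =O[𝓟 (Set.Ici 1)] fun z : ℝ => z ^ K :=
      isBigO_principal.2 ⟨C, fun z hz => by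
        have hz1 : 1 ≤ z := hz
        rw [Real.norm_of_nonneg (by positivity)]
        exact hb z hz1⟩
    have h2 := ((isBigO_exp_neg_principal_Ici (M + K + N)).mul hM).mul h1
    refine h2.congr' EventuallyEq.rfl ((EventuallyEq.of_eq ?_).trans
      (pow_mul_inv_pow_eventuallyEq (M + K) N))
    funext z
    rw [pow_add z]; ring
  have hrem : (fun z : ℝ => (z : ℂ) ^ (α - 1) * (exp (-z) * ∑' k, ε k * (z : ℂ) ^ k))
      =O[𝓟 (Set.Ici 1)] fun z : ℝ => (z⁻¹) ^ N :=
    (hM.mul hE).congr' EventuallyEq.rfl (pow_mul_inv_pow_eventuallyEq M N)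
  -- The terms of index `N` to `a + L - 1` are already of the order of the error.
  have htail : (fun z : ℝ => ∑ i ∈ Finset.range (a + M), c (N + i) * ((z : ℂ) ^ (N + i))⁻¹)
      =O[𝓟 (Set.Ici 1)] fun z : ℝ => (z⁻¹) ^ N := by
    refine IsBigO.fun_sum fun i _ => IsBigO.const_mul_left ?_ _
    refine IsBigO.trans ?_ (isBigO_inv_pow_principal_Ici (Nat.le_add_right N i))
    refine isBigO_principal.2 ⟨1, fun z hz => ?_⟩
    rw [norm_inv, norm_pow, norm_pow, norm_inv, Complex.norm_real, one_mul, inv_pow]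
  have hall := ((IsBigO.fun_sum fun j (_ : j ∈ Finset.range (a + L)) =>
    (hmain j).const_mul_left (c j)).add hrem).add htail
  refine hall.congr' (eventually_principal.2 fun z hz => ?_) EventuallyEq.rfl
  have hz1 : 1 ≤ z := hz
  have hz0 : (z : ℂ) ≠ 0 := by exact_mod_cast (by linarith : z ≠ 0)
  have hlead : ∀ j : ℕ, exp (-z) * (z : ℂ) ^ (α - 1) * (exp z * (z : ℂ) ^ (1 - (α + j))) =
      ((z : ℂ) ^ j)⁻¹ := by
    intro j
    have e1 : exp (-z) * exp z = 1 := by rw [← Complex.exp_add]; simp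
    have e2 : (z : ℂ) ^ (α - 1) * (z : ℂ) ^ (1 - (α + j)) = ((z : ℂ) ^ j)⁻¹ := by
      rw [← cpow_add _ _ hz0, show α - 1 + (1 - (α + j)) = -(j : ℂ) by ring, cpow_neg, cpow_natCast]
    calc _ = (exp (-z) * exp z) * ((z : ℂ) ^ (α - 1) * (z : ℂ) ^ (1 - (α + j))) := by ring
      _ = _ := by rw [e1, e2, one_mul]
  have hsplit : ∑ j ∈ Finset.range (a + L), c j * ((z : ℂ) ^ j)⁻¹ =
      ∑ j ∈ Finset.range N, c j * ((z : ℂ) ^ j)⁻¹ +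
      ∑ i ∈ Finset.range (a + M), c (N + i) * ((z : ℂ) ^ (N + i))⁻¹ := by
    rw [← Finset.sum_range_add]
    congr 2; omega
  simp only [mul_sub, hlead, Finset.sum_sub_distrib]
  rw [hsplit, hsum, mul_add, Finset.mul_sum]
  have e : ∀ j, c j * (exp (-z) * (z : ℂ) ^ (α - 1) * invGammaSeries (α + j) z) =
      exp (-z) * (z : ℂ) ^ (α - 1) * (c j * invGammaSeries (α + j) z) := fun j => by ring
  simp only [e]
  ring

end CDO

end

/-! ### Expansion of the analytic solutions on the positive axis -/

noncomputable section

namespace CDO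

open Complex Filter Topology MeasureTheory Asymptotics

variable {n : ℕ} (p : Fin (n + 1) → ℂ) (q : Fin n → ℂ)

/-- The sequence `p 1, …, p n, p 0, p 1, …`. -/
def cyclicSeq (i : ℕ) : ℂ := p (Fin.ofNat (n + 1) (i + 1))

/-- Extension by zero to all natural numbers. -/
def extendSeq (i : ℕ) : ℂ := if h : i < n then q ⟨i, h⟩ else 0

lemma cyclicSeq_val (c : Fin (n + 1)) : cyclicSeq p c = p (c + 1) := by
  rw [cyclicSeq]
  congr 1
  apply Fin.ext
  simp [Fin.val_add]

lemma extendSeq_val (c : Fin n) : extendSeq q c = q c := by simp [extendSeq]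

lemma prod_cyclicSeq (f : ℂ → ℂ) :
    ∏ i ∈ Finset.range (n + 1), f (cyclicSeq p i) = ∏ c, f (p c) := by
  rw [← Fin.prod_univ_eq_prod_range (fun i => f (cyclicSeq p i))]
  simp_rw [cyclicSeq_val]
  exact Equiv.prod_comp (Equiv.addRight (1 : Fin (n + 1))) fun c => f (p c)

lemma sum_cyclicSeq : ∑ i ∈ Finset.range (n + 1), cyclicSeq p i = ∑ c, p c := by
  rw [← Fin.sum_univ_eq_sum_range (fun i => cyclicSeq p i)]
  simp_rw [cyclicSeq_val]
  exact Equiv.sum_comp (Equiv.addRight (1 : Fin (n + 1))) p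

lemma prod_extendSeq (f : ℂ → ℂ) :
    ∏ i ∈ Finset.range n, f (extendSeq q i) = ∏ c, f (q c) := by
  rw [← Fin.prod_univ_eq_prod_range (fun i => f (extendSeq q i))]
  simp_rw [extendSeq_val]

lemma sum_extendSeq : ∑ i ∈ Finset.range n, extendSeq q i = ∑ c, q c := by
  rw [← Fin.sum_univ_eq_sum_range (fun i => extendSeq q i)]
  simp_rw [extendSeq_val]

/-- The index `d` enters only through the base point `β = 1 - p d`, and the Gauss coefficients do
not involve `β`. Hence all analytic solutions share the same expansion coefficients. -/
lemma gammaQuot_eq_gammaProdQuot (d : Fin (n + 1)) (k : ℕ) :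
    gammaQuot p q (p d - k) = gammaProdQuot (cyclicSeq p) (extendSeq q) (1 - p d) n k := by
  rw [gammaQuot, gammaProdQuot, prod_cyclicSeq p fun x => Gamma (k + (1 - p d + x)),
    prod_extendSeq q fun x => Gamma (k + (1 - p d - x))]
  congr 1
  · exact Finset.prod_congr rfl fun c _ => by congr 1; ring
  · exact Finset.prod_congr rfl fun c _ => by congr 1; ring

/-- The coefficients of the exponential asymptotic expansion. -/
def domCoeff (k : ℕ) : ℂ :=
  gaussCoeff (fun i => cyclicSeq p (i + 1) + extendSeq q i)
    (fun i => ∑ d ∈ Finset.range (i + 1), (cyclicSeq p d + extendSeq q d)) n k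

/-- Starting the cyclic order at `p 1` makes the first parameters `P_{c+2} + Q_c` and the second
ones partial sums of `P_{d+1} + Q_d`, in the indexing from `1`. -/
lemma expCoeff_eq_domCoeff (P : Fin (n + 1) → ℂ) (Q : Fin n → ℂ) (hbar : ℂ) (a : Fin (n + 1))
    (k : ℕ) : expCoeff P Q hbar a k =
      domCoeff (fun c => P c / hbar) (fun c => Q c / hbar + delta a c) k := by
  rw [domCoeff, gaussCoeff_eq_sum, expCoeff]
  refine Finset.sum_congr rfl fun κ _ => Finset.prod_congr rfl fun c _ => ?_
  have h1 : cyclicSeq (fun c => P c / hbar) (c + 1) + extendSeq (fun c => Q c / hbar + delta a c) c =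
      (P (c.succ + 1) + Q c) / hbar + delta a c := by
    have := cyclicSeq_val (fun c => P c / hbar) c.succ
    rw [Fin.val_succ] at this
    rw [this, extendSeq_val]
    ring
  have h2 : ∀ d : Fin n, cyclicSeq (fun c => P c / hbar) d +
      extendSeq (fun c => Q c / hbar + delta a c) d = (P d.succ + Q d) / hbar + delta a d := by
    intro d
    have := cyclicSeq_val (fun c => P c / hbar) d.castSucc
    rw [Fin.val_castSucc, Fin.coeSucc_eq_succ] at this
    rw [this, extendSeq_val]
    ring
  have h3 : ∑ d ∈ Finset.range (c + 1), (cyclicSeq (fun c => P c / hbar) d +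
      extendSeq (fun c => Q c / hbar + delta a c) d) =
      ∑ d ∈ Finset.Iic c, ((P d.succ + Q d) / hbar + delta a d) := by
    have hr : Finset.range ((c : ℕ) + 1) = (Finset.Iic c).map Fin.valEmbedding := by
      rw [Fin.map_valEmbedding_Iic]
      ext; simp
    rw [hr, Finset.sum_map]
    exact Finset.sum_congr rfl fun d _ => h2 d
  simp only [h1, h3, rising]

variable {p q}

/-- Asymptotic expansion of the analytic solutions on the positive axis. -/
theorem exists_norm_analyticSol_ofReal_sub_le (hpp : ∀ b c, b ≠ c → ∀ m : ℤ, p b - p c ≠ m)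
    (hpq : ∀ b c, ∀ m : ℤ, p b + q c ≠ m) (d : Fin (n + 1)) (N : ℕ) :
    ∃ C : ℝ, ∀ x : ℝ, 0 ≤ x →
      ‖analyticSol p q d x * exp (-exp x + (∑ c, p c + ∑ c, q c) * x) -
        ∑ j ∈ Finset.range N, domCoeff p q j * exp (-j * x)‖ ≤ C * Real.exp (-N * x) := by
  set μ := ∑ c, p c + ∑ c, q c with hμ
  -- So `z^{α - 1} = z^{μ - p d}`, and the factor `z^{-p d}` of the solution cancels the dependence
  -- on `d`.
  have hα : gammaProdShift (cyclicSeq p) (extendSeq q) (1 - p d) n = 1 - p d + μ := by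
    rw [gammaProdShift, sum_cyclicSeq, sum_extendSeq, hμ]; ring
  have hterm : ∀ w : ℂ, ∀ k : ℕ, gammaQuot p q (p d - k) * exp (w * (k - p d)) =
      exp (-w * p d) * (gammaQuot p q (p d - k) * exp w ^ k) := by
    intro w k
    rw [← Complex.exp_nat_mul, show w * (k - p d) = -w * p d + k * w by ring, Complex.exp_add]
    ring
  have hs : ∀ z : ℂ, Summable fun k : ℕ => gammaQuot p q (p d - k) * z ^ k := by
    intro z
    rcases eq_or_ne z 0 with rfl | hz
    · exact summable_of_ne_finset_zero (s := {0}) fun k hk => by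
        simp at hk; simp [hk]
    · have h := summable_analyticSol hpp hpq d (Complex.log z)
      simp_rw [hterm, Complex.exp_log hz] at h
      exact (summable_mul_left_iff (Complex.exp_ne_zero _)).1 h
  have h := isBigO_exp_neg_mul_tsum_sub (c := domCoeff p q) (α := 1 - p d + μ) hs (fun N => by
    have := isBigO_gammaProdQuot_sub (cyclicSeq p) (extendSeq q) (1 - p d) n N
    simp_rw [hα, ← gammaQuot_eq_gammaProdQuot] at this
    exact this) N
  obtain ⟨C, hC⟩ := isBigO_principal.1 h
  refine ⟨C, fun x hx => ?_⟩
  have h1 := hC (Real.exp x) (Real.one_le_exp hx)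
  have hpow : ∀ a : ℂ, ((Real.exp x : ℝ) : ℂ) ^ a = exp (a * x) := by
    intro a
    rw [Complex.cpow_def_of_ne_zero (by exact_mod_cast (Real.exp_pos x).ne'),
      ← Complex.ofReal_log (Real.exp_pos x).le, Real.log_exp, mul_comm]
  rw [hpow, norm_pow, norm_inv, Real.norm_of_nonneg (Real.exp_pos x).le, ← Real.exp_neg,
    ← Real.exp_nat_mul, mul_neg, ← neg_mul] at h1
  refine le_trans (le_of_eq (congrArg norm ?_)) h1
  rw [analyticSol]
  simp_rw [hterm]
  rw [tsum_mul_left, ofReal_exp]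
  congr 1
  · rw [Complex.exp_add, show (1 - p d + μ - 1) * (x : ℂ) = -x * p d + μ * x by ring,
      Complex.exp_add]
    ring
  · refine Finset.sum_congr rfl fun j _ => ?_
    rw [← Complex.exp_nat_mul, ← Complex.exp_neg, neg_mul]

end CDO

end

/-! ### Phragmén–Lindelöf in a half-strip and the sum of the connection coefficients -/

noncomputable section

namespace CDO

open Complex Filter Topology MeasureTheory Asymptotics

/-- The Phragmén–Lindelöf principle in a half-strip, for an entire function. -/
theorem exists_norm_le_of_halfStrip {f : ℂ → ℂ} (hf : Differentiable ℂ f) {a b C K C₀ K₀ B c : ℝ}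
    (hab : a < b) (hba : b - a ≤ 2 * Real.pi) (hc : 0 ≤ c) (hcab : c < Real.pi / (b - a))
    (hB : 0 ≤ B) (hK₀ : 0 ≤ K₀)
    (hgrowth : ∀ w : ℂ, a ≤ w.im → w.im ≤ b →
      ‖f w‖ ≤ C₀ * Real.exp (K₀ * |w.re| + B * Real.exp (c * w.re)))
    (ha : ∀ x : ℝ, 0 ≤ x → ‖f (x + a * I)‖ ≤ C * Real.exp (K * x))
    (hb : ∀ x : ℝ, 0 ≤ x → ‖f (x + b * I)‖ ≤ C * Real.exp (K * x)) :
    ∃ C' : ℝ, ∀ w : ℂ, 0 ≤ w.re → a ≤ w.im → w.im ≤ b → ‖f w‖ ≤ C' * Real.exp (K * w.re) := by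
  have hC : 0 ≤ C := by simpa using (norm_nonneg _).trans (ha 0 le_rfl)
  have hC₀ : 0 ≤ C₀ := by
    have := (norm_nonneg _).trans (hgrowth (a * I) (by simp) (by simpa using hab.le))
    exact nonneg_of_mul_nonneg_left this (Real.exp_pos _)
  -- To apply the theorem for a full strip, `f(w) e^{-Kw}` is multiplied by the `L`-th power of an
  -- auxiliary function `l`. It decays like `e^{Re w / 2}` to the left, where `L` copies of it
  -- absorb the growth rate `K₀ + |K|`, and has modulus between `1/2` and `1` on the right half.
  obtain ⟨L, hL⟩ := exists_nat_ge (2 * (K₀ + |K|))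
  set v : ℂ → ℂ := fun w => (w - (a + b) / 2 * I) / 2 with hv
  have hvre : ∀ w, (v w).re = w.re / 2 := fun w => by
    simp only [hv]
    rw [show (w - ((a : ℂ) + b) / 2 * I) / 2 = ((1 / 2 : ℝ) : ℂ) * (w - ((((a + b) / 2 : ℝ) : ℂ)) * I) by
      push_cast; ring, Complex.re_ofReal_mul]
    simp; ring
  have hvim : ∀ w, (v w).im = (w.im - (a + b) / 2) / 2 := fun w => by
    simp only [hv]
    rw [show (w - ((a : ℂ) + b) / 2 * I) / 2 = ((1 / 2 : ℝ) : ℂ) * (w - ((((a + b) / 2 : ℝ) : ℂ)) * I) by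
      push_cast; ring, Complex.im_ofReal_mul]
    simp; ring
  -- The hypothesis `b - a ≤ 2π` enters here: `|Im v| ≤ (b - a)/4 ≤ π/2`, so `e^v` has nonnegative
  -- real part and `|1 + e^v|` is at least both `1` and `|e^v|`.
  have hre : ∀ w : ℂ, a ≤ w.im → w.im ≤ b → 0 ≤ (exp (v w)).re := by
    intro w h1 h2
    rw [Complex.exp_re]
    refine mul_nonneg (Real.exp_pos _).le (Real.cos_nonneg_of_neg_pi_div_two_le_of_le ?_ ?_) <;>
      rw [hvim] <;> linarith
  have hden1 : ∀ w : ℂ, a ≤ w.im → w.im ≤ b → 1 ≤ ‖1 + exp (v w)‖ := fun w h1 h2 => by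
    have := (Complex.abs_re_le_norm (1 + exp (v w)))
    have h3 := le_abs_self (1 + exp (v w)).re
    rw [add_re, one_re] at h3
    rw [add_re, one_re] at this
    linarith [hre w h1 h2]
  have hden2 : ∀ w : ℂ, a ≤ w.im → w.im ≤ b → ‖exp (v w)‖ ≤ ‖1 + exp (v w)‖ := fun w h1 h2 => by
    rw [← sq_le_sq₀ (norm_nonneg _) (norm_nonneg _), ← Complex.normSq_eq_norm_sq,
      ← Complex.normSq_eq_norm_sq, Complex.normSq_add]
    simp only [map_one, one_mul, conj_re]
    linarith [hre w h1 h2]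
  set l : ℂ → ℂ := fun w => exp (v w) / (1 + exp (v w)) with hl
  have hl1 : ∀ w : ℂ, a ≤ w.im → w.im ≤ b → ‖l w‖ ≤ 1 := fun w h1 h2 => by
    simp only [hl, norm_div]
    exact div_le_one_of_le₀ (hden2 w h1 h2) (norm_nonneg _)
  have hl2 : ∀ w : ℂ, a ≤ w.im → w.im ≤ b → ‖l w‖ ≤ Real.exp (w.re / 2) := fun w h1 h2 => by
    simp only [hl, norm_div]
    rw [← hvre, ← Complex.norm_exp]
    exact div_le_self (norm_nonneg _) (hden1 w h1 h2)
  have hl3 : ∀ w : ℂ, 0 ≤ w.re → a ≤ w.im → w.im ≤ b → 1 / 2 ≤ ‖l w‖ := fun w h0 h1 h2 => by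
    simp only [hl, norm_div]
    rw [div_le_div_iff₀ two_pos (by linarith [hden1 w h1 h2])]
    have h3 := norm_add_le 1 (exp (v w))
    have h4 : 1 ≤ ‖exp (v w)‖ := by
      rw [Complex.norm_exp, hvre]; exact Real.one_le_exp (by linarith)
    rw [norm_one] at h3
    linarith
  set g : ℂ → ℂ := fun w => f w * exp (-K * w) * l w ^ L with hg
  have hnormexp : ∀ w : ℂ, ‖exp (-K * w)‖ = Real.exp (-K * w.re) := fun w => by
    rw [Complex.norm_exp]; simp
  have hneg : ∀ w : ℂ, w.re ≤ 0 → a ≤ w.im → w.im ≤ b → ‖g w‖ ≤ C₀ * Real.exp B := by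
    intro w h0 h1 h2
    simp only [hg]
    rw [norm_mul, norm_mul, norm_pow, hnormexp]
    calc _ ≤ C₀ * Real.exp (K₀ * |w.re| + B * Real.exp (c * w.re)) * Real.exp (-K * w.re) *
          Real.exp (w.re / 2) ^ L := by
          gcongr
          · exact hgrowth w h1 h2
          · exact hl2 w h1 h2
      _ = C₀ * Real.exp (K₀ * |w.re| + B * Real.exp (c * w.re) + -K * w.re + L * (w.re / 2)) := by
          rw [← Real.exp_nat_mul, mul_assoc, mul_assoc, ← Real.exp_add, ← Real.exp_add]
          congr 2; ring
      _ ≤ C₀ * Real.exp B := by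
          refine mul_le_mul_of_nonneg_left (Real.exp_le_exp.2 ?_) hC₀
          have h3 : B * Real.exp (c * w.re) ≤ B := mul_le_of_le_one_right hB
            (Real.exp_le_one_iff.2 (mul_nonpos_of_nonneg_of_nonpos hc h0))
          rw [abs_of_nonpos h0]
          have h4 : K * -w.re ≤ |K| * -w.re :=
            mul_le_mul_of_nonneg_right (le_abs_self K) (by linarith)
          have h5 : 2 * (K₀ + |K|) * -w.re ≤ L * -w.re :=
            mul_le_mul_of_nonneg_right hL (by linarith)
          linarith
  have hpos : ∀ w : ℂ, 0 ≤ w.re → a ≤ w.im → w.im ≤ b → ‖f w‖ ≤ C * Real.exp (K * w.re) →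
      ‖g w‖ ≤ C := by
    intro w h0 h1 h2 h3
    simp only [hg]
    rw [norm_mul, norm_mul, norm_pow, hnormexp]
    calc _ ≤ C * Real.exp (K * w.re) * Real.exp (-K * w.re) * 1 ^ L := by
          gcongr
          exact hl1 w h1 h2
      _ = C := by
          rw [one_pow, mul_one, mul_assoc, ← Real.exp_add]; simp
  have hCC : C ≤ C + C₀ * Real.exp B := le_add_of_nonneg_right (by positivity)
  have hCC' : C₀ * Real.exp B ≤ C + C₀ * Real.exp B := le_add_of_nonneg_left hC
  have hPL : ∀ w : ℂ, a ≤ w.im → w.im ≤ b → ‖g w‖ ≤ C + C₀ * Real.exp B := by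
    intro w h1 h2
    refine PhragmenLindelof.horizontal_strip (f := g) ?_ ?_ ?_ ?_ h1 h2
    · apply DifferentiableOn.diffContOnCl
      intro z hz
      have hz' : z ∈ im ⁻¹' Set.Icc a b :=
        closure_minimal (Set.preimage_mono Set.Ioo_subset_Icc_self)
          (isClosed_Icc.preimage continuous_im) hz
      have hne : 1 + exp (v z) ≠ 0 := fun h => by
        have := hden1 z hz'.1 hz'.2
        rw [h, norm_zero] at this
        linarith
      have hvd : DifferentiableAt ℂ v z := by simp only [hv]; fun_prop
      refine DifferentiableAt.differentiableWithinAt ?_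
      refine ((hf z).mul (by fun_prop)).mul (DifferentiableAt.pow ?_ L)
      exact hvd.cexp.div (hvd.cexp.const_add 1) hne
    -- As `c` may vanish, a strictly larger rate is chosen, so that `e^{c' |Re z|}` also absorbs the
    -- terms linear in `|Re z|`.
    · obtain ⟨c', hc1, hc2⟩ := exists_between hcab
      have hc0 : 0 < c' := lt_of_le_of_lt hc hc1
      refine ⟨c', hc2, B + (K₀ + |K|) / c', ?_⟩
      refine IsBigO.of_bound C₀ ?_
      refine Filter.Eventually.filter_mono inf_le_right (eventually_principal.2 fun z hz => ?_)
      have hz1 : a ≤ z.im := hz.1.le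
      have hz2 : z.im ≤ b := hz.2.le
      simp only [hg]
      rw [norm_mul, norm_mul, norm_pow, hnormexp, Real.norm_of_nonneg (Real.exp_pos _).le]
      calc _ ≤ C₀ * Real.exp (K₀ * |z.re| + B * Real.exp (c * z.re)) * Real.exp (-K * z.re) *
            1 ^ L := by
            gcongr
            · exact hgrowth z hz1 hz2
            · exact hl1 z hz1 hz2
        _ = C₀ * Real.exp (K₀ * |z.re| + B * Real.exp (c * z.re) + -K * z.re) := by
            rw [one_pow, mul_one, mul_assoc, ← Real.exp_add]
        _ ≤ _ := by
            refine mul_le_mul_of_nonneg_left (Real.exp_le_exp.2 ?_) hC₀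
            have h3 : Real.exp (c * z.re) ≤ Real.exp (c' * |z.re|) := by
              apply Real.exp_le_exp.2
              exact (mul_le_mul_of_nonneg_left (le_abs_self _) hc).trans
                (mul_le_mul_of_nonneg_right hc1.le (abs_nonneg _))
            have h4 : |z.re| ≤ Real.exp (c' * |z.re|) / c' := by
              rw [le_div_iff₀ hc0]
              linarith [Real.add_one_le_exp (c' * |z.re|)]
            have h5 : -K * z.re ≤ |K| * |z.re| := by
              rw [← abs_neg K, ← abs_mul]; exact le_abs_self _
            calc _ ≤ B * Real.exp (c' * |z.re|) + (K₀ + |K|) * |z.re| := by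
                  linarith [mul_le_mul_of_nonneg_left h3 hB]
              _ ≤ B * Real.exp (c' * |z.re|) + (K₀ + |K|) * (Real.exp (c' * |z.re|) / c') := by
                  gcongr
              _ = _ := by ring
    · intro z hz
      rcases le_total z.re 0 with h0 | h0
      · exact (hneg z h0 hz.ge (by linarith)).trans hCC'
      · refine (hpos z h0 hz.ge (by linarith) ?_).trans hCC
        have := ha z.re h0
        rwa [← hz, Complex.re_add_im] at this
    · intro z hz
      rcases le_total z.re 0 with h0 | h0
      · exact (hneg z h0 (by linarith) hz.le).trans hCC'
      · refine (hpos z h0 (by linarith) hz.le ?_).trans hCC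
        have := hb z.re h0
        rwa [← hz, Complex.re_add_im] at this
  refine ⟨2 ^ L * (C + C₀ * Real.exp B), fun w h0 h1 h2 => ?_⟩
  have h3 := hPL w h1 h2
  simp only [hg] at h3
  rw [norm_mul, norm_mul, norm_pow, hnormexp] at h3
  have h4 : (1 / 2 : ℝ) ^ L ≤ ‖l w‖ ^ L := pow_le_pow_left₀ (by norm_num) (hl3 w h0 h1 h2) L
  have h5 : ‖f w‖ * Real.exp (-K * w.re) * (1 / 2) ^ L ≤ C + C₀ * Real.exp B :=
    (mul_le_mul_of_nonneg_left h4 (by positivity)).trans h3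
  calc ‖f w‖ = (‖f w‖ * Real.exp (-K * w.re) * (1 / 2) ^ L) * (2 ^ L * Real.exp (K * w.re)) := by
        rw [one_div, inv_pow, neg_mul, Real.exp_neg]; field_simp
    _ ≤ (C + C₀ * Real.exp B) * (2 ^ L * Real.exp (K * w.re)) := by gcongr
    _ = _ := by ring

variable {n : ℕ} {p : Fin (n + 1) → ℂ} {q : Fin n → ℂ}

lemma sin_pi_mul_add (u v : ℂ) : sin (Real.pi * (u + v)) =
    exp (-(I * Real.pi * u)) / (2 * I) * (exp (I * Real.pi * v) *
      (exp (2 * Real.pi * I * u) - exp (-(2 * Real.pi * I * v)))) := by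
  have hI : (2 * I : ℂ) ≠ 0 := by simp
  have h1 : exp (-(I * Real.pi * u)) * (exp (I * Real.pi * v) * exp (2 * Real.pi * I * u)) =
      exp (Real.pi * (u + v) * I) := by
    rw [← Complex.exp_add, ← Complex.exp_add]; congr 1; ring
  have h2 : exp (-(I * Real.pi * u)) * (exp (I * Real.pi * v) * exp (-(2 * Real.pi * I * v))) =
      exp (-(Real.pi * (u + v)) * I) := by
    rw [← Complex.exp_add, ← Complex.exp_add]; congr 1; ring
  rw [div_mul_eq_mul_div, eq_div_iff hI, mul_sub, mul_sub, h1, h2]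
  linear_combination I * Complex.two_sin (Real.pi * (u + v)) +
    (exp (-(Real.pi * (u + v)) * I) - exp (Real.pi * (u + v) * I)) * I_sq

/-- In the variables `X_d = e^{2πi p d}` and `Y_c = e^{-2πi q c}` the coefficient is `∏ (X_d - Y_c)
/ ∏_{c ≠ d} (X_d - X_c)`; both products of sines carry the same `n`-th power of `e^{-iπ p d} /
(2i)`. -/
lemma exp_mul_sinQuot (p : Fin (n + 1) → ℂ) (q : Fin n → ℂ) (d : Fin (n + 1)) :
    exp (-(I * Real.pi * (∑ c, p c + ∑ c, q c - p d))) * sinQuot p q d =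
      (∏ c, (exp (2 * Real.pi * I * p d) - exp (-(2 * Real.pi * I * q c)))) /
        ∏ c ∈ Finset.univ.erase d, (exp (2 * Real.pi * I * p d) - exp (2 * Real.pi * I * p c)) := by
  have hsub : ∀ f : Fin (n + 1) → ℂ, ∏ c : {c // c ≠ d}, f c = ∏ c ∈ Finset.univ.erase d, f c :=
    fun f => (Finset.prod_subtype _ (by simp) f).symm
  have hnum : ∏ c, sin (Real.pi * (p d + q c)) = (exp (-(I * Real.pi * p d)) / (2 * I)) ^ n *
      (exp (I * Real.pi * ∑ c, q c) *
        ∏ c, (exp (2 * Real.pi * I * p d) - exp (-(2 * Real.pi * I * q c)))) := by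
    simp_rw [sin_pi_mul_add, Finset.prod_mul_distrib, Finset.mul_sum, Complex.exp_sum]
    simp [div_pow]
  have hden : ∏ c : {c // c ≠ d}, sin (Real.pi * (p d - p c)) =
      (exp (-(I * Real.pi * p d)) / (2 * I)) ^ n * (exp (-(I * Real.pi * (∑ c, p c - p d))) *
        ∏ c ∈ Finset.univ.erase d,
          (exp (2 * Real.pi * I * p d) - exp (2 * Real.pi * I * p c))) := by
    rw [hsub fun c => sin (Real.pi * (p d - p c))]
    have h1 : ∑ c, p c - p d = ∑ c ∈ Finset.univ.erase d, p c := by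
      rw [← Finset.add_sum_erase _ _ (Finset.mem_univ d)]; ring
    rw [h1, Finset.mul_sum, ← Finset.sum_neg_distrib, Complex.exp_sum]
    simp_rw [sub_eq_add_neg, sin_pi_mul_add, Finset.prod_mul_distrib]
    simp [div_pow, sub_eq_add_neg]
  have hA : (exp (-(I * Real.pi * p d)) / (2 * I)) ^ n ≠ 0 := by simp [Complex.exp_ne_zero]
  rw [sinQuot, hnum, hden, mul_div_mul_left _ _ hA, mul_div_mul_comm, ← Complex.exp_sub,
    ← mul_assoc, ← Complex.exp_add]
  rw [show -(I * Real.pi * (∑ c, p c + ∑ c, q c - p d)) + (I * Real.pi * ∑ c, q c -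
    -(I * Real.pi * (∑ c, p c - p d))) = 0 by ring, Complex.exp_zero, one_mul]

/-- A partial fraction identity for the connection coefficients. -/
theorem sum_exp_mul_sinQuot (hpp : ∀ b c, b ≠ c → ∀ m : ℤ, p b - p c ≠ m) :
    ∑ d, exp (-(I * Real.pi * (∑ c, p c + ∑ c, q c - p d))) * sinQuot p q d = 1 := by
  have hinj : Set.InjOn (fun d => exp (2 * Real.pi * I * p d))
      ((Finset.univ : Finset (Fin (n + 1))) : Set (Fin (n + 1))) := by
    intro b _ c _ h
    by_contra hbc
    obtain ⟨m, hm⟩ := Complex.exp_eq_exp_iff_exists_int.1 h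
    refine hpp b c hbc m (mul_left_cancel₀ Complex.two_pi_I_ne_zero ?_)
    linear_combination hm
  have hmonic : (∏ c, (Polynomial.X - Polynomial.C (exp (-(2 * Real.pi * I * q c))))).Monic :=
    Polynomial.monic_prod_X_sub_C _ _
  -- The sum is the leading coefficient of the monic polynomial `∏ (X - Y_c)` of degree `n`,
  -- recovered by interpolation at the `n + 1` nodes `X_d`, which are distinct by the genericity of
  -- `p`.
  have h := Lagrange.leadingCoeff_eq_sum hinj
    (P := ∏ c, (Polynomial.X - Polynomial.C (exp (-(2 * Real.pi * I * q c))))) (by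
      rw [Polynomial.degree_prod]
      simp)
  rw [hmonic.leadingCoeff] at h
  rw [h]
  refine Finset.sum_congr rfl fun d _ => ?_
  rw [exp_mul_sinQuot, Polynomial.eval_prod]
  simp

lemma sinQuot_neg (p : Fin (n + 1) → ℂ) (q : Fin n → ℂ) (d : Fin (n + 1)) :
    sinQuot (fun c => -p c) (fun c => -q c) d = sinQuot p q d := by
  have h1 : ∀ u v : ℂ, sin (Real.pi * (-u + -v)) = -1 * sin (Real.pi * (u + v)) := fun u v => by
    rw [show (Real.pi : ℂ) * (-u + -v) = -(Real.pi * (u + v)) by ring, Complex.sin_neg]; ring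
  have h2 : ∀ u v : ℂ, sin (Real.pi * (-u - -v)) = -1 * sin (Real.pi * (u - v)) := fun u v => by
    rw [show (Real.pi : ℂ) * (-u - -v) = -(Real.pi * (u - v)) by ring, Complex.sin_neg]; ring
  simp_rw [sinQuot, h1, h2, Finset.prod_mul_distrib]
  rw [Finset.prod_const, Finset.prod_const]
  have : (-1 : ℂ) ^ n ≠ 0 := by simp
  simp [mul_div_mul_left _ _ this]

/-- The previous identity at `-p`, `-q`: the sine quotient is even, having `n` factors above and
below, while the exponential is inverted. -/
theorem sum_exp_mul_sinQuot' (hpp : ∀ b c, b ≠ c → ∀ m : ℤ, p b - p c ≠ m) :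
    ∑ d, exp (I * Real.pi * (∑ c, p c + ∑ c, q c - p d)) * sinQuot p q d = 1 := by
  rw [← sum_exp_mul_sinQuot (p := fun c => -p c) (q := fun c => -q c) fun b c hbc m h =>
    hpp b c hbc (-m) (by push_cast; linear_combination -h)]
  refine Finset.sum_congr rfl fun d _ => ?_
  rw [sinQuot_neg, Finset.sum_neg_distrib, Finset.sum_neg_distrib]
  congr 2; ring

end CDO

end

/-! ### The dominant solution in the strip of height 2π -/

noncomputable section

namespace CDO

open Complex Filter Topology MeasureTheory Asymptotics

variable {n : ℕ} {p : Fin (n + 1) → ℂ} {q : Fin n → ℂ}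

/-- The combination of analytic solutions which is dominant on the positive real axis with a pure
exponential expansion in the upper half plane. -/
def dominantSol (p : Fin (n + 1) → ℂ) (q : Fin n → ℂ) (w : ℂ) : ℂ :=
  ∑ d, exp (-(I * Real.pi * (∑ c, p c + ∑ c, q c - p d))) * sinQuot p q d * analyticSol p q d w

/-- `dominantSol` divided by the leading term of its expansion. -/
def dominantRatio (p : Fin (n + 1) → ℂ) (q : Fin n → ℂ) (w : ℂ) : ℂ :=
  dominantSol p q w * exp (-exp w + (∑ c, p c + ∑ c, q c) * w)

lemma differentiable_dominantRatio (hpp : ∀ b c, b ≠ c → ∀ m : ℤ, p b - p c ≠ m)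
    (hpq : ∀ b c, ∀ m : ℤ, p b + q c ≠ m) : Differentiable ℂ (dominantRatio p q) := by
  refine Differentiable.mul ?_ (by fun_prop)
  exact Differentiable.fun_sum fun d _ => (differentiable_analyticSol hpp hpq d).const_mul _

/-- On the ray `arg z = π` the dominant combination is, up to a constant, the recessive
Mellin–Barnes integral. -/
lemma recessiveSol_eq (p : Fin (n + 1) → ℂ) (q : Fin n → ℂ) (w : ℂ) : recessiveSol p q w =
    exp (I * Real.pi * (∑ c, p c + ∑ c, q c)) * dominantSol p q (w + Real.pi * I) := by
  rw [recessiveSol, dominantSol, Finset.mul_sum]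
  refine Finset.sum_congr rfl fun d _ => ?_
  rw [← mul_assoc, ← mul_assoc, ← Complex.exp_add]
  congr 3; ring

lemma analyticSol_add_two_pi (p : Fin (n + 1) → ℂ) (q : Fin n → ℂ) (d : Fin (n + 1)) (w : ℂ) :
    analyticSol p q d (w + 2 * Real.pi * I) = exp (-(2 * Real.pi * I * p d)) * analyticSol p q d w := by
  rw [analyticSol, analyticSol, ← tsum_mul_left]
  refine tsum_congr fun k => ?_
  rw [show (w + 2 * Real.pi * I) * (k - p d) = w * (k - p d) + -(2 * Real.pi * I * p d) +
    k * (2 * Real.pi * I) by ring, Complex.exp_add, Complex.exp_add, Complex.exp_nat_mul_two_pi_mul_I]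
  ring

/-- The monodromy factors `e^{-2πi p d}` and `e^{2πi μ}` convert the coefficients for one half plane
into those for the other. -/
lemma dominantRatio_add_two_pi (p : Fin (n + 1) → ℂ) (q : Fin n → ℂ) (w : ℂ) :
    dominantRatio p q (w + 2 * Real.pi * I) =
      (∑ d, exp (I * Real.pi * (∑ c, p c + ∑ c, q c - p d)) * sinQuot p q d *
        analyticSol p q d w) * exp (-exp w + (∑ c, p c + ∑ c, q c) * w) := by
  set μ := ∑ c, p c + ∑ c, q c with hμ
  have h : exp (-exp (w + 2 * Real.pi * I) + μ * (w + 2 * Real.pi * I)) =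
      exp (2 * Real.pi * I * μ) * exp (-exp w + μ * w) := by
    rw [Complex.exp_periodic w, ← Complex.exp_add]; congr 1; ring
  rw [dominantRatio, ← hμ, h, dominantSol, ← mul_assoc, Finset.sum_mul]
  congr 1
  refine Finset.sum_congr rfl fun d _ => ?_
  rw [analyticSol_add_two_pi]
  have e : exp (-(I * Real.pi * (μ - p d))) * exp (-(2 * Real.pi * I * p d)) *
      exp (2 * Real.pi * I * μ) = exp (I * Real.pi * (μ - p d)) := by
    rw [← Complex.exp_add, ← Complex.exp_add]; congr 1; ring
  rw [← hμ]
  linear_combination sinQuot p q d * analyticSol p q d w * e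

/-- All analytic solutions have the same expansion on the positive axis, so only the sum of the
coefficients matters. It is applied with both choices of sign in the exponentials. -/
lemma exists_norm_dominantRatio_ofReal_sub_le (hpp : ∀ b c, b ≠ c → ∀ m : ℤ, p b - p c ≠ m)
    (hpq : ∀ b c, ∀ m : ℤ, p b + q c ≠ m) {A : Fin (n + 1) → ℂ} (hA : ∑ d, A d = 1) (N : ℕ) :
    ∃ C : ℝ, ∀ x : ℝ, 0 ≤ x →
      ‖(∑ d, A d * analyticSol p q d x) * exp (-exp x + (∑ c, p c + ∑ c, q c) * x) -
        ∑ j ∈ Finset.range N, domCoeff p q j * exp (-j * x)‖ ≤ C * Real.exp (-N * x) := by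
  choose C hC using fun d => exists_norm_analyticSol_ofReal_sub_le hpp hpq d N
  refine ⟨∑ d, ‖A d‖ * C d, fun x hx => ?_⟩
  have h : (∑ d, A d * analyticSol p q d x) * exp (-exp x + (∑ c, p c + ∑ c, q c) * x) -
      ∑ j ∈ Finset.range N, domCoeff p q j * exp (-j * x) =
      ∑ d, A d * (analyticSol p q d x * exp (-exp x + (∑ c, p c + ∑ c, q c) * x) -
        ∑ j ∈ Finset.range N, domCoeff p q j * exp (-j * x)) := by
    simp_rw [mul_sub, Finset.sum_sub_distrib]
    rw [← Finset.sum_mul, hA, one_mul, Finset.sum_mul]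
    simp_rw [mul_assoc]
  rw [h, Finset.sum_mul]
  refine (norm_sum_le _ _).trans (Finset.sum_le_sum fun d _ => ?_)
  rw [norm_mul, mul_assoc]
  exact mul_le_mul_of_nonneg_left (hC d x hx) (norm_nonneg _)

/-- The a priori bound of order one in `z` that Phragmén–Lindelöf requires. -/
lemma exists_norm_dominantRatio_growth (hpp : ∀ b c, b ≠ c → ∀ m : ℤ, p b - p c ≠ m)
    (hpq : ∀ b c, ∀ m : ℤ, p b + q c ≠ m) :
    ∃ C K B : ℝ, 0 ≤ C ∧ 0 ≤ K ∧ 0 ≤ B ∧ ∀ w : ℂ, 0 ≤ w.im → w.im ≤ 2 * Real.pi →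
      ‖dominantRatio p q w‖ ≤ C * Real.exp (K * |w.re| + B * Real.exp w.re) := by
  choose C D hC hD h using exists_norm_analyticSol_le hpp hpq
  set μ := ∑ c, p c + ∑ c, q c with hμ
  set S : Fin (n + 1) → ℝ := fun d => ‖exp (-(I * Real.pi * (μ - p d))) * sinQuot p q d‖
  have hpi := Real.pi_pos
  have hp0 : 0 ≤ ∑ d, ‖p d‖ := Finset.sum_nonneg fun _ _ => norm_nonneg _
  have hD0 : 0 ≤ ∑ d, D d := Finset.sum_nonneg fun d _ => hD d
  refine ⟨(∑ d, S d * C d) * Real.exp ((∑ d, ‖p d‖ + ‖μ‖) * (2 * Real.pi)), ∑ d, ‖p d‖ + ‖μ‖,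
    ∑ d, D d + 1, mul_nonneg (Finset.sum_nonneg fun d _ => mul_nonneg (norm_nonneg _) (hC d))
      (Real.exp_pos _).le, by positivity, by positivity, fun w h0 h1 => ?_⟩
  have him : |w.im| ≤ 2 * Real.pi := by rwa [abs_of_nonneg h0]
  have hF : ‖dominantSol p q w‖ ≤ (∑ d, S d * C d) *
      Real.exp ((∑ d, ‖p d‖) * (|w.re| + 2 * Real.pi)) * Real.exp ((∑ d, D d) * Real.exp w.re) := by
    rw [dominantSol, mul_assoc, Finset.sum_mul]
    refine (norm_sum_le _ _).trans (Finset.sum_le_sum fun d _ => ?_)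
    rw [norm_mul, mul_assoc (S d)]
    refine mul_le_mul_of_nonneg_left ((h d w).trans ?_) (norm_nonneg _)
    rw [mul_assoc]
    refine mul_le_mul_of_nonneg_left (mul_le_mul ?_ ?_ (Real.exp_pos _).le (Real.exp_pos _).le)
      (hC d)
    · apply Real.exp_le_exp.2
      gcongr
      exact Finset.single_le_sum (f := fun d => ‖p d‖) (fun _ _ => norm_nonneg _)
        (Finset.mem_univ d)
    · apply Real.exp_le_exp.2
      gcongr
      exact Finset.single_le_sum (f := D) (fun d _ => hD d) (Finset.mem_univ d)
  have hE : ‖exp (-exp w + μ * w)‖ ≤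
      Real.exp (Real.exp w.re + ‖μ‖ * (|w.re| + 2 * Real.pi)) := by
    rw [Complex.norm_exp]
    apply Real.exp_le_exp.2
    rw [add_re, neg_re]
    refine add_le_add ?_ ?_
    · have h2 := (Complex.abs_re_le_norm (exp w))
      rw [Complex.norm_exp] at h2
      linarith [neg_abs_le (exp w).re]
    · refine (Complex.re_le_norm _).trans ?_
      rw [norm_mul]
      gcongr
      exact (Complex.norm_le_abs_re_add_abs_im w).trans (by gcongr)
  rw [dominantRatio, norm_mul, ← hμ]
  refine (mul_le_mul hF hE (norm_nonneg _) ((norm_nonneg _).trans hF)).trans (le_of_eq ?_)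
  rw [mul_assoc, mul_assoc, mul_assoc, ← Real.exp_add, ← Real.exp_add, ← Real.exp_add]
  congr 2; ring

/-- Exponential bounds on the line of height `θ`, to the right. -/
def ExpBoundAt (f : ℂ → ℂ) (θ : ℝ) : Prop :=
  ∃ C K : ℝ, 0 ≤ C ∧ 0 ≤ K ∧ ∀ x : ℝ, 0 ≤ x → ‖f (x + θ * I)‖ ≤ C * Real.exp (K * x)

/-- Translation by `πi` changes `e^{-z}` into `e^{z}`, so the growth of the ratio is that of `e^{z}`
times the recessive solution, up to exponentials of `‖w‖`. -/
lemma norm_dominantRatio_add_pi (p : Fin (n + 1) → ℂ) (q : Fin n → ℂ) (w : ℂ) :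
    ‖dominantRatio p q (w + Real.pi * I)‖ ≤ ‖recessiveSol p q w‖ * Real.exp (exp w).re *
      Real.exp ((‖∑ c, p c + ∑ c, q c‖) * (‖w‖ + 2 * Real.pi)) := by
  set μ := ∑ c, p c + ∑ c, q c with hμ
  have h : dominantRatio p q (w + Real.pi * I) =
      recessiveSol p q w * (exp (exp w) * exp (μ * w)) := by
    rw [recessiveSol_eq, dominantRatio, ← hμ, Complex.exp_add w, Complex.exp_pi_mul_I,
      mul_comm (exp (I * Real.pi * μ)), mul_assoc, ← Complex.exp_add, ← Complex.exp_add]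
    congr 2; ring
  rw [h, norm_mul, norm_mul, ← mul_assoc, Complex.norm_exp]
  refine mul_le_mul_of_nonneg_left ?_ (by positivity)
  rw [Complex.norm_exp]
  refine Real.exp_le_exp.2 ((Complex.re_le_norm _).trans ?_)
  rw [norm_mul]
  have := Real.pi_pos
  gcongr
  linarith

/-- On the two imaginary rays `|e^{z}| = 1`, and the Mellin–Barnes bound for the recessive solution
suffices. -/
lemma expBoundAt_of_re_exp_eq_zero (hpp : ∀ b c, b ≠ c → ∀ m : ℤ, p b - p c ≠ m)
    (hpq : ∀ b c, ∀ m : ℤ, p b + q c ≠ m) {θ : ℝ} (hθ : |θ| ≤ Real.pi / 2)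
    (hθ0 : Real.cos θ = 0) : ExpBoundAt (dominantRatio p q) (θ + Real.pi) := by
  obtain ⟨C, K, hC, hK, h⟩ := exists_norm_recessiveSol_le hpp hpq
  set M := ‖∑ c, p c + ∑ c, q c‖ with hM
  refine ⟨C * Real.exp (M * (Real.pi / 2 + 2 * Real.pi)), K + M, by positivity, by positivity,
    fun x hx => ?_⟩
  have h1 := norm_dominantRatio_add_pi p q (x + θ * I)
  have h2 := h (x + θ * I) (by simpa using hθ) (by simpa using hx)
  have h3 : (exp (x + θ * I)).re = 0 := by rw [Complex.exp_re]; simp [hθ0]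
  have h4 : ‖(x : ℂ) + θ * I‖ ≤ x + Real.pi / 2 := by
    refine (norm_add_le _ _).trans (add_le_add ?_ ?_)
    · rw [Complex.norm_real, Real.norm_of_nonneg hx]
    · rw [norm_mul, Complex.norm_I, mul_one, Complex.norm_real]; exact hθ
  rw [h3, Real.exp_zero, mul_one] at h1
  simp only [add_re, ofReal_re, mul_re, I_re, mul_zero, ofReal_im, I_im, mul_one, sub_self,
    add_zero] at h2
  rw [show (x : ℂ) + ((θ + Real.pi : ℝ) : ℂ) * I = x + θ * I + Real.pi * I by push_cast; ring]
  refine h1.trans ?_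
  calc _ ≤ C * Real.exp (K * x) * Real.exp (M * (x + Real.pi / 2 + 2 * Real.pi)) := by gcongr
    _ = _ := by
      rw [mul_assoc, mul_assoc, ← Real.exp_add, ← Real.exp_add]; congr 2; ring

/-- The decay `e^{-e^x}` of the recessive solution exactly compensates the growth of `e^{z}`. -/
lemma expBoundAt_pi (hpp : ∀ b c, b ≠ c → ∀ m : ℤ, p b - p c ≠ m)
    (hpq : ∀ b c, ∀ m : ℤ, p b + q c ≠ m) : ExpBoundAt (dominantRatio p q) Real.pi := by
  obtain ⟨C, K, hC, hK, h⟩ := exists_norm_recessiveSol_ofReal_le hpp hpq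
  set M := ‖∑ c, p c + ∑ c, q c‖ with hM
  refine ⟨C * Real.exp (M * (2 * Real.pi)), K + M, by positivity, by positivity, fun x hx => ?_⟩
  have h1 := norm_dominantRatio_add_pi p q x
  have h2 := h x hx
  rw [← Complex.ofReal_exp, Complex.ofReal_re, Complex.norm_real, Real.norm_of_nonneg hx] at h1
  refine h1.trans ?_
  calc _ ≤ C * Real.exp (K * x) * Real.exp (-Real.exp x) * Real.exp (Real.exp x) *
        Real.exp (M * (x + 2 * Real.pi)) := by gcongr
    _ = _ := by
      simp only [mul_assoc, ← Real.exp_add]; congr 2; ring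

/-- A strip of height `π/2` admits growth `e^{B e^{c Re w}}` with `c < 2`; the available bound has
`c = 1`. -/
lemma ExpBoundAt.exists_strip {f : ℂ → ℂ} (hf : Differentiable ℂ f) {a b C₀ K₀ B : ℝ}
    (hab : b = a + Real.pi / 2) (hB : 0 ≤ B) (hK₀ : 0 ≤ K₀)
    (hgrowth : ∀ w : ℂ, a ≤ w.im → w.im ≤ b →
      ‖f w‖ ≤ C₀ * Real.exp (K₀ * |w.re| + B * Real.exp w.re))
    (ha : ExpBoundAt f a) (hb : ExpBoundAt f b) :
    ∃ C K : ℝ, 0 ≤ C ∧ 0 ≤ K ∧ ∀ w : ℂ, 0 ≤ w.re → a ≤ w.im → w.im ≤ b →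
      ‖f w‖ ≤ C * Real.exp (K * w.re) := by
  obtain ⟨C₁, K₁, hC₁, hK₁, h₁⟩ := ha
  obtain ⟨C₂, K₂, hC₂, hK₂, h₂⟩ := hb
  have hpi := Real.pi_pos
  have key : ∀ C K x : ℝ, 0 ≤ C → 0 ≤ K → 0 ≤ x → C ≤ C₁ + C₂ → K ≤ K₁ + K₂ →
      C * Real.exp (K * x) ≤ (C₁ + C₂) * Real.exp ((K₁ + K₂) * x) := by
    intro C K x h1 h2 h3 h4 h5
    gcongr
  obtain ⟨C, hC⟩ := exists_norm_le_of_halfStrip hf (a := a) (b := b) (C := C₁ + C₂)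
    (K := K₁ + K₂) (c := 1) (by linarith) (by linarith) zero_le_one
    (by rw [hab, lt_div_iff₀ (by linarith)]; linarith) hB hK₀ (by simpa using hgrowth)
    (fun x hx => (h₁ x hx).trans (key _ _ _ hC₁ hK₁ hx (by linarith) (by linarith)))
    (fun x hx => (h₂ x hx).trans (key _ _ _ hC₂ hK₂ hx (by linarith) (by linarith)))
  refine ⟨|C|, K₁ + K₂, abs_nonneg _, by positivity, fun w h0 h1 h2 => (hC w h0 h1 h2).trans ?_⟩
  gcongr
  exact le_abs_self C

/-- Bounds on the five lines at heights `0, π/2, π, 3π/2, 2π` are interpolated on the four strips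
between them. A strip of height `2π` would only allow growth with `c < 1/2`, hence the subdivision.
-/
theorem exists_norm_dominantRatio_le (hpp : ∀ b c, b ≠ c → ∀ m : ℤ, p b - p c ≠ m)
    (hpq : ∀ b c, ∀ m : ℤ, p b + q c ≠ m) :
    ∃ C K : ℝ, 0 ≤ C ∧ 0 ≤ K ∧ ∀ w : ℂ, 0 ≤ w.re → 0 ≤ w.im → w.im ≤ 2 * Real.pi →
      ‖dominantRatio p q w‖ ≤ C * Real.exp (K * w.re) := by
  obtain ⟨C₀, K₀, B, hC₀, hK₀, hB, hg⟩ := exists_norm_dominantRatio_growth hpp hpq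
  have hd := differentiable_dominantRatio hpp hpq
  have hpi := Real.pi_pos
  have b0 : ExpBoundAt (dominantRatio p q) 0 := by
    obtain ⟨C, hC⟩ := exists_norm_dominantRatio_ofReal_sub_le hpp hpq (sum_exp_mul_sinQuot hpp) 0
    refine ⟨|C|, 0, abs_nonneg _, le_rfl, fun x hx => ?_⟩
    have := hC x hx
    simp only [Finset.range_zero, Finset.sum_empty, sub_zero, Nat.cast_zero, neg_zero, zero_mul,
      Real.exp_zero, mul_one] at this
    simpa [dominantRatio, dominantSol] using this.trans (le_abs_self C)
  have b4 : ExpBoundAt (dominantRatio p q) (2 * Real.pi) := by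
    obtain ⟨C, hC⟩ := exists_norm_dominantRatio_ofReal_sub_le hpp hpq (sum_exp_mul_sinQuot' hpp) 0
    refine ⟨|C|, 0, abs_nonneg _, le_rfl, fun x hx => ?_⟩
    have := hC x hx
    simp only [Finset.range_zero, Finset.sum_empty, sub_zero, Nat.cast_zero, neg_zero, zero_mul,
      Real.exp_zero, mul_one] at this ⊢
    rw [show (x : ℂ) + ((2 * Real.pi : ℝ) : ℂ) * I = x + 2 * Real.pi * I by push_cast; ring,
      dominantRatio_add_two_pi]
    exact this.trans (le_abs_self C)
  have b1 := expBoundAt_of_re_exp_eq_zero hpp hpq (θ := -(Real.pi / 2))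
    (by rw [abs_neg, abs_of_pos (by linarith)]) (by simp)
  have b3 := expBoundAt_of_re_exp_eq_zero hpp hpq (θ := Real.pi / 2)
    (by rw [abs_of_pos (by linarith)]) (by simp)
  have b2 := expBoundAt_pi hpp hpq
  obtain ⟨C₁, K₁, hC₁, hK₁, h₁⟩ := ExpBoundAt.exists_strip hd (by ring) hB hK₀
    (fun w h0 h1 => hg w h0 (by linarith)) b0 b1
  obtain ⟨C₂, K₂, hC₂, hK₂, h₂⟩ := ExpBoundAt.exists_strip hd (by ring) hB hK₀
    (fun w h0 h1 => hg w (by linarith) (by linarith)) b1 b2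
  obtain ⟨C₃, K₃, hC₃, hK₃, h₃⟩ := ExpBoundAt.exists_strip hd (by ring) hB hK₀
    (fun w h0 h1 => hg w (by linarith) (by linarith)) b2 b3
  obtain ⟨C₄, K₄, hC₄, hK₄, h₄⟩ := ExpBoundAt.exists_strip hd (by ring) hB hK₀
    (fun w h0 h1 => hg w (by linarith) (by linarith)) b3 b4
  have key : ∀ C K x : ℝ, 0 ≤ C → 0 ≤ K → 0 ≤ x → C ≤ C₁ + C₂ + C₃ + C₄ →
      K ≤ K₁ + K₂ + K₃ + K₄ →
      C * Real.exp (K * x) ≤ (C₁ + C₂ + C₃ + C₄) * Real.exp ((K₁ + K₂ + K₃ + K₄) * x) := by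
    intro C K x h1 h2 h3 h4 h5
    gcongr
  refine ⟨C₁ + C₂ + C₃ + C₄, K₁ + K₂ + K₃ + K₄, by positivity, by positivity, fun w h0 h1 h2 => ?_⟩
  rcases le_total w.im Real.pi with h | h
  · rcases le_total w.im (-(Real.pi / 2) + Real.pi) with h' | h'
    · exact (h₁ w h0 h1 h').trans (key _ _ _ hC₁ hK₁ h0 (by linarith) (by linarith))
    · exact (h₂ w h0 h' h).trans (key _ _ _ hC₂ hK₂ h0 (by linarith) (by linarith))
  · rcases le_total w.im (Real.pi / 2 + Real.pi) with h' | h'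
    · exact (h₃ w h0 h h').trans (key _ _ _ hC₃ hK₃ h0 (by linarith) (by linarith))
    · exact (h₄ w h0 h' h2).trans (key _ _ _ hC₄ hK₄ h0 (by linarith) (by linarith))

/-- The asymptotic expansion of the dominant solution, in terms of the logarithm `w` of the
variable. -/
theorem exists_norm_dominantRatio_sub_le (hpp : ∀ b c, b ≠ c → ∀ m : ℤ, p b - p c ≠ m)
    (hpq : ∀ b c, ∀ m : ℤ, p b + q c ≠ m) (N : ℕ) :
    ∃ C : ℝ, ∀ w : ℂ, 0 ≤ w.re → 0 ≤ w.im → w.im ≤ 2 * Real.pi →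
      ‖dominantRatio p q w - ∑ j ∈ Finset.range N, domCoeff p q j * exp (-j * w)‖ ≤
        C * Real.exp (-N * w.re) := by
  obtain ⟨C₀, K₀, B, hC₀, hK₀, hB, hg⟩ := exists_norm_dominantRatio_growth hpp hpq
  obtain ⟨C₁, K₁, hC₁, hK₁, h₁⟩ := exists_norm_dominantRatio_le hpp hpq
  obtain ⟨C₂, h₂⟩ := exists_norm_dominantRatio_ofReal_sub_le hpp hpq (sum_exp_mul_sinQuot hpp) N
  obtain ⟨C₃, h₃⟩ := exists_norm_dominantRatio_ofReal_sub_le hpp hpq (sum_exp_mul_sinQuot' hpp) N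
  have hpi := Real.pi_pos
  set S := ∑ j ∈ Finset.range N, ‖domCoeff p q j‖ with hS
  have hS0 : 0 ≤ S := Finset.sum_nonneg fun _ _ => norm_nonneg _
  have hsum : ∀ w : ℂ, ‖∑ j ∈ Finset.range N, domCoeff p q j * exp (-j * w)‖ ≤
      S * Real.exp (N * |w.re|) := by
    intro w
    rw [hS, Finset.sum_mul]
    refine (norm_sum_le _ _).trans (Finset.sum_le_sum fun j hj => ?_)
    rw [norm_mul]
    refine mul_le_mul_of_nonneg_left ?_ (norm_nonneg _)
    rw [Complex.norm_exp]
    apply Real.exp_le_exp.2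
    have h1 : (-(j : ℂ) * w).re = j * -w.re := by simp
    have h2 : (j : ℝ) ≤ N := by exact_mod_cast (Finset.mem_range.1 hj).le
    rw [h1]
    refine (mul_le_mul_of_nonneg_left (neg_le_abs w.re) (Nat.cast_nonneg j)).trans ?_
    gcongr
  -- The ratio is now known to grow at most exponentially in `|Re w|`, so `c = 0` and `B = 0` are
  -- admissible and the whole strip of height `2π` can be treated at once. On both edges the
  -- expansion on the positive axis gives the rate `K = -N`.
  obtain ⟨C, hC⟩ := exists_norm_le_of_halfStrip
    (f := fun w => dominantRatio p q w - ∑ j ∈ Finset.range N, domCoeff p q j * exp (-j * w))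
    ((differentiable_dominantRatio hpp hpq).sub (by fun_prop)) (a := 0) (b := 2 * Real.pi)
    (C := |C₂| + |C₃|) (K := -N) (C₀ := C₁ + C₀ * Real.exp B + S) (K₀ := K₁ + K₀ + N) (B := 0)
    (c := 0) (by positivity) (by linarith) le_rfl (by rw [sub_zero]; positivity) le_rfl
    (by positivity)
    (fun w h0 h1 => by
      rw [zero_mul, add_zero]
      have hN : (0 : ℝ) ≤ N := Nat.cast_nonneg N
      have e1 : ‖dominantRatio p q w‖ ≤ (C₁ + C₀ * Real.exp B) *
          Real.exp ((K₁ + K₀ + N) * |w.re|) := by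
        rcases le_total 0 w.re with h | h
        · refine (h₁ w h h0 h1).trans ?_
          rw [abs_of_nonneg h]
          have : 0 ≤ C₀ * Real.exp B := by positivity
          gcongr <;> linarith
        · refine (hg w h0 h1).trans ?_
          have h3 : B * Real.exp w.re ≤ B :=
            mul_le_of_le_one_right hB (Real.exp_le_one_iff.2 h)
          calc _ ≤ C₀ * Real.exp ((K₁ + K₀ + N) * |w.re| + B) := by
                gcongr
                linarith
            _ = C₀ * Real.exp B * Real.exp ((K₁ + K₀ + N) * |w.re|) := by
                rw [add_comm, Real.exp_add]; ring
            _ ≤ _ := by gcongr; linarith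
      have e2 := hsum w
      calc _ ≤ _ := norm_sub_le _ _
        _ ≤ (C₁ + C₀ * Real.exp B) * Real.exp ((K₁ + K₀ + N) * |w.re|) +
            S * Real.exp ((K₁ + K₀ + N) * |w.re|) := by
            refine add_le_add e1 (e2.trans ?_)
            gcongr
            linarith
        _ = _ := by ring)
    (fun x hx => by
      have := h₂ x hx
      simp only [ofReal_zero, zero_mul, add_zero]
      refine this.trans ?_
      gcongr
      linarith [le_abs_self C₂, abs_nonneg C₃])
    (fun x hx => by
      have := h₃ x hx
      rw [show (x : ℂ) + ((2 * Real.pi : ℝ) : ℂ) * I = x + 2 * Real.pi * I by push_cast; ring,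
        dominantRatio_add_two_pi]
      have he : ∀ j : ℕ, exp (-(j : ℂ) * (x + 2 * Real.pi * I)) = exp (-j * x) := by
        intro j
        rw [show -(j : ℂ) * (x + 2 * Real.pi * I) = -j * x - j * (2 * Real.pi * I) by ring,
          Complex.exp_sub, Complex.exp_nat_mul_two_pi_mul_I, div_one]
      simp_rw [he]
      refine this.trans ?_
      gcongr
      linarith [le_abs_self C₃, abs_nonneg C₂])
  exact ⟨C, fun w h0 h1 h2 => hC w h0 h1 h2⟩

end CDO

end

/-! ### Translation between the original notation and the normalised parameters -/

noncomputable section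

namespace CDO

open Complex Filter Topology MeasureTheory Asymptotics

variable {n : ℕ}

lemma scale_ne_zero {hbar Λ : ℂ} (hhbar : hbar ≠ 0) (hΛ : Λ ≠ 0) : scale n hbar Λ ≠ 0 :=
  mul_ne_zero hhbar (pow_ne_zero _ (neg_ne_zero.2 hΛ))

lemma eventually_one_le_norm_div {s : ℂ} (hs : s ≠ 0) :
    ∀ᶠ x : ℂ in Bornology.cobounded ℂ, 1 ≤ ‖x / s‖ := by
  filter_upwards [tendsto_norm_cobounded_atTop.eventually_ge_atTop ‖s‖] with x hx
  rwa [norm_div, le_div_iff₀ (norm_pos_iff.2 hs), one_mul]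

/-- For an asymptotic expansion it is enough to have arbitrarily good error terms for some of the
partial sums. -/
lemma FormalSol.isAsymptoticTo_of_forall_exists {ψ : FormalSol} {l : Filter ℂ} {f : ℂ → ℂ}
    (hl : ∀ᶠ x in l, 1 ≤ ‖x / ψ.scale‖)
    (h : ∀ N : ℕ, ∃ K : ℕ, N ≤ K ∧ ∃ C : ℝ, ∀ᶠ x in l,
      ‖f x - ψ.prefactor x * ∑ k ∈ Finset.range K, ψ.coeff k * ((x / ψ.scale) ^ k)⁻¹‖ ≤
        C * ‖ψ.prefactor x * ((x / ψ.scale) ^ N)⁻¹‖) : ψ.IsAsymptoticTo l f := by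
  intro N
  obtain ⟨K, hNK, C, hC⟩ := h N
  obtain ⟨m, rfl⟩ := Nat.exists_eq_add_of_le hNK
  have h1 := IsBigO.of_bound C hC
  have h2 : (fun x => ψ.prefactor x * ∑ i ∈ Finset.range m,
      ψ.coeff (N + i) * ((x / ψ.scale) ^ (N + i))⁻¹) =O[l]
      fun x => ψ.prefactor x * ((x / ψ.scale) ^ N)⁻¹ := by
    refine (isBigO_refl _ _).mul (IsBigO.fun_sum fun i _ => IsBigO.const_mul_left ?_ _)
    refine IsBigO.of_bound 1 ?_
    filter_upwards [hl] with x hx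
    rw [norm_inv, norm_inv, norm_pow, norm_pow, one_mul]
    have : 0 < ‖x / ψ.scale‖ := by linarith
    gcongr
    · exact Nat.le_add_right N i
  refine (h1.add h2).congr_left fun x => ?_
  rw [Finset.sum_range_add]
  ring

variable (P : Fin (n + 1) → ℂ) (Q : Fin n → ℂ) (hbar Λ : ℂ) (a : Fin (n + 1))

/-- The parameters `P / ħ`. -/
def normP (c : Fin (n + 1)) : ℂ := P c / hbar

/-- The parameters `Q / ħ`, shifted by the Kronecker symbols. -/
def normQ (c : Fin n) : ℂ := Q c / hbar + delta a c

/-- The sign `(-1) ^ δ`. -/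
def deltaSign (c : Fin n) : ℂ := if c.castSucc = a then -1 else 1

variable {P Q hbar Λ a}

lemma deltaSign_mul_self (c : Fin n) : deltaSign a c * deltaSign a c = 1 := by
  rw [deltaSign]; split_ifs <;> norm_num

lemma deltaSign_ne_zero (c : Fin n) : deltaSign a c ≠ 0 := by
  rw [deltaSign]; split_ifs <;> norm_num

lemma prod_deltaSign_mul_self : (∏ c, deltaSign a c) * ∏ c, deltaSign a c = 1 := by
  rw [← Finset.prod_mul_distrib]
  exact Finset.prod_eq_one fun c _ => deltaSign_mul_self c

lemma sin_sub_pi_mul_delta (u : ℂ) (c : Fin n) :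
    sin (Real.pi * (u - delta a c)) = deltaSign a c * sin (Real.pi * u) := by
  rw [delta, deltaSign]
  split_ifs
  · rw [mul_sub, mul_one, Complex.sin_sub_pi]; ring
  · simp

lemma sin_add_pi_mul_delta (u : ℂ) (c : Fin n) :
    sin (Real.pi * (u + delta a c)) = deltaSign a c * sin (Real.pi * u) := by
  rw [delta, deltaSign]
  split_ifs
  · rw [mul_add, mul_one, Complex.sin_add_pi]; ring
  · simp

lemma exp_pi_mul_delta (c : Fin n) : exp (I * Real.pi * delta a c) = deltaSign a c := by
  rw [delta, deltaSign]
  split_ifs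
  · rw [mul_one, mul_comm, Complex.exp_pi_mul_I]
  · simp

lemma exists_int_eq_delta (c : Fin n) : ∃ m : ℤ, delta a c = m := by
  rw [delta]
  split_ifs
  · exact ⟨1, by simp⟩
  · exact ⟨0, by simp⟩

lemma sum_delta : ∑ c, delta a c = if a = Fin.last n then 0 else 1 := by
  split_ifs with h
  · subst h
    exact Finset.sum_eq_zero fun c _ => by simp [delta, (Fin.castSucc_lt_last c).ne]
  · obtain ⟨b, rfl⟩ := Fin.exists_castSucc_eq.2 h
    simp [delta, Fin.castSucc_inj]

lemma normP_sub_ne (hhbar : hbar ≠ 0)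
    (hPP : ∀ b c : Fin (n + 1), b ≠ c → ∀ m : ℤ, P b - P c ≠ hbar * m)
    (b c : Fin (n + 1)) (hbc : b ≠ c) (m : ℤ) : normP P hbar b - normP P hbar c ≠ m := by
  intro h
  refine hPP b c hbc m ?_
  rw [normP, normP] at h
  rw [← h]; field_simp

lemma normQ_sub_ne (hhbar : hbar ≠ 0)
    (hQQ : ∀ b c : Fin n, b ≠ c → ∀ m : ℤ, Q b - Q c ≠ hbar * m)
    (b c : Fin n) (hbc : b ≠ c) (m : ℤ) : normQ Q hbar a b - normQ Q hbar a c ≠ m := by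
  intro h
  obtain ⟨i, hi⟩ := exists_int_eq_delta (a := a) b
  obtain ⟨j, hj⟩ := exists_int_eq_delta (a := a) c
  refine hQQ b c hbc (m - i + j) ?_
  rw [normQ, normQ, hi, hj] at h
  push_cast
  rw [← h]; field_simp; ring

lemma normP_add_normQ_ne (hhbar : hbar ≠ 0)
    (hPQ : ∀ (b : Fin (n + 1)) (c : Fin n) (m : ℤ), P b + Q c ≠ hbar * m)
    (b : Fin (n + 1)) (c : Fin n) (m : ℤ) : normP P hbar b + normQ Q hbar a c ≠ m := by
  intro h
  obtain ⟨j, hj⟩ := exists_int_eq_delta (a := a) c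
  refine hPQ b c (m - j) ?_
  rw [normP, normQ, hj] at h
  push_cast
  rw [← h]; field_simp; ring

/-- The Gamma prefactors combine with the rising factorials into shifted Gamma functions, and `k!`
is the factor of index `d` in the denominator of `gammaQuot`. -/
lemma chi_eq_analyticSol
    (hpp : ∀ b c, b ≠ c → ∀ m : ℤ, normP P hbar b - normP P hbar c ≠ m)
    (hpq : ∀ b c, ∀ m : ℤ, normP P hbar b + normQ Q hbar a c ≠ m) (d : Fin (n + 1)) {x : ℂ}
    (hx : x / scale n hbar Λ ≠ 0) : chi P Q hbar Λ a d x =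
      analyticSol (normP P hbar) (normQ Q hbar a) d (log (x / scale n hbar Λ)) := by
  set z := x / scale n hbar Λ with hz
  rw [chi, ← hz, analyticSol, hypF, ← tsum_mul_left]
  refine tsum_congr fun k => ?_
  have hα : ∀ c, 1 - (P d + Q c) / hbar - delta a c = 1 - normQ Q hbar a c - normP P hbar d := by
    intro c; rw [normP, normQ]; ring
  have hα' : ∀ c, 1 - delta a c - (P d + Q c) / hbar = 1 - normQ Q hbar a c - normP P hbar d := by
    intro c; rw [normP, normQ]; ring
  have hβ : ∀ c, 1 - (P d - P c) / hbar = 1 + normP P hbar c - normP P hbar d := by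
    intro c; rw [normP, normP]; ring
  simp only [hα, hα', hβ]
  have hexp : exp (log z * (k - normP P hbar d)) = z ^ (-P d / hbar) * z ^ k := by
    rw [show log z * (k - normP P hbar d) = log z * (-P d / hbar) + k * log z by rw [normP]; ring,
      Complex.exp_add, Complex.exp_nat_mul, Complex.exp_log hx, cpow_def_of_ne_zero hx]
  have hnum : ∀ c, Gamma (1 - normQ Q hbar a c - (normP P hbar d - k)) =
      Gamma (1 - normQ Q hbar a c - normP P hbar d) *
        rising (1 - normQ Q hbar a c - normP P hbar d) k := by
    intro c
    rw [← Gamma_add_natCast fun i _ => one_sub_sub_add_natCast_ne_zero hpq c d i]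
    congr 1; ring
  have hden : ∀ c, Gamma (1 + normP P hbar c - (normP P hbar d - k)) =
      Gamma (1 + normP P hbar c - normP P hbar d) *
        rising (1 + normP P hbar c - normP P hbar d) k := by
    intro c
    rw [← Gamma_add_natCast fun i _ => one_add_sub_add_natCast_ne_zero hpp c d i]
    congr 1; ring
  have hd : Gamma (1 + normP P hbar d - (normP P hbar d - k)) = k.factorial := by
    rw [← Complex.Gamma_nat_eq_factorial]; congr 1; ring
  rw [hexp, gammaQuot, prod_eq_mul_prod_subtype_ne
    (fun c => Gamma (1 + normP P hbar c - (normP P hbar d - k))) d, hd]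
  simp only [hnum, hden, Finset.prod_mul_distrib]
  rw [hypCoeff]
  simp only [rising]
  ring

/-- For `|Im w| ≤ π` the moduli `|z^s|` and `|z|^{Re s}` agree up to a constant factor. -/
lemma norm_exp_mul_le {w s : ℂ} (hw : |w.im| ≤ Real.pi) :
    Real.exp (w.re * s.re) ≤ Real.exp (Real.pi * |s.im|) * ‖exp (w * s)‖ := by
  rw [Complex.norm_exp, ← Real.exp_add, mul_re]
  apply Real.exp_le_exp.2
  have h1 : w.im * s.im ≤ Real.pi * |s.im| := by
    refine (le_abs_self _).trans ?_
    rw [abs_mul]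
    gcongr
  linarith

/-- Reflection for the `n + 1` Gamma functions of the numerator and the `n - 1` of the denominator;
the difference in number accounts for `π²`. -/
lemma algCoeff_eq {p : Fin (n + 1) → ℂ} {q : Fin n → ℂ}
    (hqq : ∀ b c, b ≠ c → ∀ m : ℤ, q b - q c ≠ m) (hpq : ∀ b c, ∀ m : ℤ, p b + q c ≠ m)
    (b : Fin n) (k : ℕ) :
    (∏ c : {c // c ≠ b}, Gamma (q b - q c)) / (∏ c, Gamma (q b + p c)) *
      (hypCoeff (fun c => 1 - q b - p c) (fun c : {c // c ≠ b} => 1 + q c - q b) k * (-1) ^ k) =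
    1 / (Real.pi : ℂ) ^ 2 * ((∏ c, sin (Real.pi * (p c + q b))) /
      ∏ c : {c // c ≠ b}, sin (Real.pi * (q b - q c))) * algCoeff p q b k := by
  have hpi : (Real.pi : ℂ) ≠ 0 := by exact_mod_cast Real.pi_ne_zero
  have h1 : ∀ c, Gamma (1 - q b - p c + k) = Gamma (1 - q b - p c) * rising (1 - q b - p c) k :=
    fun c => Gamma_add_natCast fun i _ h =>
      hpq c b (1 + i) (by push_cast; linear_combination -h)
  have h2 : ∀ c : {c // c ≠ b}, Gamma (1 + q c - q b + k) =
      Gamma (1 + q c - q b) * rising (1 + q c - q b) k := fun c => Gamma_add_natCast fun i _ h =>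
    hqq b c (Ne.symm c.2) (1 + i) (by push_cast; linear_combination -h)
  have h3 : ∀ c, Gamma (1 - q b - p c) =
      Real.pi / (Gamma (q b + p c) * sin (Real.pi * (p c + q b))) := by
    intro c
    have hs := sin_pi_mul_ne_zero (hpq c b)
    have hG : Gamma (q b + p c) ≠ 0 := Gamma_ne_zero_of_ne_int fun m h =>
      hpq c b m (by linear_combination h)
    have e := Complex.Gamma_mul_Gamma_one_sub (q b + p c)
    rw [add_comm (q b) (p c)] at e hG ⊢
    rw [eq_div_iff (mul_ne_zero hG hs), ← mul_assoc, mul_comm (Gamma _) (Gamma (p c + q b)),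
      show 1 - q b - p c = 1 - (p c + q b) by ring, e]
    field_simp
  have h4 : ∀ c : {c // c ≠ b}, Gamma (1 + q c - q b) =
      Real.pi / (Gamma (q b - q c) * sin (Real.pi * (q b - q c))) := by
    intro c
    have hne := hqq b c (Ne.symm c.2)
    have hs := sin_pi_mul_ne_zero hne
    have hG := Gamma_ne_zero_of_ne_int hne
    have e := Complex.Gamma_mul_Gamma_one_sub (q b - q c)
    rw [eq_div_iff (mul_ne_zero hG hs), ← mul_assoc, mul_comm (Gamma _) (Gamma (q b - q c)),
      show 1 + q c - q b = 1 - (q b - q c) by ring, e]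
    field_simp
  have hcard : (Real.pi : ℂ) * ∏ _c : {c : Fin n // c ≠ b}, (Real.pi : ℂ) = Real.pi ^ n := by
    rw [← prod_eq_mul_prod_subtype_ne (fun _ => (Real.pi : ℂ)) b]; simp
  have hS : ∏ c, sin (Real.pi * (p c + q b)) ≠ 0 :=
    Finset.prod_ne_zero_iff.2 fun c _ => sin_pi_mul_ne_zero (hpq c b)
  have hS' : ∏ c : {c // c ≠ b}, sin (Real.pi * (q b - q c)) ≠ 0 :=
    Finset.prod_ne_zero_iff.2 fun c _ => sin_pi_mul_ne_zero (hqq b c (Ne.symm c.2))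
  have hT : ∏ _c : {c : Fin n // c ≠ b}, (Real.pi : ℂ) ≠ 0 :=
    Finset.prod_ne_zero_iff.2 fun _ _ => hpi
  rw [algCoeff, hypCoeff, Finset.prod_inv_distrib]
  simp only [h1, h2, Finset.prod_mul_distrib, h3, h4, Finset.prod_div_distrib, Finset.prod_const,
    Finset.card_univ, Fintype.card_fin] at hcard hT ⊢
  simp only [rising]
  rw [pow_succ (Real.pi : ℂ) n, ← hcard]
  field_simp

end CDO

end

/-! ### Connection coefficients and the three expansions -/

noncomputable section

namespace CDO

open Complex Filter Topology MeasureTheory Asymptotics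

variable {n : ℕ} {P : Fin (n + 1) → ℂ} {Q : Fin n → ℂ} {hbar Λ : ℂ} {a : Fin (n + 1)}

lemma sin_P_add_Q (c : Fin (n + 1)) (d : Fin n) : sin (Real.pi * (P c + Q d) / hbar) =
    deltaSign a d * sin (Real.pi * (normP P hbar c + normQ Q hbar a d)) := by
  rw [← sin_sub_pi_mul_delta]
  congr 1
  rw [normP, normQ]; ring

lemma sin_P_sub_P (c d : Fin (n + 1)) : sin (Real.pi * (P c - P d) / hbar) =
    sin (Real.pi * (normP P hbar c - normP P hbar d)) := by
  congr 1
  rw [normP, normP]; ring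

lemma sin_Q_sub_Q (c d : Fin n) : sin (Real.pi * (Q c - Q d) / hbar) =
    deltaSign a c * deltaSign a d *
      sin (Real.pi * (normQ Q hbar a c - normQ Q hbar a d)) := by
  rw [mul_assoc, ← sin_add_pi_mul_delta, ← sin_sub_pi_mul_delta]
  congr 1
  rw [normQ, normQ]; ring

lemma prod_sin_div_prod_sin (d : Fin (n + 1)) :
    (∏ c : Fin n, sin (Real.pi * (P d + Q c) / hbar)) /
      (∏ c : {c : Fin (n + 1) // c ≠ d}, sin (Real.pi * (P d - P c) / hbar)) =
    (∏ c, deltaSign a c) * sinQuot (normP P hbar) (normQ Q hbar a) d := by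
  simp_rw [sin_P_add_Q (a := a), sin_P_sub_P, Finset.prod_mul_distrib]
  rw [sinQuot, mul_div_assoc]

lemma sum_normP_add_sum_normQ : ∑ c, normP P hbar c + ∑ c, normQ Q hbar a c =
    ((∑ c, P c) + ∑ c, Q c) / hbar + ∑ c, delta a c := by
  simp only [normP, normQ, Finset.sum_add_distrib, ← Finset.sum_div]
  ring

lemma exp_pi_mul_sum_delta : exp (I * Real.pi * ∑ c, delta a c) = ∏ c, deltaSign a c := by
  rw [Finset.mul_sum, Complex.exp_sum]
  exact Finset.prod_congr rfl fun c _ => exp_pi_mul_delta c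

/-- The Kronecker shifts contribute `∏ deltaSign` from the sines and its inverse from the
exponential; these agree because the product squares to `1`. -/
lemma upper_coefficient_eq (d : Fin (n + 1)) :
    exp (-(I * Real.pi * ((∑ c, P c) + (∑ c, Q c) - P d) / hbar)) *
        (∏ c : Fin n, sin (Real.pi * (P d + Q c) / hbar)) /
      (∏ c : {c : Fin (n + 1) // c ≠ d}, sin (Real.pi * (P d - P c) / hbar)) =
    exp (-(I * Real.pi * (∑ c, normP P hbar c + ∑ c, normQ Q hbar a c - normP P hbar d))) *
      sinQuot (normP P hbar) (normQ Q hbar a) d := by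
  rw [mul_div_assoc, prod_sin_div_prod_sin (a := a), sum_normP_add_sum_normQ,
    ← exp_pi_mul_sum_delta, ← mul_assoc, ← Complex.exp_add]
  have h : exp (-(I * Real.pi * (((∑ c, P c) + ∑ c, Q c) / hbar + ∑ c, delta a c -
      normP P hbar d))) * exp (I * Real.pi * ∑ c, delta a c) = exp (-(I * Real.pi *
      ((∑ c, P c) + (∑ c, Q c) - P d) / hbar)) := by
    rw [← Complex.exp_add]; congr 1; rw [normP]; ring
  have h1 : exp (I * Real.pi * ∑ c, delta a c) * exp (I * Real.pi * ∑ c, delta a c) = 1 := by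
    rw [exp_pi_mul_sum_delta]; exact prod_deltaSign_mul_self
  rw [Complex.exp_add, ← h]
  linear_combination (exp (-(I * Real.pi * (((∑ c, P c) + ∑ c, Q c) / hbar + ∑ c, delta a c -
      normP P hbar d))) * sinQuot (normP P hbar) (normQ Q hbar a) d) * h1

lemma lower_coefficient_eq (d : Fin (n + 1)) :
    exp (I * Real.pi * ((∑ c, P c) + (∑ c, Q c) - P d) / hbar) *
        (∏ c : Fin n, sin (Real.pi * (P d + Q c) / hbar)) /
      (∏ c : {c : Fin (n + 1) // c ≠ d}, sin (Real.pi * (P d - P c) / hbar)) =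
    exp (I * Real.pi * (∑ c, normP P hbar c + ∑ c, normQ Q hbar a c - normP P hbar d)) *
      sinQuot (normP P hbar) (normQ Q hbar a) d := by
  rw [mul_div_assoc, prod_sin_div_prod_sin (a := a), sum_normP_add_sum_normQ,
    ← exp_pi_mul_sum_delta, ← mul_assoc, ← Complex.exp_add]
  congr 2
  rw [normP]; ring

lemma psiBarLast_prefactor {x : ℂ} (hx : x / scale n hbar Λ ≠ 0) :
    (psiBarLast P Q hbar Λ a).prefactor x = exp (exp (log (x / scale n hbar Λ)) -
      (∑ c, normP P hbar c + ∑ c, normQ Q hbar a c) * log (x / scale n hbar Λ)) := by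
  have h : -(∑ c, normP P hbar c + ∑ c, normQ Q hbar a c) =
      -((∑ c, P c) + ∑ c, Q c) / hbar - (if a = Fin.last n then 0 else 1) := by
    rw [sum_normP_add_sum_normQ, sum_delta]; ring
  simp only [FormalSol.prefactor, psiBarLast]
  rw [← h, cpow_def_of_ne_zero hx, ← Complex.exp_add, Complex.exp_log hx]
  congr 1; ring

/-- A uniform error bound in terms of the logarithm gives the exponential asymptotic expansion. -/
lemma psiBarLast_isAsymptoticTo_of_bound (hs : scale n hbar Λ ≠ 0) {l : Filter ℂ} {F f : ℂ → ℂ}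
    {D : Set ℂ} (hl : l ≤ Bornology.cobounded ℂ)
    (hD : ∀ᶠ x in l, log (x / scale n hbar Λ) ∈ D)
    (hf : ∀ x, x / scale n hbar Λ ≠ 0 → f x = F (log (x / scale n hbar Λ)))
    (h : ∀ N : ℕ, ∃ C : ℝ, ∀ w ∈ D, 0 ≤ w.re →
      ‖F w * exp (-exp w + (∑ c, normP P hbar c + ∑ c, normQ Q hbar a c) * w) -
        ∑ j ∈ Finset.range N, domCoeff (normP P hbar) (normQ Q hbar a) j * exp (-j * w)‖ ≤
      C * Real.exp (-N * w.re)) :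
    (psiBarLast P Q hbar Λ a).IsAsymptoticTo l f := by
  intro N
  obtain ⟨C, hC⟩ := h N
  refine IsBigO.of_bound C ?_
  filter_upwards [hl (eventually_one_le_norm_div hs), hD] with x hx hxD
  have hx0 : x / scale n hbar Λ ≠ 0 := norm_pos_iff.1 (by linarith)
  have h1 := hC _ hxD (by rw [Complex.log_re]; exact Real.log_nonneg hx)
  rw [hf x hx0, psiBarLast_prefactor hx0]
  simp only [psiBarLast, expCoeff_eq_domCoeff]
  set w := log (x / scale n hbar Λ) with hw
  set μ := ∑ c, normP P hbar c + ∑ c, normQ Q hbar a c with hμ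
  have hpow : ∀ k : ℕ, ((x / scale n hbar Λ) ^ k)⁻¹ = exp (-k * w) := by
    intro k
    rw [neg_mul, Complex.exp_neg, Complex.exp_nat_mul, hw, Complex.exp_log hx0]
  simp only [hpow]
  -- Multiplying by the prefactor and by its inverse turns the relative error bound into an absolute
  -- one.
  have he : exp (exp w - μ * w) * exp (-exp w + μ * w) = 1 := by
    rw [← Complex.exp_add]; simp
  have hre : ‖exp (-N * w)‖ = Real.exp (-N * w.re) := by rw [Complex.norm_exp]; simp
  rw [norm_mul, hre]
  calc _ = ‖exp (exp w - μ * w) * (F w * exp (-exp w + μ * w) - ∑ j ∈ Finset.range N,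
        domCoeff (normP P hbar) (normQ Q hbar a) j * exp (-j * w))‖ := by
        congr 1
        rw [mul_sub, mul_left_comm, he, mul_one]
        rfl
    _ = ‖exp (exp w - μ * w)‖ * ‖F w * exp (-exp w + μ * w) - ∑ j ∈ Finset.range N,
        domCoeff (normP P hbar) (normQ Q hbar a) j * exp (-j * w)‖ := norm_mul _ _
    _ ≤ ‖exp (exp w - μ * w)‖ * (C * Real.exp (-N * w.re)) := by gcongr
    _ = _ := by ring

theorem psiBarLast_isAsymptoticTo_upper
    (hpp : ∀ b c, b ≠ c → ∀ m : ℤ, normP P hbar b - normP P hbar c ≠ m)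
    (hpq : ∀ b c, ∀ m : ℤ, normP P hbar b + normQ Q hbar a c ≠ m)
    (hs : scale n hbar Λ ≠ 0) :
    (psiBarLast P Q hbar Λ a).IsAsymptoticTo
      (Bornology.cobounded ℂ ⊓ 𝓟 {x : ℂ | 0 ≤ (x / (hbar * (-Λ) ^ (n + 1))).arg})
      (fun x : ℂ => ∑ d : Fin (n + 1),
        exp (-(I * Real.pi * ((∑ c, P c) + (∑ c, Q c) - P d) / hbar)) *
          (∏ c : Fin n, sin (Real.pi * (P d + Q c) / hbar)) /
          (∏ c : {c : Fin (n + 1) // c ≠ d}, sin (Real.pi * (P d - P c) / hbar)) *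
          chi P Q hbar Λ a d x) := by
  refine psiBarLast_isAsymptoticTo_of_bound hs (D := {w | 0 ≤ w.im ∧ w.im ≤ Real.pi})
    (F := dominantSol (normP P hbar) (normQ Q hbar a)) inf_le_left ?_ ?_ ?_
  · filter_upwards [mem_inf_of_right (mem_principal_self _)] with x hx
    exact ⟨by rw [Complex.log_im]; exact hx, Complex.log_im_le_pi _⟩
  · intro x hx
    rw [dominantSol]
    refine Finset.sum_congr rfl fun d _ => ?_
    rw [upper_coefficient_eq (a := a), chi_eq_analyticSol hpp hpq d hx]
  · intro N
    obtain ⟨C, hC⟩ := exists_norm_dominantRatio_sub_le hpp hpq N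
    exact ⟨C, fun w hw h0 => hC w h0 hw.1 (by linarith [hw.2, Real.pi_pos])⟩

/-- For `-π < Im w ≤ 0` the point `w + 2πi` lies in the upper part of the strip, and monodromy
rewrites `dominantRatio` there with the opposite exponentials at `w`. The partial sums are
`2πi`-periodic. -/
theorem psiBarLast_isAsymptoticTo_lower
    (hpp : ∀ b c, b ≠ c → ∀ m : ℤ, normP P hbar b - normP P hbar c ≠ m)
    (hpq : ∀ b c, ∀ m : ℤ, normP P hbar b + normQ Q hbar a c ≠ m)
    (hs : scale n hbar Λ ≠ 0) :
    (psiBarLast P Q hbar Λ a).IsAsymptoticTo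
      (Bornology.cobounded ℂ ⊓ 𝓟 {x : ℂ | (x / (hbar * (-Λ) ^ (n + 1))).arg ≤ 0})
      (fun x : ℂ => ∑ d : Fin (n + 1),
        exp (I * Real.pi * ((∑ c, P c) + (∑ c, Q c) - P d) / hbar) *
          (∏ c : Fin n, sin (Real.pi * (P d + Q c) / hbar)) /
          (∏ c : {c : Fin (n + 1) // c ≠ d}, sin (Real.pi * (P d - P c) / hbar)) *
          chi P Q hbar Λ a d x) := by
  refine psiBarLast_isAsymptoticTo_of_bound hs (D := {w | -Real.pi < w.im ∧ w.im ≤ 0})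
    (F := fun w => ∑ d, exp (I * Real.pi * (∑ c, normP P hbar c + ∑ c, normQ Q hbar a c -
      normP P hbar d)) * sinQuot (normP P hbar) (normQ Q hbar a) d *
      analyticSol (normP P hbar) (normQ Q hbar a) d w) inf_le_left ?_ ?_ ?_
  · filter_upwards [mem_inf_of_right (mem_principal_self _)] with x hx
    exact ⟨Complex.neg_pi_lt_log_im _, by rw [Complex.log_im]; exact hx⟩
  · intro x hx
    refine Finset.sum_congr rfl fun d _ => ?_
    rw [lower_coefficient_eq (a := a), chi_eq_analyticSol hpp hpq d hx]
  · intro N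
    obtain ⟨C, hC⟩ := exists_norm_dominantRatio_sub_le hpp hpq N
    refine ⟨C, fun w hw h0 => ?_⟩
    have him : (w + 2 * Real.pi * I).im = w.im + 2 * Real.pi := by simp
    have hre : (w + 2 * Real.pi * I).re = w.re := by simp
    have h := hC (w + 2 * Real.pi * I) (by rw [hre]; exact h0)
      (by rw [him]; linarith [hw.1, Real.pi_pos]) (by rw [him]; linarith [hw.2])
    have he : ∀ j : ℕ, exp (-(j : ℂ) * (w + 2 * Real.pi * I)) = exp (-j * w) := by
      intro j
      rw [show -(j : ℂ) * (w + 2 * Real.pi * I) = -j * w - j * (2 * Real.pi * I) by ring,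
        Complex.exp_sub, Complex.exp_nat_mul_two_pi_mul_I, div_one]
    simp only [he] at h
    rwa [hre, dominantRatio_add_two_pi] at h

theorem psiBar_isAsymptoticTo
    (hpp : ∀ b c, b ≠ c → ∀ m : ℤ, normP P hbar b - normP P hbar c ≠ m)
    (hpq : ∀ b c, ∀ m : ℤ, normP P hbar b + normQ Q hbar a c ≠ m)
    (hs : scale n hbar Λ ≠ 0)
    (hqq : ∀ b c, b ≠ c → ∀ m : ℤ, normQ Q hbar a b - normQ Q hbar a c ≠ m) (b : Fin n) :
    (psiBar P Q hbar Λ a b).IsAsymptoticTo (Bornology.cobounded ℂ)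
      (fun x : ℂ => 1 / (Real.pi : ℂ) * ∑ d : Fin (n + 1),
        (if b.castSucc = a then 1 else -1) *
          ((∏ c : Fin n, sin (Real.pi * (P d + Q c) / hbar)) *
            (∏ c : Fin (n + 1), sin (Real.pi * (P c + Q b) / hbar))) /
          (sin (Real.pi * (P d + Q b) / hbar) *
            (∏ c : {c : Fin n // c ≠ b}, sin (Real.pi * (Q b - Q c) / hbar)) *
            (∏ c : {c : Fin (n + 1) // c ≠ d}, sin (Real.pi * (P d - P c) / hbar))) *
          chi P Q hbar Λ a d x) := by
  set p := normP P hbar with hp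
  set q := normQ Q hbar a with hq
  set ε : ℂ := if b.castSucc = a then 1 else -1 with hε
  -- The factor between the normalisation of the formal solution and the residues `algCoeff`; the
  -- same factor appears in front of the combination of analytic solutions, where `π` from `π / sin`
  -- reduces `1/π²` to `1/π`.
  set R : ℂ := ε * (1 / (Real.pi : ℂ) ^ 2 * ((∏ c, sin (Real.pi * (p c + q b))) /
      ∏ c : {c // c ≠ b}, sin (Real.pi * (q b - q c)))) with hR
  have hpi : (Real.pi : ℂ) ≠ 0 := by exact_mod_cast Real.pi_ne_zero
  have hcoeff : ∀ k, (psiBar P Q hbar Λ a b).coeff k = R * algCoeff p q b k := by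
    intro k
    rw [hR, mul_assoc, ← algCoeff_eq hqq hpq b k]
    simp only [psiBar]
    rw [mul_assoc]
    have e1 : ∀ c, (Q b - Q c) / hbar + delta a b - delta a c = q b - q c := by
      intro c; rw [hq, normQ, normQ]; ring
    have e2 : ∀ c, (Q b + P c) / hbar + delta a b = q b + p c := by
      intro c; rw [hq, hp, normP, normQ]; ring
    have e3 : ∀ c, -(Q b + P c) / hbar + 1 - delta a b = 1 - q b - p c := by
      intro c; rw [hq, hp, normP, normQ]; ring
    have e4 : ∀ c, (Q c - Q b) / hbar + 1 + delta a c - delta a b = 1 + q c - q b := by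
      intro c; rw [hq, normQ, normQ]; ring
    simp only [e1, e2, e3, e4]
    rfl
  have hsum : ∀ x, x / scale n hbar Λ ≠ 0 → 1 / (Real.pi : ℂ) * ∑ d : Fin (n + 1),
        ε * ((∏ c : Fin n, sin (Real.pi * (P d + Q c) / hbar)) *
            (∏ c : Fin (n + 1), sin (Real.pi * (P c + Q b) / hbar))) /
          (sin (Real.pi * (P d + Q b) / hbar) *
            (∏ c : {c : Fin n // c ≠ b}, sin (Real.pi * (Q b - Q c) / hbar)) *
            (∏ c : {c : Fin (n + 1) // c ≠ d}, sin (Real.pi * (P d - P c) / hbar))) *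
          chi P Q hbar Λ a d x = R * ∑ d, Real.pi / sin (Real.pi * (p d + q b)) *
            sinQuot p q d * analyticSol p q d (log (x / scale n hbar Λ)) := by
    intro x hx
    rw [Finset.mul_sum, Finset.mul_sum]
    refine Finset.sum_congr rfl fun d _ => ?_
    rw [chi_eq_analyticSol hpp hpq d hx, ← mul_assoc, ← mul_assoc R]
    congr 1
    have hb := deltaSign_ne_zero (a := a) b
    have hbb := deltaSign_mul_self (a := a) b
    have hpow : deltaSign a b * ∏ _c : {c : Fin n // c ≠ b}, deltaSign a b =
        deltaSign a b ^ n := by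
      rw [← prod_eq_mul_prod_subtype_ne (fun _ => deltaSign a b) b]; simp
    have hS := prod_eq_mul_prod_subtype_ne (fun c => deltaSign a c) b
    have hT0 : ∏ c : {c : Fin n // c ≠ b}, deltaSign a (c : Fin n) ≠ 0 :=
      Finset.prod_ne_zero_iff.2 fun c _ => deltaSign_ne_zero _
    have hU0 : ∏ _c : {c : Fin n // c ≠ b}, deltaSign a b ≠ 0 :=
      Finset.prod_ne_zero_iff.2 fun _ _ => hb
    have hQ : ∏ c : {c : Fin n // c ≠ b}, sin (Real.pi * (Q b - Q c) / hbar) =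
        (∏ _c : {c : Fin n // c ≠ b}, deltaSign a b) *
          (∏ c : {c : Fin n // c ≠ b}, deltaSign a (c : Fin n)) *
          ∏ c : {c : Fin n // c ≠ b}, sin (Real.pi * (q b - q c)) := by
      rw [← Finset.prod_mul_distrib, ← Finset.prod_mul_distrib]
      exact Finset.prod_congr rfl fun c _ => sin_Q_sub_Q b c
    have hPb : ∏ c : Fin (n + 1), sin (Real.pi * (P c + Q b) / hbar) =
        deltaSign a b ^ (n + 1) * ∏ c, sin (Real.pi * (p c + q b)) := by
      simp_rw [sin_P_add_Q (a := a), Finset.prod_mul_distrib]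
      simp [hp, hq]
    have hnum : ∏ c : Fin n, sin (Real.pi * (P d + Q c) / hbar) =
        (∏ c, deltaSign a c) * ∏ c, sin (Real.pi * (p d + q c)) := by
      simp_rw [sin_P_add_Q (a := a), Finset.prod_mul_distrib]
      simp [hp, hq]
    rw [hnum, hPb, hQ, sin_P_add_Q (a := a) d b, hR]
    have hsq : sinQuot p q d = (∏ c, sin (Real.pi * (p d + q c))) /
        ∏ c : {c : Fin (n + 1) // c ≠ d}, sin (Real.pi * (p d - p c)) := rfl
    rw [hsq, pow_succ, ← hpow, hS]
    simp_rw [sin_P_sub_P]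
    set T := ∏ c : {c : Fin n // c ≠ b}, deltaSign a (c : Fin n)
    set U := ∏ _c : {c : Fin n // c ≠ b}, deltaSign a b
    have hs0 := sin_pi_mul_ne_zero (hpq d b)
    have hs1 : ∏ c : {c // c ≠ b}, sin (Real.pi * (q b - q c)) ≠ 0 :=
      Finset.prod_ne_zero_iff.2 fun c _ => sin_pi_mul_ne_zero (hqq b c (Ne.symm c.2))
    have hs2 : ∏ c : {c : Fin (n + 1) // c ≠ d}, sin (Real.pi * (p d - p c)) ≠ 0 :=
      Finset.prod_ne_zero_iff.2 fun c _ => sin_pi_mul_ne_zero (hpp d c (Ne.symm c.2))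
    rw [← hp, ← hq]
    field_simp
    linear_combination (ε * (∏ c, sin (Real.pi * (p d + q c))) *
      ∏ c, sin (Real.pi * (p c + q b))) * hbb
  refine FormalSol.isAsymptoticTo_of_forall_exists (eventually_one_le_norm_div hs) fun N => ?_
  obtain ⟨K, hK, C, hC⟩ := exists_norm_sum_analyticSol_sub_le hpp hpq b N
  -- The last factor bounds the oscillation of the complex power: the error estimate is in terms of
  -- `|z|^{Re s}`, while the required one is in terms of `|z^s|`, with `s = q b - 1 - N`.
  refine ⟨K, hK, ‖R‖ * |C| * Real.exp (Real.pi * |(q b - 1 - N).im|), ?_⟩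
  filter_upwards [eventually_one_le_norm_div hs] with x hx
  have hx0 : x / scale n hbar Λ ≠ 0 := norm_pos_iff.1 (by linarith)
  rw [hsum x hx0]
  simp_rw [hcoeff]
  have hexpo : (psiBar P Q hbar Λ a b).exponent = q b - 1 := by
    simp only [psiBar, hq, normQ]; ring
  have hpre : (psiBar P Q hbar Λ a b).prefactor x = exp (log (x / scale n hbar Λ) * (q b - 1)) := by
    rw [FormalSol.prefactor, hexpo]
    simp only [psiBar, zero_mul, Complex.exp_zero, one_mul]
    rw [cpow_def_of_ne_zero hx0]
  rw [hpre]
  simp only [psiBar]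
  have him : |(log (x / scale n hbar Λ)).im| ≤ Real.pi := by
    rw [Complex.log_im]; exact Complex.abs_arg_le_pi _
  have hre : 0 ≤ (log (x / scale n hbar Λ)).re := by
    rw [Complex.log_re]; exact Real.log_nonneg hx
  have hexplog := Complex.exp_log hx0
  set w := log (x / scale n hbar Λ) with hw
  have hpow : ∀ k : ℕ, ((x / scale n hbar Λ) ^ k)⁻¹ = exp (-k * w) := by
    intro k
    rw [neg_mul, Complex.exp_neg, Complex.exp_nat_mul, hexplog]
  simp only [hpow]
  have hs1 : exp (w * (q b - 1)) * ∑ k ∈ Finset.range K, R * algCoeff p q b k * exp (-k * w) =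
      R * ∑ k ∈ Finset.range K, algCoeff p q b k * exp (w * (q b - 1 - k)) := by
    rw [Finset.mul_sum, Finset.mul_sum]
    refine Finset.sum_congr rfl fun k _ => ?_
    rw [show w * (q b - 1 - k) = w * (q b - 1) + -k * w by ring, Complex.exp_add]
    ring
  have hs2 : exp (w * (q b - 1)) * exp (-N * w) = exp (w * (q b - 1 - N)) := by
    rw [← Complex.exp_add]; congr 1; ring
  rw [hs1, hs2, ← mul_sub, norm_mul, mul_assoc, mul_assoc]
  refine mul_le_mul_of_nonneg_left ((hC w him hre).trans ?_) (norm_nonneg _)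
  have hn := norm_exp_mul_le (s := q b - 1 - N) him
  have hres : (q b - 1 - N).re = (q b).re - 1 - N := by simp
  rw [hres] at hn
  exact mul_le_mul (le_abs_self C) hn (Real.exp_pos _).le (abs_nonneg _)

end CDO

end
theorem proposition5p11 (n : ℕ) (P : Fin (n + 1) → ℂ) (Q : Fin n → ℂ) (hbar Λ : ℂ)
    (hhbar : hbar ≠ 0) (hΛ : Λ ≠ 0)
    (hPP : ∀ b c : Fin (n + 1), b ≠ c → ∀ m : ℤ, P b - P c ≠ hbar * m)
    (hQQ : ∀ b c : Fin n, b ≠ c → ∀ m : ℤ, Q b - Q c ≠ hbar * m)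
    (hPQ : ∀ (b : Fin (n + 1)) (c : Fin n) (m : ℤ), P b + Q c ≠ hbar * m)
    (a : Fin (n + 1)) :
    (∀ b : Fin n,
      (CDO.psiBar P Q hbar Λ a b).IsAsymptoticTo (Bornology.cobounded ℂ)
        (fun x : ℂ => 1 / (Real.pi : ℂ) * ∑ d : Fin (n + 1),
          (if b.castSucc = a then 1 else -1) *
            ((∏ c : Fin n, Complex.sin (Real.pi * (P d + Q c) / hbar)) *
              (∏ c : Fin (n + 1), Complex.sin (Real.pi * (P c + Q b) / hbar))) /
            (Complex.sin (Real.pi * (P d + Q b) / hbar) *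
              (∏ c : {c : Fin n // c ≠ b}, Complex.sin (Real.pi * (Q b - Q c) / hbar)) *
              (∏ c : {c : Fin (n + 1) // c ≠ d}, Complex.sin (Real.pi * (P d - P c) / hbar))) *
            CDO.chi P Q hbar Λ a d x)) ∧
    (CDO.psiBarLast P Q hbar Λ a).IsAsymptoticTo
      (Bornology.cobounded ℂ ⊓
        Filter.principal {x : ℂ | 0 ≤ (x / (hbar * (-Λ) ^ (n + 1))).arg})
      (fun x : ℂ => ∑ d : Fin (n + 1),
        Complex.exp (-(Complex.I * Real.pi * ((∑ c, P c) + (∑ c, Q c) - P d) / hbar)) *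
          (∏ c : Fin n, Complex.sin (Real.pi * (P d + Q c) / hbar)) /
          (∏ c : {c : Fin (n + 1) // c ≠ d}, Complex.sin (Real.pi * (P d - P c) / hbar)) *
          CDO.chi P Q hbar Λ a d x) ∧
    (CDO.psiBarLast P Q hbar Λ a).IsAsymptoticTo
      (Bornology.cobounded ℂ ⊓
        Filter.principal {x : ℂ | (x / (hbar * (-Λ) ^ (n + 1))).arg ≤ 0})
      (fun x : ℂ => ∑ d : Fin (n + 1),
        Complex.exp (Complex.I * Real.pi * ((∑ c, P c) + (∑ c, Q c) - P d) / hbar) *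
          (∏ c : Fin n, Complex.sin (Real.pi * (P d + Q c) / hbar)) /
          (∏ c : {c : Fin (n + 1) // c ≠ d}, Complex.sin (Real.pi * (P d - P c) / hbar)) *
          CDO.chi P Q hbar Λ a d x) := by
  have hs := CDO.scale_ne_zero (n := n) hhbar hΛ
  have hpp := CDO.normP_sub_ne hhbar hPP
  have hpq := CDO.normP_add_normQ_ne (a := a) hhbar hPQ
  exact ⟨CDO.psiBar_isAsymptoticTo hpp hpq hs (CDO.normQ_sub_ne hhbar hQQ),
    CDO.psiBarLast_isAsymptoticTo_upper hpp hpq hs, CDO.psiBarLast_isAsymptoticTo_lower hpp hpq hs⟩
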